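/- Let $k_0$ be a commutative ring, $k$ a field with a $k_0$-algebra structure, and $Z=\operatorname{Spec} k$. Let $M_0$ be a formal monoid over $\operatorname{Spec} k_0$, i.e. a monoid object in ind-(finite flat schemes) over $\operatorname{Spec}k_0$, represented by a cofiltered system $E_0=(E_{0,i})_i$ of finite flat $k_0$-algebras, and assume that it is quasi-separable: for every field $K$ over $k_0$, the reduced algebra of $K\otimes_{k_0}E_{0,i}$ is separable over $K$. Let $E_i=k\otimes_{k_0}E_{0,i}$ and $E=(E_i)_i$; write $e$ and $m$ for the unit $\operatorname{Spec}k\to\operatorname{Spec}E$ and the product $\operatorname{Spec}(E\otimes_kE)\to\operatorname{Spec}E$ of $M_0\times Z$ over $k$. An action of $M_0$ on $Z$ is a unital and associative left action $\mu:M_0\times Z\to Z$ over $k_0$; it is given by the map of pro-$k_0$-algebras $\mu^\#:k\to E$. Let $\mathrm{Vec}_k$ be the category of finite dimensional $k$-vector spaces. For a finite $k$-algebra $F$, a finite dimensional $F$-module $X$ is called $F$-injective if $X^\vee=\operatorname{Hom}_k(X,k)$ is a flat $F$-module, and $X\otimes^FY\subseteq X\otimes_kY$ is the largest subspace on which the two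 actions of $F$ agree (its unit is $F^\vee$). For a map $f:F\to F'$ put $f^!X=\operatorname{Hom}_F(F',X)$. The prolongation $\mathrm{Plng}^E$ of $\mathrm{Vec}_k$ is the tensor category of systems of $E_i$-injective modules $X_i$ with compatible isomorphisms $X_j\cong f^!X_i$ for the transition maps $f:E_i\to E_j$, with the tensor products $\otimes^{E_i}$; a map of pro-finite algebras $E\to E'$ induces a tensor functor $(-)^!:\mathrm{Plng}^E\to\mathrm{Plng}^{E'}$. An $E_0$-structure on $\mathrm{Vec}_k$ is a triple $(\tau,a,b)$ of a $k_0$-linear tensor functor $\tau:\mathrm{Vec}_k\to\mathrm{Plng}^E$ that is exact as a functor to $E$-modules, a $k$-linear tensor isomorphism $a:e^!\circ\tau\to\mathrm{Id}$, and an $E\otimes_kE$-linear tensor isomorphism $b:\tau\circ\tau\to m^!\circ\tau$. Here, in $\tau_j(\tau_i(X))$, the first factor $E_{0,i}$ acts by functoriality of $\tau_j$ and the second factor $E_{0,j}$ acts through the module structure of $\tau_j$. An isomorphism $(\tau,a,b)\to(\sigma,c,d)$ is an $E$-linear isomorphism $\tau\to\sigma$ of tensor functors that commutes with $a,c$ and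 with $b,d$. Such a structure determines a $k_0$-algebra map $$\tau_{\mathbf 1}:k=\operatorname{End}(\mathbf 1)\to\operatorname{End}(\tau(\mathbf 1))=\operatorname{End}_E(E^\vee)=E .$$ **Proposition.** For every $E_0$-structure on $\mathrm{Vec}_k$ the map $\tau_{\mathbf 1}$ is $\mu^\#$ for an action $\mu$ of $M_0$ on $Z$ over $k_0$, and $(\tau,a,b)\mapsto\mu$ induces a bijection from the set of isomorphism classes of $E_0$-structures on $\mathrm{Vec}_k$ to the set of actions of $M_0$ on $Z=\operatorname{Spec}k$ over $k_0$. The functor $\tau$ of a structure in the class that corresponds to $\mu$ is isomorphic to $X\mapsto E^\vee\otimes_\mu X$, where the tensor product over $k$ is formed with the $k$-structure of $E^\vee$ given by $\mu^\#$ (and where the isomorphism is $E$-linear, natural in $X$, and compatible with the transition maps and with $\tau(\mathbf 1)\cong E^\vee$). -/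

import Mathlib

open CategoryTheory MonoidalCategory TensorProduct

universe u

noncomputable section

namespace ETensor

/-! ## Formal sets, formal monoids and their actions on an affine scheme -/

/-- A commutative algebra over a field is quasi-separable if it is finite and the associated
reduced algebra is separable. -/
def IsQuasiSeparableAlgebra (K A : Type u) [Field K] [CommRing A] [Algebra K A] : Prop :=
  Module.Finite K A ∧ Algebra.IsSeparable K (A ⧸ nilradical A)

/-- A formal set over `Spec R`: an ind-object in finite flat schemes over `Spec R`, given by the
corresponding pro-finite algebra, i.e. a cofiltered system of finite flat commutative
`R`-algebras. -/
structure FormalSet (R : Type u) [CommRing R] where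
  /-- the index category -/
  I : Type u
  [cat : SmallCategory I]
  [cofiltered : IsCofiltered I]
  /-- the system of algebras -/
  alg : I ⥤ CommAlgCat.{u} R
  [finite : ∀ i, Module.Finite R (alg.obj i)]
  [flat : ∀ i, Module.Flat R (alg.obj i)]

attribute [instance] FormalSet.cat FormalSet.cofiltered FormalSet.finite FormalSet.flat

namespace FormalSet

variable {R : Type u} [CommRing R] (M : FormalSet R)

/-- The algebra of the system with index `i`. -/
abbrev A (i : M.I) : Type u := M.alg.obj i

/-- The transition map of the system. -/
abbrev tr {i j : M.I} (u : i ⟶ j) : M.A i →ₐ[R] M.A j := (M.alg.map u).hom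

/-- All the schemes of the system are quasi-separable: for every point of `Spec R` with values in
a field, the fibre is the spectrum of a quasi-separable algebra. -/
def IsQuasiSeparable : Prop :=
  ∀ (i : M.I) (K : Type u) [Field K] [Algebra R K], IsQuasiSeparableAlgebra K (K ⊗[R] M.A i)

/-- The base change of a formal set to `Spec S`. -/
abbrev baseChange (S : Type u) [CommRing S] [Algebra R S] : FormalSet S where
  I := M.I
  alg :=
    { obj := fun i => CommAlgCat.of S (S ⊗[R] M.A i)
      map := fun u => CommAlgCat.ofHom (Algebra.TensorProduct.map (AlgHom.id S S) (M.tr u))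
      map_id := fun i => by
        ext x
        simp [tr]
      map_comp := fun u v => by
        ext x
        simp [tr] }
  finite := fun i => (inferInstance : Module.Finite S (S ⊗[R] M.A i))
  flat := fun i => (inferInstance : Module.Flat S (S ⊗[R] M.A i))

section Points

variable (B : Type u) [CommRing B] [Algebra R B]

/-- The relation that generates the identifications in `colim_i Hom_R(A_i, B)`. -/
def PointRel (p q : Σ i : M.I, (M.A i →ₐ[R] B)) : Prop :=
  ∃ u : q.1 ⟶ p.1, q.2 = p.2.comp (M.tr u)

/-- The functor of points of a formal set: `M(B) = colim_i Hom_R(A_i, B)`, the set of morphisms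
of ind-schemes over `Spec R` from `Spec B` to `M`. -/
def Points : Type u := Quot (M.PointRel B)

variable {B}

/-- The `B`-point of `M` represented by an algebra map `A_i → B`. -/
def point (i : M.I) (φ : M.A i →ₐ[R] B) : M.Points B := Quot.mk _ ⟨i, φ⟩

/-- Functoriality of the points in the test algebra. -/
def Points.map {M : FormalSet R} {C : Type u} [CommRing C] [Algebra R C] (f : B →ₐ[R] C) :
    M.Points B → M.Points C :=
  Quot.map (fun p => ⟨p.1, f.comp p.2⟩) (fun p q => by
    rintro ⟨u, hu⟩
    exact ⟨u, by rw [hu]; rfl⟩)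

end Points

end FormalSet

/-- A formal monoid over `Spec R`: a monoid object in formal sets, given by a monoid structure on
its functor of points. -/
structure FormalMonoid (R : Type u) [CommRing R] extends FormalSet R where
  [monoid : ∀ (B : Type u) [CommRing B] [Algebra R B], Monoid (toFormalSet.Points B)]
  map_one : ∀ {B C : Type u} [CommRing B] [Algebra R B] [CommRing C] [Algebra R C]
    (f : B →ₐ[R] C), FormalSet.Points.map f (1 : toFormalSet.Points B) = 1
  map_mul : ∀ {B C : Type u} [CommRing B] [Algebra R B] [CommRing C] [Algebra R C]
    (f : B →ₐ[R] C) (g h : toFormalSet.Points B),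
    FormalSet.Points.map f (g * h) = FormalSet.Points.map f g * FormalSet.Points.map f h

attribute [instance] FormalMonoid.monoid

variable {k₀ : Type u} [CommRing k₀]

/-- A (left) action `M × Spec k → Spec k` over `Spec k₀`, given on `B`-points for every
`k₀`-algebra `B`. -/
@[ext]
structure Action (M : FormalMonoid k₀) (k : Type u) [CommRing k] [Algebra k₀ k] where
  /-- the action of `M(B)` on `(Spec k)(B)` -/
  smul : ∀ (B : Type u) [CommRing B] [Algebra k₀ B],
    M.Points B → (k →ₐ[k₀] B) → (k →ₐ[k₀] B)
  natural : ∀ {B C : Type u} [CommRing B] [Algebra k₀ B] [CommRing C] [Algebra k₀ C]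
    (f : B →ₐ[k₀] C) (g : M.Points B) (z : k →ₐ[k₀] B),
    f.comp (smul B g z) = smul C (g.map f) (f.comp z)
  one_smul : ∀ (B : Type u) [CommRing B] [Algebra k₀ B] (z : k →ₐ[k₀] B), smul B 1 z = z
  mul_smul : ∀ (B : Type u) [CommRing B] [Algebra k₀ B] (g h : M.Points B) (z : k →ₐ[k₀] B),
    smul B (g * h) z = smul B g (smul B h z)

/-- The component `k → E_i = k ⊗ A_i` of the map of pro-algebras `μ^# : k → E` that corresponds to
the action `μ : M × Spec k → Spec k`: the action of the tautological point `Spec E_i → M` on the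
tautological point `Spec E_i → Spec k`. -/
def Action.coaction {M : FormalMonoid k₀} {k : Type u} [CommRing k] [Algebra k₀ k]
    (μ : Action M k) (i : M.I) : k →ₐ[k₀] (k ⊗[k₀] M.A i) :=
  μ.smul (k ⊗[k₀] M.A i) (M.point i Algebra.TensorProduct.includeRight)
    Algebra.TensorProduct.includeLeft

/-! ## Modules in `Vec_k` over finite algebras

A module over a `k`-algebra `A` in `Vec_k` is an object `X` with an algebra map `A → End(X)`. -/

section Modules

variable {k : Type u} [Field k]
variable {A : Type u} [CommRing A] [Algebra k A] {B : Type u} [CommRing B] [Algebra k B]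
variable {X : Type u} [AddCommGroup X] [Module k X] {Y : Type u} [AddCommGroup Y] [Module k Y]

/-- The action of `A` on the dual of an `A`-module. -/
def dualAction (ρ : A →ₐ[k] Module.End k X) : A →+* Module.End k (Module.Dual k X) where
  toFun a := (ρ a).dualMap
  map_one' := by ext; simp
  map_mul' a b := by
    ext
    rw [mul_comm]
    simp
  map_zero' := by ext; simp
  map_add' a b := by ext; simp

/-- An `A`-module in `Vec_k` is `A`-injective if its dual is a flat `A`-module. -/
def IsInjectiveAction (ρ : A →ₐ[k] Module.End k X) : Prop :=
  letI : Module A (Module.Dual k X) := Module.compHom _ (dualAction ρ)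
  Module.Flat A (Module.Dual k X)

/-- The tensor product `X ⊗^A Y`: the largest subspace of `X ⊗ Y` on which the two actions of `A`
agree. -/
def dualTensor (ρ : A →ₐ[k] Module.End k X) (σ : A →ₐ[k] Module.End k Y) :
    Submodule k (X ⊗[k] Y) :=
  ⨅ a : A, LinearMap.eqLocus
    (TensorProduct.map (ρ a) LinearMap.id) (TensorProduct.map LinearMap.id (σ a))

/-- The pullback `f^! X = Hom_A(B, X)` of an `A`-module along an algebra map `f : A → B`. The
element `b` of `B` acts on it by sending `h` to `y ↦ h (b * y)`. -/
def shriek (f : A →ₐ[k] B) (ρ : A →ₐ[k] Module.End k X) : Submodule k (B →ₗ[k] X) where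
  carrier := {h | ∀ a y, h (f a * y) = ρ a (h y)}
  add_mem' h₁ h₂ a y := by simp [h₁ a y, h₂ a y]
  zero_mem' a y := by simp
  smul_mem' c h hh a y := by simp [hh a y]

/-- The map `Y → f^! X`, `y ↦ (b ↦ t (b y))`, adjoint to an `A`-linear map `t : Y → X` from a
`B`-module to an `A`-module. -/
def toShriek (f : A →ₐ[k] B) (ρ : A →ₐ[k] Module.End k X) (σ : B →ₐ[k] Module.End k Y)
    (t : Y →ₗ[k] X) (ht : ∀ a y, t (σ (f a) y) = ρ a (t y)) : Y →ₗ[k] shriek f ρ where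
  toFun y := ⟨t.comp ((LinearMap.applyₗ y).comp σ.toLinearMap), fun a b => by simp [ht]⟩
  map_add' y z := by ext; simp
  map_smul' c y := by ext; simp

/-- An `A'`-linear map `t : X → Y` from an `A`-module to an `A'`-module, where `g : A' → A`, induces
a map `f^! X → f'^! Y`, `h ↦ t ∘ h`, for `f' = f g`. -/
def shriekMap {A' : Type u} [CommRing A'] [Algebra k A'] (f : A →ₐ[k] B) (f' : A' →ₐ[k] B) (g : A' →ₐ[k] A)
    (hf : f' = f.comp g) (ρ : A →ₐ[k] Module.End k X) (σ : A' →ₐ[k] Module.End k Y)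
    (t : X →ₗ[k] Y) (ht : ∀ a x, t (ρ (g a) x) = σ a (t x)) :
    shriek f ρ →ₗ[k] shriek f' σ where
  toFun h := ⟨t.comp h.1, fun a y => by simp [hf, h.2 (g a) y, ht]⟩
  map_add' h₁ h₂ := by ext; simp
  map_smul' c h := by ext; simp

/-- The evaluation `f^! X → X` at `1`. The tensor structure of `f^!`, i.e. the isomorphism
`f^! X ⊗^B f^! Y ≅ f^! (X ⊗^A Y)`, is the one that is compatible with these evaluations. -/
def shriekEval (f : A →ₐ[k] B) (ρ : A →ₐ[k] Module.End k X) : shriek f ρ →ₗ[k] X :=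
  (LinearMap.applyₗ (1 : B)).comp (Submodule.subtype _)

/-- Functoriality of `f^!`. -/
def shriekCongr (f : A →ₐ[k] B) (ρ : A →ₐ[k] Module.End k X) (σ : A →ₐ[k] Module.End k Y)
    (t : X →ₗ[k] Y) (ht : ∀ a x, t (ρ a x) = σ a (t x)) :
    shriek f ρ →ₗ[k] shriek f σ where
  toFun h := ⟨t.comp h.1, fun a y => by simp [h.2 a y, ht]⟩
  map_add' h₁ h₂ := by ext; simp
  map_smul' c h := by ext; simp

end Modules

/-! ## The prolongation category of `Vec_k` -/

variable {k : Type u} [Field k]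

/-- An object of the `E`-prolongation of `Vec_k`, for a pro-finite algebra `E = (E_i)` over `k`: an
`E_i`-injective module `X_i` in `Vec_k` for each `i`, and compatible isomorphisms `X_j → f^! X_i`
for the transition maps `f : E_i → E_j`. The latter are given by the adjoint `E_i`-linear maps
`X_j → X_i`. -/
structure Plng (E : FormalSet k) where
  /-- the components -/
  X : E.I → FGModuleCat.{u} k
  /-- the module structures -/
  ρ : ∀ i, E.A i →ₐ[k] Module.End k (X i)
  injective : ∀ i, IsInjectiveAction (ρ i)
  /-- the transition maps -/
  t : ∀ {i j : E.I} (_ : i ⟶ j), X j →ₗ[k] X i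
  t_id : ∀ i x, t (𝟙 i) x = x
  t_comp : ∀ {i j l : E.I} (u : i ⟶ j) (v : j ⟶ l) x, t (u ≫ v) x = t u (t v x)
  t_linear : ∀ {i j : E.I} (u : i ⟶ j) a x, t u (ρ j (E.tr u a) x) = ρ i a (t u x)
  cartesian : ∀ {i j : E.I} (u : i ⟶ j),
    Function.Bijective (toShriek (E.tr u) (ρ i) (ρ j) (t u) (t_linear u))

namespace Plng

variable {E : FormalSet k}

/-- A morphism of the prolongation category: compatible `E_i`-linear maps. -/
@[ext]
structure Hom (V W : Plng E) where
  /-- the components -/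
  app : ∀ i, V.X i →ₗ[k] W.X i
  linear : ∀ i a x, app i (V.ρ i a x) = W.ρ i a (app i x)
  comm : ∀ {i j : E.I} (u : i ⟶ j) x, app i (V.t u x) = W.t u (app j x)

instance : Category (Plng E) where
  Hom := Hom
  id V := ⟨fun _ => LinearMap.id, fun _ _ _ => rfl, fun _ _ => rfl⟩
  comp f g := ⟨fun i => (g.app i).comp (f.app i),
    fun i a x => by simp [f.linear, g.linear], fun u x => by simp [f.comm, g.comm]⟩

end Plng

section Functors

variable {E : FormalSet k} (τ : FGModuleCat.{u} k ⥤ Plng E)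

/-- The component of `τ` with index `i`, viewed as a functor to `Vec_k`: the linear map
`τ_i(X) → τ_i(Y)` induced by `f : X → Y`. -/
abbrev tmap (i : E.I) {X Y : FGModuleCat.{u} k} (f : X ⟶ Y) :
    (τ.obj X).X i →ₗ[k] (τ.obj Y).X i := (τ.map f).app i

/-- As `tmap`, for a linear map between objects of `Vec_k`. -/
abbrev tmapₗ (i : E.I) {X Y : FGModuleCat.{u} k} (f : X →ₗ[k] Y) :
    (τ.obj X).X i →ₗ[k] (τ.obj Y).X i :=
  tmap τ i (⟨ModuleCat.ofHom f⟩ : X ⟶ Y)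

theorem tmapₗ_id (i : E.I) (X : FGModuleCat.{u} k) (w : (τ.obj X).X i) :
    tmapₗ τ i (LinearMap.id : X →ₗ[k] X) w = w :=
  congrArg (fun f : τ.obj X ⟶ τ.obj X => Plng.Hom.app f i w) (τ.map_id X)

theorem tmapₗ_comp (i : E.I) {X Y Z : FGModuleCat.{u} k} (f : X →ₗ[k] Y) (g : Y →ₗ[k] Z)
    (w : (τ.obj X).X i) : tmapₗ τ i (g.comp f) w = tmapₗ τ i g (tmapₗ τ i f w) :=
  congrArg (fun h : τ.obj X ⟶ τ.obj Z => Plng.Hom.app h i w)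
    (τ.map_comp (⟨ModuleCat.ofHom f⟩ : X ⟶ Y) (⟨ModuleCat.ofHom g⟩ : Y ⟶ Z))

variable {τ} in
theorem naturality_tmapₗ {σ : FGModuleCat.{u} k ⥤ Plng E} (u : τ ⟶ σ) (i : E.I)
    {X Y : FGModuleCat.{u} k} (f : X →ₗ[k] Y) (w : (τ.obj X).X i) :
    (u.app Y).app i (tmapₗ τ i f w) = tmapₗ σ i f ((u.app X).app i w) :=
  congrArg (fun h : τ.obj X ⟶ σ.obj Y => Plng.Hom.app h i w)
    (u.naturality (⟨ModuleCat.ofHom f⟩ : X ⟶ Y))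

/-- The structure of a tensor functor on `τ`: functorial `E`-linear isomorphisms
`τ(X ⊗ Y) ≅ τ(X) ⊗^E τ(Y)` and `τ(𝟙) ≅ E^∨`, compatible with the associativity, commutativity and
unit constraints. The constraints of `⊗^E` are restrictions of those of `⊗`, so that the
compatibilities are stated inside tensor products over `k`. The unit constraint
`E^∨ ⊗^E X → X` is given by the evaluation `E^∨ → k` at `1`. -/
structure TensorStructure where
  /-- the isomorphisms `τ_i(X ⊗ Y) ≅ τ_i(X) ⊗^{E_i} τ_i(Y)` -/
  mulIso : ∀ (i : E.I) (X Y : FGModuleCat.{u} k),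
    (τ.obj (X ⊗ Y)).X i ≃ₗ[k] dualTensor ((τ.obj X).ρ i) ((τ.obj Y).ρ i)
  /-- the isomorphisms `τ_i(𝟙) ≅ E_i^∨` -/
  unitIso : ∀ i : E.I, (τ.obj (𝟙_ (FGModuleCat.{u} k))).X i ≃ₗ[k] Module.Dual k (E.A i)
  mul_linear : ∀ i X Y a w,
    (mulIso i X Y ((τ.obj (X ⊗ Y)).ρ i a w)).1 =
      TensorProduct.map ((τ.obj X).ρ i a) LinearMap.id (mulIso i X Y w).1
  mul_trans : ∀ {i j : E.I} (u : i ⟶ j) X Y w,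
    (mulIso i X Y ((τ.obj (X ⊗ Y)).t u w)).1 =
      TensorProduct.map ((τ.obj X).t u) ((τ.obj Y).t u) (mulIso j X Y w).1
  unit_linear : ∀ i a w y,
    unitIso i ((τ.obj (𝟙_ (FGModuleCat.{u} k))).ρ i a w) y = unitIso i w (a * y)
  unit_trans : ∀ {i j : E.I} (u : i ⟶ j) w y,
    unitIso i ((τ.obj (𝟙_ (FGModuleCat.{u} k))).t u w) y = unitIso j w (E.tr u y)
  natural : ∀ i {X X' Y Y' : FGModuleCat.{u} k} (f : X ⟶ X') (g : Y ⟶ Y') w,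
    (mulIso i X' Y' (tmap τ i (f ⊗ₘ g) w)).1 =
      TensorProduct.map (tmap τ i f) (tmap τ i g) (mulIso i X Y w).1
  assoc : ∀ i (X Y Z : FGModuleCat.{u} k) w,
    TensorProduct.assoc k _ _ _
      (TensorProduct.map ((Submodule.subtype _).comp (mulIso i X Y).toLinearMap) LinearMap.id
        (mulIso i (X ⊗ Y) Z w).1) =
      TensorProduct.map LinearMap.id ((Submodule.subtype _).comp (mulIso i Y Z).toLinearMap)
        (mulIso i X (Y ⊗ Z) (tmap τ i (α_ X Y Z).hom w)).1
  comm : ∀ i (X Y : FGModuleCat.{u} k) w,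
    TensorProduct.comm k _ _ (mulIso i X Y w).1 = (mulIso i Y X (tmap τ i (β_ X Y).hom w)).1
  unit : ∀ i (X : FGModuleCat.{u} k) w,
    TensorProduct.lid k _
      (TensorProduct.map ((LinearMap.applyₗ (1 : E.A i)).comp (unitIso i).toLinearMap)
        LinearMap.id (mulIso i (𝟙_ (FGModuleCat.{u} k)) X w).1) =
      tmap τ i (λ_ X).hom w

variable {τ}

/-- The map `δ : τ_i(X ⊗ Y) → τ_i(X) ⊗ τ_i(Y)`, the isomorphism onto `τ_i(X) ⊗^{E_i} τ_i(Y)`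
followed by the inclusion. -/
def TensorStructure.δ (T : TensorStructure τ) (i : E.I) (X Y : FGModuleCat.{u} k) :
    (τ.obj (X ⊗ Y)).X i →ₗ[k] (τ.obj X).X i ⊗[k] (τ.obj Y).X i :=
  (Submodule.subtype _).comp (T.mulIso i X Y).toLinearMap

/-- The map `ε : τ_i(𝟙) → k`, the isomorphism with `E_i^∨` followed by the evaluation at `1`. -/
def TensorStructure.ε (T : TensorStructure τ) (i : E.I) :
    (τ.obj (𝟙_ (FGModuleCat.{u} k))).X i →ₗ[k] k :=
  (LinearMap.applyₗ (1 : E.A i)).comp (T.unitIso i).toLinearMap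

/-- `τ`, as a functor to `E`-modules, is exact: each component preserves short exact sequences. -/
def IsExactFunctor (τ : FGModuleCat.{u} k ⥤ Plng E) : Prop :=
  ∀ (i : E.I) {X Y Z : FGModuleCat.{u} k} (f : X ⟶ Y) (g : Y ⟶ Z),
    Function.Injective f.hom.hom → Function.Exact f.hom.hom g.hom.hom →
    Function.Surjective g.hom.hom →
    Function.Injective (tmap τ i f) ∧ Function.Exact (tmap τ i f) (tmap τ i g) ∧
      Function.Surjective (tmap τ i g)

end Functors

/-! ## `E₀`-structures on `Vec_k`

`M` is a formal monoid over `Spec k₀` with pro-finite algebra `E₀ = (A_i)`, `k` is a field over `k₀`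
and `E = k ⊗ E₀` is the algebra of `M.baseChange k`. -/

variable [Algebra k₀ k]

/-- The `k`-algebra map `k ⊗ A → F` induced by a `k₀`-algebra map `A → F` into a `k`-algebra. -/
def liftScalar {A F : Type u} [CommRing A] [Algebra k₀ A] [CommRing F] [Algebra k₀ F]
    [Algebra k F] [IsScalarTower k₀ k F] (φ : A →ₐ[k₀] F) : k ⊗[k₀] A →ₐ[k] F :=
  Algebra.TensorProduct.lift (Algebra.ofId k F) φ (fun _ _ => Commute.all _ _)

theorem liftScalar_comp {A A' F : Type u} [CommRing A] [Algebra k₀ A] [CommRing A'] [Algebra k₀ A']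
    [CommRing F] [Algebra k₀ F] [Algebra k F] [IsScalarTower k₀ k F]
    (φ : A →ₐ[k₀] F) (g : A' →ₐ[k₀] A) :
    liftScalar (k := k) (φ.comp g) =
      (liftScalar φ).comp (Algebra.TensorProduct.map (AlgHom.id k k) g) := by
  ext
  simp [liftScalar]

section

variable (M : FormalMonoid k₀) (k)

/-- The component `E_i = k ⊗ A_i` of `E`. -/
abbrev EAlg (i : M.I) : Type u := k ⊗[k₀] M.A i

/-- The component `E_i ⊗_k E_j` of `E ⊗_k E`. -/
abbrev EEAlg (i j : M.I) : Type u := EAlg k M i ⊗[k] EAlg k M j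

/-- The map from `A_i` to the first factor of `E_i ⊗_k E_j`. -/
def inl (i j : M.I) : M.A i →ₐ[k₀] EEAlg k M i j :=
  (Algebra.TensorProduct.includeLeft (R := k) (S := k₀)).comp Algebra.TensorProduct.includeRight

/-- The map from `A_j` to the second factor of `E_i ⊗_k E_j`. -/
def inr (i j : M.I) : M.A j →ₐ[k₀] EEAlg k M i j :=
  ((Algebra.TensorProduct.includeRight (R := k) (A := EAlg k M i)
    (B := EAlg k M j)).restrictScalars k₀).comp Algebra.TensorProduct.includeRight

/-- The transition map of the system `E ⊗_k E`. -/
def trEE {i i' j j' : M.I} (p : i ⟶ i') (q : j ⟶ j') : EEAlg k M i j →ₐ[k] EEAlg k M i' j' :=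
  Algebra.TensorProduct.map ((M.baseChange k).tr p) ((M.baseChange k).tr q)

/-- The restriction of the product map `m` to `Spec (E_i ⊗_k E_j)`: the product of the two
tautological points with values in `E_i ⊗_k E_j`. -/
def mulPoint (i j : M.I) : M.Points (EEAlg k M i j) :=
  M.point i (inl k M i j) * M.point j (inr k M i j)
end

variable (M : FormalMonoid k₀) (k)

section

variable {M k}
variable {τ : FGModuleCat.{u} k ⥤ Plng (M.baseChange k)} (T : TensorStructure τ)

/-- A `k`-linear tensor isomorphism `i^! ∘ τ → Id`, where `i` is the unit of the monoid.

`i^! τ(X)` is `φ^! τ_l(X)` for any `φ : A_l → k` that represents the unit. Different representatives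
are identified through the transition maps of `τ(X)`, so the isomorphism is given for all of them,
compatibly. The compatibility with the tensor structures is stated for the inverse
`X → i^! τ(X) → τ_l(X)`. -/
structure UnitIso where
  /-- the isomorphism `i^! ∘ τ → Id` -/
  iso : ∀ (l : M.I) (φ : M.A l →ₐ[k₀] k) (_ : M.point l φ = 1) (X : FGModuleCat.{u} k),
    shriek (liftScalar φ) ((τ.obj X).ρ l) ≃ₗ[k] X
  natural : ∀ l φ hφ {X Y : FGModuleCat.{u} k} (f : X ⟶ Y) w,
    iso l φ hφ Y (shriekCongr _ _ _ (tmap τ l f) ((τ.map f).linear l) w) = f.hom.hom (iso l φ hφ X w)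
  trans : ∀ {l l' : M.I} (v : l' ⟶ l) φ hφ hφ' (X : FGModuleCat.{u} k) w,
    iso l' (φ.comp (M.tr v)) hφ' X
      (shriekMap _ _ _ (liftScalar_comp φ (M.tr v)) _ _ ((τ.obj X).t v) ((τ.obj X).t_linear v) w) =
      iso l φ hφ X w
  iso_tensor : ∀ l φ hφ (X Y : FGModuleCat.{u} k) (z : X ⊗[k] Y),
    T.δ l X Y (shriekEval _ _ ((iso l φ hφ (X ⊗ Y)).symm z)) =
      TensorProduct.map ((shriekEval _ _).comp (iso l φ hφ X).symm.toLinearMap)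
        ((shriekEval _ _).comp (iso l φ hφ Y).symm.toLinearMap) z
  iso_unit : ∀ l φ hφ (c : k),
    T.ε l (shriekEval _ _ ((iso l φ hφ (𝟙_ (FGModuleCat.{u} k))).symm c)) = c

/-- An `E ⊗_k E`-linear tensor isomorphism `τ ∘ τ → m^! ∘ τ`, where `m` is the product of the
monoid.

The component of `m^! τ(X)` over `E_i ⊗_k E_j` is `φ^! τ_l(X)` for any `φ : A_l → E_i ⊗_k E_j` that
represents the product. As before, the isomorphism is given for all representatives, compatibly.
The component of `τ(τ(X))` over `E_i ⊗_k E_j` is `τ_j(τ_i(X))`; here `E_j` acts through the module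
structure of `τ_j`, and the `k₀`-algebra `A_i` acts through the functoriality of `τ_j`. -/
structure MulIso where
  /-- the isomorphism `τ ∘ τ → m^! ∘ τ` -/
  iso : ∀ (i j l : M.I) (φ : M.A l →ₐ[k₀] EEAlg k M i j) (_ : M.point l φ = mulPoint k M i j)
    (X : FGModuleCat.{u} k),
    (τ.obj ((τ.obj X).X i)).X j ≃ₗ[k] shriek (liftScalar φ) ((τ.obj X).ρ l)
  linear_left : ∀ i j l φ hφ (X : FGModuleCat.{u} k) (e : M.A i) w y,
    (iso i j l φ hφ X (tmapₗ τ j ((τ.obj X).ρ i (1 ⊗ₜ e)) w)).1 y =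
      (iso i j l φ hφ X w).1 (((1 ⊗ₜ e) ⊗ₜ 1) * y)
  linear_right : ∀ i j l φ hφ (X : FGModuleCat.{u} k) (e : EAlg k M j) w y,
    (iso i j l φ hφ X ((τ.obj ((τ.obj X).X i)).ρ j e w)).1 y =
      (iso i j l φ hφ X w).1 ((1 ⊗ₜ e) * y)
  natural : ∀ i j l φ hφ {X Y : FGModuleCat.{u} k} (f : X ⟶ Y) w,
    iso i j l φ hφ Y (tmapₗ τ j (tmap τ i f) w) =
      shriekCongr _ _ _ (tmap τ l f) ((τ.map f).linear l) (iso i j l φ hφ X w)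
  trans : ∀ i j {l l' : M.I} (v : l' ⟶ l) φ hφ hφ' (X : FGModuleCat.{u} k) w,
    iso i j l' (φ.comp (M.tr v)) hφ' X w =
      shriekMap _ _ _ (liftScalar_comp φ (M.tr v)) _ _ ((τ.obj X).t v) ((τ.obj X).t_linear v)
        (iso i j l φ hφ X w)
  trans' : ∀ {i i' j j' : M.I} (p : i ⟶ i') (q : j ⟶ j') l (φ : M.A l →ₐ[k₀] EEAlg k M i j)
    hφ hφ' (X : FGModuleCat.{u} k) (w : (τ.obj ((τ.obj X).X i')).X j') y,
    (iso i j l φ hφ X (tmapₗ τ j ((τ.obj X).t p) ((τ.obj ((τ.obj X).X i')).t q w))).1 y =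
      (iso i' j' l (((trEE k M p q).restrictScalars k₀).comp φ) hφ' X w).1 (trEE k M p q y)
  iso_tensor : ∀ i j l φ hφ (X Y : FGModuleCat.{u} k) w,
    T.δ l X Y (shriekEval _ _ (iso i j l φ hφ (X ⊗ Y) w)) =
      TensorProduct.map ((shriekEval _ _).comp (iso i j l φ hφ X).toLinearMap)
        ((shriekEval _ _).comp (iso i j l φ hφ Y).toLinearMap)
        (T.δ j ((τ.obj X).X i) ((τ.obj Y).X i)
          (tmapₗ τ j (Y := (τ.obj X).X i ⊗ (τ.obj Y).X i) (T.δ i X Y) w))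
  iso_unit : ∀ i j l φ hφ w,
    T.ε l (shriekEval _ _ (iso i j l φ hφ (𝟙_ (FGModuleCat.{u} k)) w)) =
      T.ε j (tmapₗ τ j (Y := 𝟙_ (FGModuleCat.{u} k)) (T.ε i) w)

end

/-- An `E₀`-structure on `Vec_k`: an exact `k₀`-linear tensor functor `τ` from `Vec_k` to its
`E`-prolongation, a `k`-linear tensor isomorphism `a : i^! ∘ τ → Id` and an `E ⊗_k E`-linear tensor
isomorphism `b : τ ∘ τ → m^! ∘ τ`. -/
structure EStructure where
  /-- the functor from `Vec_k` to the prolongation category -/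
  τ : FGModuleCat.{u} k ⥤ Plng (M.baseChange k)
  map_add : ∀ i {X Y : FGModuleCat.{u} k} (f g : X ⟶ Y),
    tmap τ i (f + g) = tmap τ i f + tmap τ i g
  map_smul : ∀ i {X Y : FGModuleCat.{u} k} (c : k₀) (f : X ⟶ Y),
    tmap τ i (algebraMap k₀ k c • f) = algebraMap k₀ k c • tmap τ i f
  exact : IsExactFunctor τ
  /-- the tensor structure of `τ` -/
  tensor : TensorStructure τ
  /-- the isomorphism `i^! ∘ τ → Id` -/
  a : UnitIso tensor
  /-- the isomorphism `τ ∘ τ → m^! ∘ τ` -/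
  b : MulIso tensor

variable {M k}

namespace EStructure

/-- A morphism of `E₀`-structures on `Vec_k`: an `E`-linear map `u : τ → σ` of tensor functors that
commutes with the isomorphisms `a` and `b`. Isomorphisms in the resulting category are the
`E₀`-functors whose underlying functor is the identity. -/
@[ext]
structure Hom (S T : EStructure k M) where
  /-- the natural transformation -/
  u : S.τ ⟶ T.τ
  tensor : ∀ i (X Y : FGModuleCat.{u} k) w,
    T.tensor.δ i X Y ((u.app (X ⊗ Y)).app i w) =
      TensorProduct.map ((u.app X).app i) ((u.app Y).app i) (S.tensor.δ i X Y w)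
  unit : ∀ i w, T.tensor.ε i ((u.app (𝟙_ (FGModuleCat.{u} k))).app i w) = S.tensor.ε i w
  comm_a : ∀ l φ hφ (X : FGModuleCat.{u} k) w,
    T.a.iso l φ hφ X (shriekCongr _ _ _ ((u.app X).app l) ((u.app X).linear l) w) = S.a.iso l φ hφ X w
  comm_b : ∀ i j l φ hφ (X : FGModuleCat.{u} k) w,
    T.b.iso i j l φ hφ X
      ((u.app ((T.τ.obj X).X i)).app j (tmapₗ S.τ j ((u.app X).app i) w)) =
      shriekCongr _ _ _ ((u.app X).app l) ((u.app X).linear l) (S.b.iso i j l φ hφ X w)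

instance : Category (EStructure k M) where
  Hom := Hom
  id S :=
    { u := 𝟙 S.τ
      tensor := fun i X Y w => by
        exact (LinearMap.congr_fun (TensorProduct.map_id (R := k)) _).symm
      unit := fun i w => rfl
      comm_a := fun l φ hφ X w => rfl
      comm_b := fun i j l φ hφ X w => by
        change S.b.iso i j l φ hφ X (tmapₗ S.τ j LinearMap.id w) = S.b.iso i j l φ hφ X w
        rw [tmapₗ_id] }
  comp {S T U} f g :=
    { u := f.u ≫ g.u
      tensor := fun i X Y w => by
        refine (g.tensor i X Y _).trans ?_
        rw [f.tensor i X Y w]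
        exact (LinearMap.congr_fun (TensorProduct.map_comp ((g.u.app X).app i)
          ((g.u.app Y).app i) ((f.u.app X).app i) ((f.u.app Y).app i)) _).symm
      unit := fun i w => (g.unit i _).trans (f.unit i w)
      comm_a := fun l φ hφ X w => (g.comm_a l φ hφ X _).trans (f.comm_a l φ hφ X w)
      comm_b := fun i j l φ hφ X w => by
        change U.b.iso i j l φ hφ X ((g.u.app ((U.τ.obj X).X i)).app j
          ((f.u.app ((U.τ.obj X).X i)).app j
            (tmapₗ S.τ j (((g.u.app X).app i).comp ((f.u.app X).app i)) w))) = _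
        rw [tmapₗ_comp, naturality_tmapₗ, g.comm_b, f.comm_b]
        rfl }

/-- The map `τ_𝟙 : k = End(𝟙) → End(τ(𝟙)) = End(E^∨) = E`, at level `i`: the endomorphism of
`E_i^∨ ≅ τ_i(𝟙)` induced by `c ∈ k` is the multiplication by this element of `E_i`, which is
therefore characterised by `(c ξ)(1) = ξ(e)`. -/
def tauOne (S : EStructure k M) (i : M.I) (c : k) : EAlg k M i :=
  (Module.evalEquiv k (EAlg k M i)).symm
    ((S.tensor.ε i).comp
      ((tmap S.τ i (c • 𝟙 (𝟙_ (FGModuleCat.{u} k)))).comp (S.tensor.unitIso i).symm.toLinearMap))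

/-- `c ∈ k` acts on `τ_i(𝟙)` through the element `tauOne i c` of `E_i`. -/
theorem tmap_smul_id (S : EStructure k M) (i : M.I) (c : k)
    (w : (S.τ.obj (𝟙_ (FGModuleCat.{u} k))).X i) :
    tmap S.τ i (c • 𝟙 (𝟙_ (FGModuleCat.{u} k))) w =
      (S.τ.obj (𝟙_ (FGModuleCat.{u} k))).ρ i (S.tauOne i c) w := by
  apply (S.tensor.unitIso i).injective
  refine LinearMap.ext fun (y : EAlg k M i) => ?_
  have h₁ := S.tensor.unit_linear i (S.tauOne i c) w y
  have h₂ := S.tensor.unit_linear i y w (S.tauOne i c)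
  have h₃ := S.tensor.unit_linear i y
    (tmap S.τ i (c • 𝟙 (𝟙_ (FGModuleCat.{u} k))) w) (1 : EAlg k M i)
  have h₄ := Module.apply_evalEquiv_symm_apply k (EAlg k M i)
    (S.tensor.unitIso i ((S.τ.obj (𝟙_ (FGModuleCat.{u} k))).ρ i y w))
    ((S.tensor.ε i).comp
      ((tmap S.τ i (c • 𝟙 (𝟙_ (FGModuleCat.{u} k)))).comp (S.tensor.unitIso i).symm.toLinearMap))
  have h₅ := (S.τ.map (c • 𝟙 (𝟙_ (FGModuleCat.{u} k)))).linear i y w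
  rw [h₁, mul_comm, ← h₂]
  refine Eq.trans ?_ h₄.symm
  simp only [LinearMap.comp_apply, LinearEquiv.coe_coe, LinearEquiv.symm_apply_apply]
  rw [tmap, h₅]
  refine Eq.trans ?_ h₃.symm
  rw [mul_one]

end EStructure

/-- The dual `E_i^∨`, with the `k`-vector space structure given by the action `μ`: an element `c` of
`k` acts as the element `μ^#(c)` of `E_i`. -/
def TwistedDual (_μ : Action M k) (i : M.I) : Type u :=
  Module.Dual k (EAlg k M i)

namespace TwistedDual

variable (μ : Action M k) (i : M.I)

instance : AddCommGroup (TwistedDual μ i) :=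
  inferInstanceAs (AddCommGroup (Module.Dual k (EAlg k M i)))

instance : Module k (TwistedDual μ i) :=
  Module.compHom (Module.Dual k (EAlg k M i))
    ((dualAction (Algebra.lmul k (EAlg k M i))).comp (μ.coaction i).toRingHom)

/-- An element of the dual, viewed in the twisted dual. -/
def of (ξ : Module.Dual k (EAlg k M i)) : TwistedDual μ i := ξ

end TwistedDual

/-- The functor underlying the `E₀`-structure `S` is isomorphic to the functor
`X ↦ E^∨ ⊗_μ X` that is defined by the action `μ`: there are isomorphisms
`θ : E_i^∨ ⊗_μ X → τ_i(X)`, linear over `E_i`, natural in `X`, compatible with the transition maps,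
and compatible with `τ_i(𝟙) ≅ E_i^∨`. -/
def IsInducedBy (S : EStructure k M) (μ : Action M k) : Prop :=
  ∃ θ : ∀ (i : M.I) (X : FGModuleCat.{u} k), (TwistedDual μ i ⊗[k] X) ≃+ (S.τ.obj X).X i,
    (∀ i (X : FGModuleCat.{u} k) (e : EAlg k M i)
      (ξ : Module.Dual k (EAlg k M i)) (x : X),
      θ i X (TwistedDual.of μ i (ξ.comp (LinearMap.mulLeft k e)) ⊗ₜ x) =
        (S.τ.obj X).ρ i e (θ i X (TwistedDual.of μ i ξ ⊗ₜ x))) ∧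
    (∀ i {X Y : FGModuleCat.{u} k} (f : X ⟶ Y)
      (ξ : Module.Dual k (EAlg k M i)) (x : X),
      θ i Y (TwistedDual.of μ i ξ ⊗ₜ f.hom.hom x) =
        tmap S.τ i f (θ i X (TwistedDual.of μ i ξ ⊗ₜ x))) ∧
    (∀ {i j : M.I} (v : i ⟶ j) (X : FGModuleCat.{u} k)
      (ξ : Module.Dual k (EAlg k M j)) (x : X),
      θ i X (TwistedDual.of μ i (ξ.comp ((M.baseChange k).tr v).toLinearMap) ⊗ₜ x) =
        (S.τ.obj X).t v (θ j X (TwistedDual.of μ j ξ ⊗ₜ x))) ∧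
    (∀ i (ξ : Module.Dual k (EAlg k M i)), S.tensor.unitIso i
      (θ i (𝟙_ (FGModuleCat.{u} k)) (TwistedDual.of μ i ξ ⊗ₜ[k] (1 : k))) = ξ)

variable (k M) in
/-- The isomorphism classes of `E₀`-structures on `Vec_k`. -/
def EStructureClasses : Type _ := Quotient (isIsomorphicSetoid (EStructure k M))

/-- The isomorphism class of an `E₀`-structure. -/
def EStructure.isoClass (S : EStructure k M) : EStructureClasses k M :=
  Quotient.mk (isIsomorphicSetoid (EStructure k M)) S

end ETensor

end

/-! The category `Vec_k` is generated by 𝟙. An element x of X is a morphism 𝟙 → X, a linear form is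
a morphism X → 𝟙, and a basis writes id_X as a sum of composites X → 𝟙 → X. So an additive functor τ
is determined by τ_i(𝟙) ≅ E_i^∨ together with the action of End(𝟙) = k on it, which is the ring map
`tauOne` : k → E_i. Concretely, τ_i(X) is spanned by the elements `elem x ξ`, the images of ξ ∈
E_i^∨ under τ(x : 𝟙 → X). A scalar c passes from x to ξ as multiplication by `tauOne c`
(`elem_smul`), and the coordinates of `sum_elem_coord` show that no other relations exist. Hence
τ_i(X) ≅ E_i^∨ ⊗_μ X (`isInducedBy`).

The rest of a structure is forced on these generators. The unit constraint makes the tensor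
structure the comultiplication of E_i^∨ (`δ_elem`). The tensor conditions at 𝟙 and naturality along
𝟙 → X give explicit formulas for a (`shriekEval_a_symm`) and b (`b_elem`) that involve only
`tauOne`. Two structures with the same `tauOne` are therefore isomorphic by `elem x ξ ↦ elem x ξ`
(`isoOfTauOne`), and conversely a morphism preserves `tauOne` (`tauOne_eq_of_hom`).

The formulas also show that `tauOne` is a coaction. Linearity of a gives the unit law
(`liftScalar_tauOne_one`). Computing b on a generator with a scalar c, before and after c is moved
across, gives associativity (`liftScalar_tauOne_mul`); here one needs that the contractions of E_i ⊗
E_j by forms on E_i, followed by forms on E_j, span all forms (`exists_sum_comp_contract`). By the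
Yoneda lemma a coaction is the same as an action on points.

Conversely, for an action μ the functor X ↦ E^∨ ⊗_μ X is exact and monoidal, and f^!(E^∨ ⊗_μ X) is
E'^∨ ⊗ X with scalars through f ∘ μ^# (`toShriek_bijective`). Applied to the unit, this gives a. For
the product it gives b, once E_j^∨ ⊗ (E_i^∨ ⊗ X) is identified with (E_i ⊗ E_j)^∨ ⊗ X
(`compose_bijective`); associativity of the action says that the two k-structures agree. -/

noncomputable section

namespace ETensor

/-! ### The induced module E^∨ ⊗_μ X over a single algebra -/

section Twist

variable {k E : Type u} [Field k] [CommRing E] [Algebra k E]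

/-- The dual of a `k`-algebra `E`, with the `k`-module structure given by a ring map `k → E`. -/
def Twist (_μ : k →+* E) : Type u := Module.Dual k E

instance (μ : k →+* E) : AddCommGroup (Twist μ) := inferInstanceAs (AddCommGroup (Module.Dual k E))

instance (μ : k →+* E) : Module k (Twist μ) :=
  Module.compHom (Module.Dual k E) ((dualAction (Algebra.lmul k E)).comp μ)

/-- An element of the twisted dual, viewed as a linear form. -/
def Twist.form {μ : k →+* E} (ξ : Twist μ) : Module.Dual k E := ξ

/-- The action of `e : E` on the twisted dual. -/
def Twist.act (μ : k →+* E) : E →+* Module.End k (Twist μ) where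
  toFun e :=
    { toFun := fun ξ : Module.Dual k E => (ξ.comp (LinearMap.mulLeft k e) : Module.Dual k E)
      map_add' := fun _ _ => rfl
      map_smul' := fun c ξ => by
        refine LinearMap.ext fun y => ?_
        change ξ.form (μ c * (e * y)) = ξ.form (e * (μ c * y))
        rw [mul_left_comm] }
  map_one' := by
    refine LinearMap.ext fun ξ => LinearMap.ext fun y => ?_
    change ξ.form (1 * y) = ξ.form y
    rw [one_mul]
  map_mul' a b := by
    refine LinearMap.ext fun ξ => LinearMap.ext fun y => ?_
    change ξ.form (a * b * y) = ξ.form (b * (a * y))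
    rw [mul_comm a b, mul_assoc]
  map_zero' := by
    refine LinearMap.ext fun ξ => LinearMap.ext fun y => ?_
    change ξ.form (0 * y) = 0
    rw [zero_mul, map_zero]
  map_add' a b := by
    refine LinearMap.ext fun ξ => LinearMap.ext fun y => ?_
    change ξ.form ((a + b) * y) =
      ξ.form (a * y) + ξ.form (b * y)
    rw [add_mul, map_add]

/-- The `E`-module `E^∨ ⊗ X`, where the tensor product over `k` is formed with the `k`-module
structure on `E^∨` given by `μ`. -/
def Induced (μ : k →+* E) (X : Type u) [AddCommGroup X] [Module k X] : Type u := Twist μ ⊗[k] X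

namespace Induced

variable {μ : k →+* E} {X Y Z : Type u} [AddCommGroup X] [Module k X] [AddCommGroup Y] [Module k Y]
  [AddCommGroup Z] [Module k Z]

instance : AddCommGroup (Induced μ X) := inferInstanceAs (AddCommGroup (Twist μ ⊗[k] X))

variable (μ X) in
/-- The action of `E` on the induced module by additive maps. -/
def act : E →+* AddMonoid.End (Induced μ X) where
  toFun e := (TensorProduct.map (Twist.act μ e) (LinearMap.id : X →ₗ[k] X)).toAddMonoidHom
  map_one' := by
    rw [map_one, Module.End.one_eq_id, TensorProduct.map_id]
    rfl
  map_mul' a b := by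
    rw [map_mul]
    refine AddMonoidHom.ext fun w => ?_
    exact LinearMap.congr_fun
      (TensorProduct.map_comp (Twist.act μ a) LinearMap.id (Twist.act μ b) LinearMap.id) w
  map_zero' := by
    rw [map_zero, TensorProduct.map_zero_left]
    rfl
  map_add' a b := by
    rw [map_add, TensorProduct.map_add_left]
    rfl

instance : Module k (Induced μ X) := Module.compHom _ ((act μ X).comp (algebraMap k E))

variable (μ X) in
/-- The action of `E` on the induced module. -/
def ρ : E →ₐ[k] Module.End k (Induced μ X) :=
  AlgHom.ofLinearMap
    { toFun := fun e =>
        { toFun := act μ X e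
          map_add' := map_add _
          map_smul' := fun c w => by
            change (act μ X e * act μ X (algebraMap k E c)) w =
              (act μ X (algebraMap k E c) * act μ X e) w
            rw [← map_mul, ← map_mul, mul_comm] }
      map_add' := fun a b => by
        refine LinearMap.ext fun w => ?_
        exact congrArg (fun f : AddMonoid.End (Induced μ X) => f w) (map_add (act μ X) a b)
      map_smul' := fun c a => by
        refine LinearMap.ext fun w => ?_
        rw [Algebra.smul_def]
        exact congrArg (fun f : AddMonoid.End (Induced μ X) => f w) (map_mul (act μ X) _ a) }
    (by
      refine LinearMap.ext fun w => ?_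
      exact congrArg (fun f : AddMonoid.End (Induced μ X) => f w) (map_one (act μ X)))
    (fun a b => by
      refine LinearMap.ext fun w => ?_
      exact congrArg (fun f : AddMonoid.End (Induced μ X) => f w) (map_mul (act μ X) a b))

variable (μ) in
/-- The map `ξ ↦ ξ ⊗ x`. -/
def mk (x : X) : Module.Dual k E →ₗ[k] Induced μ X where
  toFun ξ := (show Twist μ from ξ) ⊗ₜ[k] x
  map_add' ξ η := TensorProduct.add_tmul (R := k) (show Twist μ from ξ) (show Twist μ from η) x
  map_smul' c ξ := by
    change (show Twist μ from c • ξ) ⊗ₜ[k] x =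
      (Twist.act μ (algebraMap k E c) (show Twist μ from ξ)) ⊗ₜ[k] x
    congr 1
    refine LinearMap.ext fun y => ?_
    change c • ξ y = ξ (algebraMap k E c * y)
    rw [← Algebra.smul_def, map_smul]

theorem ρ_mk (e : E) (x : X) (ξ : Module.Dual k E) :
    ρ μ X e (mk μ x ξ) = mk μ x (ξ.comp (LinearMap.mulLeft k e)) := rfl

theorem mk_add (x y : X) (ξ : Module.Dual k E) : mk μ (x + y) ξ = mk μ x ξ + mk μ y ξ :=
  TensorProduct.tmul_add (R := k) (show Twist μ from ξ) x y

theorem mk_smul (c : k) (x : X) (ξ : Module.Dual k E) :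
    mk μ (c • x) ξ = mk μ x (ξ.comp (LinearMap.mulLeft k (μ c))) :=
  (TensorProduct.smul_tmul (R := k) c (show Twist μ from ξ) x).symm

theorem mk_zero (ξ : Module.Dual k E) : mk μ (0 : X) ξ = 0 :=
  TensorProduct.tmul_zero (R := k) X (show Twist μ from ξ)

theorem mk_sum {ι : Type*} (s : Finset ι) (x : ι → X) (ξ : Module.Dual k E) :
    mk μ (∑ a ∈ s, x a) ξ = ∑ a ∈ s, mk μ (x a) ξ :=
  TensorProduct.tmul_sum (R := k) (show Twist μ from ξ) s x

theorem induction {p : Induced μ X → Prop} (w : Induced μ X) (h0 : p 0)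
    (h : ∀ x ξ, p (mk μ x ξ)) (hadd : ∀ v w, p v → p w → p (v + w)) : p w :=
  TensorProduct.induction_on (motive := p) w h0 (fun ξ x => h x ξ) hadd

theorem addHom_ext {P : Type*} [AddCommMonoid P] {f g : Induced μ X →+ P}
    (h : ∀ x ξ, f (mk μ x ξ) = g (mk μ x ξ)) : f = g := by
  refine AddMonoidHom.ext fun w => ?_
  induction w using induction with
  | h0 => rw [map_zero, map_zero]
  | h x ξ => exact h x ξ
  | hadd v w hv hw => rw [map_add, map_add, hv, hw]

theorem linearMap_ext {P : Type*} [AddCommMonoid P] [Module k P] {f g : Induced μ X →ₗ[k] P}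
    (h : ∀ x ξ, f (mk μ x ξ) = g (mk μ x ξ)) : f = g :=
  LinearMap.toAddMonoidHom_injective (addHom_ext h)

/-- The additive map out of the induced module given by a compatible family of additive maps on
`E^∨`. -/
def liftAdd {P : Type*} [AddCommMonoid P] (f : X →+ Module.Dual k E →+ P)
    (hf : ∀ (c : k) x ξ, f (c • x) ξ = f x (ξ.comp (LinearMap.mulLeft k (μ c)))) :
    Induced μ X →+ P :=
  TensorProduct.liftAddHom (M := Twist μ) (AddMonoidHom.flip f) (fun c ξ x => (hf c x ξ).symm)

@[simp]
theorem liftAdd_mk {P : Type*} [AddCommMonoid P] (f : X →+ Module.Dual k E →+ P)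
    (hf : ∀ (c : k) x ξ, f (c • x) ξ = f x (ξ.comp (LinearMap.mulLeft k (μ c)))) (x : X)
    (ξ : Module.Dual k E) : liftAdd (μ := μ) f hf (mk μ x ξ) = f x ξ := rfl

/-- The linear map out of the induced module given by a compatible family of linear maps on
`E^∨`. -/
def lift {P : Type*} [AddCommGroup P] [Module k P] (f : X →+ Module.Dual k E →ₗ[k] P)
    (hf : ∀ (c : k) x ξ, f (c • x) ξ = f x (ξ.comp (LinearMap.mulLeft k (μ c)))) :
    Induced μ X →ₗ[k] P :=
  let g : Induced μ X →+ P := liftAdd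
    (AddMonoidHom.mk' (fun x => ((f x).toAddMonoidHom : Module.Dual k E →+ P))
      (fun x y => by rw [map_add]; rfl)) hf
  { g with
    map_smul' := fun c w => by
      change g (act μ X (algebraMap k E c) w) = c • g w
      induction w using induction with
      | h0 => rw [map_zero, map_zero, smul_zero]
      | h x ξ =>
        refine Eq.trans ?_ (map_smul (f x) c ξ)
        change f x (ξ.comp (LinearMap.mulLeft k (algebraMap k E c))) = f x (c • ξ)
        congr 1
        ext y
        simp [← Algebra.smul_def]
      | hadd v w hv hw => rw [map_add, map_add, map_add, smul_add, hv, hw] }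

@[simp]
theorem lift_mk {P : Type*} [AddCommGroup P] [Module k P] (f : X →+ Module.Dual k E →ₗ[k] P)
    (hf : ∀ (c : k) x ξ, f (c • x) ξ = f x (ξ.comp (LinearMap.mulLeft k (μ c)))) (x : X)
    (ξ : Module.Dual k E) : lift (μ := μ) f hf (mk μ x ξ) = f x ξ := rfl

attribute [irreducible] Induced.mk Induced.ρ Induced.liftAdd Induced.lift

variable (μ) in
/-- Functoriality of the induced module. -/
def map (f : X →ₗ[k] Y) : Induced μ X →ₗ[k] Induced μ Y :=
  lift (AddMonoidHom.mk' (fun x => mk μ (f x)) (fun x y => by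
    ext ξ
    rw [map_add, mk_add]
    rfl)) (fun c x ξ => by simp [mk_smul])

@[simp]
theorem map_mk (f : X →ₗ[k] Y) (x : X) (ξ : Module.Dual k E) :
    map μ f (mk μ x ξ) = mk μ (f x) ξ := by
  rw [map, lift_mk]
  rfl

/-- The coordinate `E^∨ ⊗ X → E^∨` with respect to a linear form on `X`. -/
def coord (μ : k →+* E) (f : Module.Dual k X) : Induced μ X →ₗ[k] Module.Dual k E :=
  lift (AddMonoidHom.mk' (fun x => (LinearMap.mulLeft k (μ (f x))).dualMap) (fun x y => by
    ext ξ y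
    simp [add_mul])) (fun c x ξ => by
      ext y
      simp)

@[simp]
theorem coord_mk (f : Module.Dual k X) (x : X) (ξ : Module.Dual k E) (y : E) :
    coord μ f (mk μ x ξ) y = ξ (μ (f x) * y) := by
  rw [coord, lift_mk]
  rfl

theorem coord_ρ (f : Module.Dual k X) (e : E) (w : Induced μ X) (y : E) :
    coord μ f (ρ μ X e w) y = coord μ f w (e * y) := by
  induction w using induction with
  | h0 => simp
  | h x ξ => simp [ρ_mk, mul_left_comm]
  | hadd v w hv hw => simp [hv, hw]

theorem map_ρ (f : X →ₗ[k] Y) (e : E) (w : Induced μ X) :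
    map μ f (ρ μ X e w) = ρ μ Y e (map μ f w) := by
  induction w using induction with
  | h0 => simp
  | h x ξ => simp [ρ_mk]
  | hadd v w hv hw => simp [hv, hw]

section Basis

variable {ι : Type*} [Fintype ι] (b : Module.Basis ι k X)

/-- The basis coordinates of x cross the tensor sign as multiplication by their images under μ,
which is exactly what `coord` records. This exhibits E^∨ ⊗ X as a finite sum of copies of E^∨. -/
theorem sum_mk_coord (w : Induced μ X) : ∑ a, mk μ (b a) (coord μ (b.coord a) w) = w := by
  induction w using induction with
  | h0 => simp
  | h x ξ =>
    conv_rhs => rw [← b.sum_repr x, mk_sum]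
    refine Finset.sum_congr rfl fun a _ => ?_
    rw [mk_smul]
    congr 1
    ext y
    simp
  | hadd v w hv hw => simp only [map_add, Finset.sum_add_distrib, hv, hw]

theorem coord_sum_mk (ξ : ι → Module.Dual k E) (a : ι) :
    coord μ (b.coord a) (∑ a', mk μ (b a') (ξ a')) = ξ a := by
  classical
  ext y
  rw [map_sum, LinearMap.sum_apply, Finset.sum_eq_single a]
  · simp
  · intro a' _ h
    simp [h]
  · simp

variable (μ) in
/-- The induced module is a direct sum of copies of `E^∨`. -/
def equivPi : Induced μ X ≃ₗ[k] (ι → Module.Dual k E) where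
  toFun w a := coord μ (b.coord a) w
  invFun ξ := ∑ a, mk μ (b a) (ξ a)
  map_add' v w := by ext; simp
  map_smul' c w := by ext; simp
  left_inv w := sum_mk_coord b w
  right_inv ξ := by
    ext a : 1
    exact coord_sum_mk b ξ a

end Basis

theorem eq_zero_of_coord [Module.Finite k X] (w : Induced μ X)
    (h : ∀ f : Module.Dual k X, coord μ f w = 0) : w = 0 := by
  rw [← sum_mk_coord (Module.finBasis k X) w]
  exact Finset.sum_eq_zero fun a _ => by rw [h, map_zero]

theorem eq_of_coord [Module.Finite k X] {v w : Induced μ X}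
    (h : ∀ f : Module.Dual k X, coord μ f v = coord μ f w) : v = w := by
  rw [← sub_eq_zero]
  exact eq_zero_of_coord _ fun f => by rw [map_sub, h, sub_self]

instance [Module.Finite k E] [Module.Finite k X] : Module.Finite k (Induced μ X) :=
  Module.Finite.equiv (equivPi μ (Module.finBasis k X)).symm

theorem finrank [Module.Finite k E] [Module.Finite k X] :
    Module.finrank k (Induced μ X) = Module.finrank k X * Module.finrank k E := by
  rw [(equivPi μ (Module.finBasis k X)).finrank_eq, Module.finrank_pi_fintype]
  simp [Subspace.dual_finrank_eq]

/-- The dual is even free over E: restricting a form to the summand of each basis vector gives an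
element of E^∨∨ = E, so the dual is a finite power of E. -/
theorem isInjectiveAction [Module.Finite k E] [Module.Finite k X] :
    IsInjectiveAction (ρ μ X) := by
  let b := Module.finBasis k X
  let : Module E (Module.Dual k (Induced μ X)) := Module.compHom _ (dualAction (ρ μ X))
  change Module.Flat E (Module.Dual k (Induced μ X))
  let T : (Fin (Module.finrank k X) → E) →ₗ[E] Module.Dual k (Induced μ X) :=
    { toFun := fun e => ∑ a, ((LinearMap.applyₗ (e a)).comp (coord μ (b.coord a)))
      map_add' := fun e e' => by
        ext w
        simp [Finset.sum_add_distrib]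
      map_smul' := fun c e => by
        ext w
        change _ = (∑ a, ((LinearMap.applyₗ (e a)).comp (coord μ (b.coord a)))) (ρ μ X c w)
        simp [coord_ρ] }
  have hT : ∀ e a ξ, T e (mk μ (b a) ξ) = ξ (e a) := by
    intro e a ξ
    classical
    change (∑ a, ((LinearMap.applyₗ (e a)).comp (coord μ (b.coord a)))) (mk μ (b a) ξ) = _
    rw [LinearMap.sum_apply, Finset.sum_eq_single a]
    · simp
    · intro a' _ h
      simp [h.symm]
    · simp
  have hb : Function.Bijective T := by
    constructor
    · rw [injective_iff_map_eq_zero]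
      intro e he
      ext a
      refine (Module.forall_dual_apply_eq_zero_iff k (e a)).1 fun ξ => ?_
      rw [← hT, he]
      rfl
    · intro l
      refine ⟨fun a => (Module.evalEquiv k E).symm (l.comp (mk μ (b a))), ?_⟩
      refine LinearMap.ext fun w => ?_
      rw [← sum_mk_coord b w, map_sum, map_sum]
      refine Finset.sum_congr rfl fun a _ => ?_
      rw [hT, Module.apply_evalEquiv_symm_apply]
      rfl
  exact Module.Flat.of_linearEquiv (LinearEquiv.ofBijective T hb).symm

/-! ### Pullback of induced modules along an algebra map -/

section Shriek

variable {E' : Type u} [CommRing E'] [Algebra k E']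

/-- For a linear form `η` on `E'` and an algebra map `f : E → E'`, the linear map that sends `y` to
the linear form `a ↦ η (f a * y)`. -/
def translate (f : E →ₐ[k] E') (η : Module.Dual k E') : E' →ₗ[k] Module.Dual k E where
  toFun y := η.comp ((LinearMap.mulRight k y).comp f.toLinearMap)
  map_add' y z := by ext; simp [mul_add]
  map_smul' c y := by ext; simp

@[simp]
theorem translate_apply (f : E →ₐ[k] E') (η : Module.Dual k E') (y : E') (a : E) :
    translate f η y a = η (f a * y) := rfl

/-- The restriction of `toShriek` to the elements `η ⊗ x`. -/
def toShriekMk (μ : k →+* E) (f : E →ₐ[k] E') (x : X) :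
    Module.Dual k E' →ₗ[k] shriek f (ρ μ X) where
  toFun η := ⟨(mk μ x).comp (translate f η), fun a y => by
        simp only [LinearMap.comp_apply, ρ_mk]
        congr 1
        ext z
        simp [mul_assoc, mul_left_comm]⟩
  map_add' η η' := Subtype.ext (LinearMap.ext fun y =>
    map_add (mk μ x) (translate f η y) (translate f η' y))
  map_smul' c η := Subtype.ext (LinearMap.ext fun y => map_smul (mk μ x) c (translate f η y))

theorem toShriekMk_apply (f : E →ₐ[k] E') (x : X) (η : Module.Dual k E') (y : E') :
    (toShriekMk μ f x η).1 y =
      mk μ x (translate f η y) := rfl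

/-- The map `E'^∨ ⊗ X → f^!(E^∨ ⊗ X)` for an algebra map `f : E → E'`. -/
def toShriek (f : E →ₐ[k] E') (ν : k →+* E') (hν : ∀ c, ν c = f (μ c)) :
    Induced ν X →ₗ[k] shriek f (ρ μ X) :=
  lift (AddMonoidHom.mk' (fun x => toShriekMk μ f x) (fun x x' => by
      refine LinearMap.ext fun η => Subtype.ext (LinearMap.ext fun y => ?_)
      exact mk_add x x' _))
    (fun c x η => by
      refine Subtype.ext (LinearMap.ext fun y => ?_)
      refine (mk_smul c x _).trans ?_
      rw [AddMonoidHom.mk'_apply, toShriekMk_apply]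
      congr 1
      ext z
      simp [hν, mul_assoc])

theorem toShriek_mk (f : E →ₐ[k] E') (ν : k →+* E') (hν : ∀ c, ν c = f (μ c)) (x : X)
    (η : Module.Dual k E') (y : E') :
    (toShriek f ν hν (mk ν x η)).1 y =
      mk μ x (translate f η y) := by
  rw [toShriek, lift_mk]
  rfl

theorem coord_toShriek (f : E →ₐ[k] E') (ν : k →+* E') (hν : ∀ c, ν c = f (μ c))
    (g : Module.Dual k X) (w : Induced ν X) (y : E') (z : E) :
    coord μ g ((toShriek f ν hν w).1 y) z = coord ν g w (f z * y) := by
  induction w using induction with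
  | h0 => simp
  | h x ξ => simp [toShriek_mk, hν, mul_assoc]
  | hadd v w hv hw =>
    have h : (toShriek f ν hν (v + w)).1 y =
        (toShriek f ν hν v).1 y + (toShriek f ν hν w).1 y := by
      rw [map_add]
      rfl
    rw [h, map_add, map_add, LinearMap.add_apply, LinearMap.add_apply, hv, hw]

theorem toShriek_bijective [Module.Finite k X] (f : E →ₐ[k] E') (ν : k →+* E')
    (hν : ∀ c, ν c = f (μ c)) : Function.Bijective (toShriek (X := X) f ν hν) := by
  constructor
  · rw [injective_iff_map_eq_zero]
    intro w hw
    refine eq_zero_of_coord w fun g => LinearMap.ext fun y => ?_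
    rw [← one_mul y, ← map_one f, ← coord_toShriek (μ := μ) f ν hν, hw]
    simp
  · intro h
    let b := Module.finBasis k X
    -- The preimage has as coordinates the forms y ↦ (coordinate of h y)(1). The other values of
    -- these coordinates follow from h (f z * y) = z · h y.
    refine ⟨∑ a, mk ν (b a) ((LinearMap.applyₗ 1).comp ((coord μ (b.coord a)).comp h.1)), ?_⟩
    refine Subtype.ext (LinearMap.ext fun y => eq_of_coord fun g => LinearMap.ext fun z => ?_)
    rw [coord_toShriek, map_sum, LinearMap.sum_apply]
    conv_rhs => rw [← sum_mk_coord b (h.1 y), map_sum, LinearMap.sum_apply]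
    refine Finset.sum_congr rfl fun a _ => ?_
    rw [coord_mk, coord_mk, hν, ← mul_assoc, ← map_mul]
    rw [LinearMap.comp_apply, LinearMap.comp_apply, h.2, LinearMap.applyₗ_apply_apply, coord_ρ,
      mul_one]

end Shriek

end Induced

end Twist

/-! ### The coalgebra dual to a finite algebra -/

section DualComul

variable {k E E' : Type u} [Field k] [CommRing E] [Algebra k E] [CommRing E'] [Algebra k E']

/-- For finite dimensional spaces V^∨ ⊗ W^∨ is the dual of V ⊗ W, so its elements can be compared on
pure tensors. Every identity for `dualComul` thereby becomes an identity in E. -/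
theorem eq_of_dualDistrib {V W : Type*} [AddCommGroup V] [Module k V] [AddCommGroup W] [Module k W]
    [Module.Finite k V] [Module.Finite k W] {z z' : Module.Dual k V ⊗[k] Module.Dual k W}
    (h : ∀ a b, dualDistrib k V W z (a ⊗ₜ b) = dualDistrib k V W z' (a ⊗ₜ b)) : z = z' :=
  (dualDistribEquiv k V W).injective (TensorProduct.ext' h)

theorem dualDistrib_map {V W V' W' : Type*} [AddCommGroup V] [Module k V] [AddCommGroup W]
    [Module k W] [AddCommGroup V'] [Module k V'] [AddCommGroup W'] [Module k W']
    (f : V' →ₗ[k] V) (g : W' →ₗ[k] W) (z : Module.Dual k V ⊗[k] Module.Dual k W) (a : V') (b : W') :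
    dualDistrib k V' W' (TensorProduct.map f.dualMap g.dualMap z) (a ⊗ₜ b) =
      dualDistrib k V W z (f a ⊗ₜ g b) := by
  induction z with
  | zero => simp
  | tmul ξ η => simp
  | add z z' h h' => simp only [map_add, LinearMap.add_apply, h, h']

theorem lid_map_apply {V W : Type*} [AddCommGroup V] [Module k V] [AddCommGroup W] [Module k W]
    (z : Module.Dual k V ⊗[k] Module.Dual k W) (a : V) (b : W) :
    TensorProduct.lid k _ (TensorProduct.map (LinearMap.applyₗ a) LinearMap.id z) b =
      dualDistrib k V W z (a ⊗ₜ b) := by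
  induction z with
  | zero => simp
  | tmul ξ η => simp
  | add z z' h h' => simp only [map_add, LinearMap.add_apply, h, h']

variable [Module.Finite k E] [Module.Finite k E']

/-- The comultiplication on the dual of a finite algebra. -/
def dualComul : Module.Dual k E →ₗ[k] Module.Dual k E ⊗[k] Module.Dual k E :=
  (dualDistribEquiv k E E).symm.toLinearMap.comp (LinearMap.mul' k E).dualMap

@[simp]
theorem dualDistrib_dualComul (ξ : Module.Dual k E) (a b : E) :
    dualDistrib k E E (dualComul ξ) (a ⊗ₜ b) = ξ (a * b) := by
  have h : dualDistribEquiv k E E (dualComul ξ) = (LinearMap.mul' k E).dualMap ξ :=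
    (dualDistribEquiv k E E).apply_symm_apply _
  exact LinearMap.congr_fun h (a ⊗ₜ b)

theorem dualComul_injective : Function.Injective (dualComul (k := k) (E := E)) := by
  intro ξ η h
  ext a
  rw [← one_mul a, ← dualDistrib_dualComul, h, dualDistrib_dualComul]

theorem lid_dualComul (ξ : Module.Dual k E) :
    TensorProduct.lid k _
      (TensorProduct.map (LinearMap.applyₗ (1 : E)) LinearMap.id (dualComul ξ)) = ξ := by
  ext b
  rw [lid_map_apply, dualDistrib_dualComul, one_mul]

theorem comm_dualComul (ξ : Module.Dual k E) :
    TensorProduct.comm k _ _ (dualComul ξ) = dualComul ξ := by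
  refine eq_of_dualDistrib fun a b => ?_
  have h : ∀ z : Module.Dual k E ⊗[k] Module.Dual k E,
      dualDistrib k E E (TensorProduct.comm k _ _ z) (a ⊗ₜ b) = dualDistrib k E E z (b ⊗ₜ a) := by
    intro z
    induction z with
    | zero => simp
    | tmul ξ η => simp [mul_comm]
    | add z z' h h' => simp only [map_add, LinearMap.add_apply, h, h']
  rw [h, dualDistrib_dualComul, dualDistrib_dualComul, mul_comm]

theorem map_dualMap_dualComul (f : E →ₐ[k] E') (ξ : Module.Dual k E') :
    TensorProduct.map f.toLinearMap.dualMap f.toLinearMap.dualMap (dualComul ξ) =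
      dualComul (f.toLinearMap.dualMap ξ) :=
  eq_of_dualDistrib fun a b => by simp [dualDistrib_map]

theorem map_mulLeft_dualComul (a b : E) (ξ : Module.Dual k E) :
    TensorProduct.map (LinearMap.mulLeft k a).dualMap (LinearMap.mulLeft k b).dualMap
      (dualComul ξ) = dualComul ((LinearMap.mulLeft k (a * b)).dualMap ξ) :=
  eq_of_dualDistrib fun c d => by
    simp only [dualDistrib_map, dualDistrib_dualComul, LinearMap.dualMap_apply,
      LinearMap.mulLeft_apply]
    congr 1
    ring

theorem map_mulLeft_id_dualComul (a : E) (ξ : Module.Dual k E) :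
    TensorProduct.map (LinearMap.mulLeft k a).dualMap LinearMap.id (dualComul ξ) =
      dualComul ((LinearMap.mulLeft k a).dualMap ξ) := by
  simpa using map_mulLeft_dualComul a 1 ξ

theorem map_id_mulLeft_dualComul (a : E) (ξ : Module.Dual k E) :
    TensorProduct.map LinearMap.id (LinearMap.mulLeft k a).dualMap (dualComul ξ) =
      dualComul ((LinearMap.mulLeft k a).dualMap ξ) := by
  simpa using map_mulLeft_dualComul 1 a ξ

/-- Multiplicativity of an algebra map to k says that it is group-like in E^∨. This makes a
compatible with tensor products. -/
theorem dualComul_algHom (f : E →ₐ[k] k) : dualComul f.toLinearMap = f.toLinearMap ⊗ₜ f.toLinearMap :=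
  eq_of_dualDistrib fun a b => by simp

/-- Dual to associativity of the product of E: Ψ embeds the triple tensor product into the forms on
E ⊗ (E ⊗ E), where both sides evaluate ξ on the product of three elements. -/
theorem assoc_dualComul (ξ : Module.Dual k E) :
    TensorProduct.assoc k _ _ _ (TensorProduct.map dualComul LinearMap.id (dualComul ξ)) =
      TensorProduct.map LinearMap.id dualComul (dualComul ξ) := by
  let Ψ : Module.Dual k E ⊗[k] (Module.Dual k E ⊗[k] Module.Dual k E) →ₗ[k] Module.Dual k (E ⊗[k] (E ⊗[k] E)) :=
    (dualDistrib k E (E ⊗[k] E)).comp (TensorProduct.map LinearMap.id (dualDistrib k E E))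
  have hΨ : Function.Injective Ψ := by
    have := ((TensorProduct.congr (LinearEquiv.refl k (Module.Dual k E)) (dualDistribEquiv k E E)).trans
      (dualDistribEquiv k E (E ⊗[k] E))).injective
    exact this
  have h₁ : ∀ (u : Module.Dual k E ⊗[k] Module.Dual k E) (η : Module.Dual k E) (a b c : E),
      Ψ (TensorProduct.assoc k _ _ _ (u ⊗ₜ η))
      (a ⊗ₜ (b ⊗ₜ c)) = dualDistrib k E E u (a ⊗ₜ b) * η c := by
    intro u η a b c
    induction u with
    | zero => simp
    | tmul ξ η => simp [Ψ, mul_assoc]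
    | add z z' h h' => simp only [map_add, TensorProduct.add_tmul, LinearMap.add_apply, h, h', add_mul]
  have h₂ : ∀ (z : Module.Dual k E ⊗[k] Module.Dual k E) (a b c : E),
      Ψ (TensorProduct.assoc k _ _ _ (TensorProduct.map dualComul LinearMap.id z))
        (a ⊗ₜ (b ⊗ₜ c)) = dualDistrib k E E z ((a * b) ⊗ₜ c) := by
    intro z a b c
    induction z with
    | zero => simp
    | tmul ξ η => rw [TensorProduct.map_tmul, h₁]; simp
    | add z z' h h' => simp only [map_add, LinearMap.add_apply, h, h']
  have h₃ : ∀ (z : Module.Dual k E ⊗[k] Module.Dual k E) (a b c : E),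
      Ψ (TensorProduct.map LinearMap.id dualComul z)
        (a ⊗ₜ (b ⊗ₜ c)) = dualDistrib k E E z (a ⊗ₜ (b * c)) := by
    intro z a b c
    induction z with
    | zero => simp
    | tmul ξ η => simp [Ψ]
    | add z z' h h' => simp only [map_add, LinearMap.add_apply, h, h']
  refine hΨ (TensorProduct.ext_threefold' ?_)
  intro a b c
  rw [h₂, h₃, dualDistrib_dualComul, dualDistrib_dualComul, mul_assoc]

/-- The image of the comultiplication consists of the elements on which the two actions of `E`
agree. -/
theorem exists_dualComul_eq (z : Module.Dual k E ⊗[k] Module.Dual k E)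
    (hz : ∀ a : E, TensorProduct.map (LinearMap.mulLeft k a).dualMap LinearMap.id z =
      TensorProduct.map LinearMap.id (LinearMap.mulLeft k a).dualMap z) :
    dualComul (TensorProduct.lid k _
      (TensorProduct.map (LinearMap.applyₗ (1 : E)) LinearMap.id z)) = z := by
  refine eq_of_dualDistrib fun a b => ?_
  rw [dualDistrib_dualComul, lid_map_apply]
  -- Agreement of the two actions, tested on 1 ⊗ b, gives z(a ⊗ b) = z(1 ⊗ ab). So z is the
  -- comultiplication of the form b ↦ z(1 ⊗ b).
  have h := congrArg (fun z => dualDistrib k E E z (1 ⊗ₜ b)) (hz a)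
  rw [← LinearMap.dualMap_id] at h
  simp only [dualDistrib_map] at h
  simpa using h.symm

end DualComul

/-! ### The isomorphism E^∨ ⊗ (X ⊗ Y) ≅ (E^∨ ⊗ X) ⊗^E (E^∨ ⊗ Y) -/

namespace Induced

variable {k E : Type u} [Field k] [CommRing E] [Algebra k E] {μ : k →+* E}
variable {X Y Z : Type u} [AddCommGroup X] [Module k X] [AddCommGroup Y] [Module k Y]
  [AddCommGroup Z] [Module k Z]

theorem mk_smul' (c : k) (x : X) :
    mk μ (c • x) = (mk μ x).comp (LinearMap.mulLeft k (μ c)).dualMap :=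
  LinearMap.ext fun ξ => mk_smul c x ξ

theorem mk_add' (x y : X) : mk μ (x + y) = mk μ x + mk μ y :=
  LinearMap.ext fun ξ => mk_add x y ξ

theorem ρ_comp_mk (e : E) (x : X) :
    (ρ μ X e).comp (mk μ x) = (mk μ x).comp (LinearMap.mulLeft k e).dualMap :=
  LinearMap.ext fun ξ => ρ_mk e x ξ

theorem coord_comp_mk (f : Module.Dual k X) (x : X) :
    (coord μ f).comp (mk μ x) = (LinearMap.mulLeft k (μ (f x))).dualMap := by
  ext ξ y
  simp

theorem coord_comp_ρ (f : Module.Dual k X) (e : E) :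
    (coord μ f).comp (ρ μ X e) = (LinearMap.mulLeft k e).dualMap.comp (coord μ f) := by
  ext w y
  simp [coord_ρ]

/-- Induction on the generators `ξ ⊗ (x ⊗ y)` of `E^∨ ⊗ (X ⊗ Y)`. -/
theorem induction₂ {p : Induced μ (X ⊗[k] Y) → Prop} (w : Induced μ (X ⊗[k] Y)) (h0 : p 0)
    (h : ∀ x y ξ, p (mk μ (x ⊗ₜ y) ξ)) (hadd : ∀ v w, p v → p w → p (v + w)) : p w := by
  induction w using induction with
  | h0 => exact h0
  | h t ξ =>
    induction t with
    | zero => rwa [mk_zero]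
    | tmul x y => exact h x y ξ
    | add t t' ht ht' =>
      rw [mk_add]
      exact hadd _ _ ht ht'
  | hadd v w hv hw => exact hadd v w hv hw

variable [Module.Finite k E]

variable (μ) in
/-- The map `E^∨ → (E^∨ ⊗ X) ⊗ (E^∨ ⊗ Y)` given by the comultiplication of `E^∨` and by elements of
`X` and `Y`. -/
def mkMk (x : X) (y : Y) : Module.Dual k E →ₗ[k] Induced μ X ⊗[k] Induced μ Y :=
  (TensorProduct.map (mk μ x) (mk μ y)).comp dualComul

theorem mkMk_apply (x : X) (y : Y) (ξ : Module.Dual k E) :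
    mkMk μ x y ξ = TensorProduct.map (mk μ x) (mk μ y) (dualComul ξ) := rfl

/-- A scalar in either variable turns into multiplication by μ c on ξ, because both actions of E on
a comultiplied form agree. Together with `mkMk_smul_right` this makes `mkMk` balanced over k. -/
theorem mkMk_smul_left (c : k) (x : X) (y : Y) (ξ : Module.Dual k E) :
    mkMk μ (c • x) y ξ = mkMk μ x y ((LinearMap.mulLeft k (μ c)).dualMap ξ) := by
  rw [mkMk_apply, mkMk_apply, ← map_mulLeft_id_dualComul, TensorProduct.map_map, ← mk_smul',
    LinearMap.comp_id]

theorem mkMk_smul_right (c : k) (x : X) (y : Y) (ξ : Module.Dual k E) :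
    mkMk μ x (c • y) ξ = mkMk μ x y ((LinearMap.mulLeft k (μ c)).dualMap ξ) := by
  rw [mkMk_apply, mkMk_apply, ← map_id_mulLeft_dualComul, TensorProduct.map_map, ← mk_smul',
    LinearMap.comp_id]

variable (μ X Y) in
/-- The additive extension of `mkMk` to tensors. -/
def mkTensor : X ⊗[k] Y →+ Module.Dual k E →ₗ[k] Induced μ X ⊗[k] Induced μ Y :=
  TensorProduct.liftAddHom
    (AddMonoidHom.mk' (fun x => AddMonoidHom.mk' (mkMk μ x)
      (fun y y' => by simp only [mkMk, mk_add', TensorProduct.map_add_right, LinearMap.add_comp]))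
      (fun x x' => by
        refine AddMonoidHom.ext fun y => ?_
        change mkMk μ (x + x') y = mkMk μ x y + mkMk μ x' y
        simp only [mkMk, mk_add', TensorProduct.map_add_left, LinearMap.add_comp]))
    (fun c x y => LinearMap.ext fun ξ =>
      (mkMk_smul_left c x y ξ).trans (mkMk_smul_right c x y ξ).symm)

theorem mkTensor_tmul (x : X) (y : Y) : mkTensor μ X Y (x ⊗ₜ y) = mkMk μ x y := rfl

/-- The map `E^∨ ⊗ (X ⊗ Y) → (E^∨ ⊗ X) ⊗ (E^∨ ⊗ Y)` given by the comultiplication of `E^∨`. -/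
def δ (μ : k →+* E) (X Y : Type u) [AddCommGroup X] [Module k X] [AddCommGroup Y] [Module k Y] :
    Induced μ (X ⊗[k] Y) →ₗ[k] Induced μ X ⊗[k] Induced μ Y :=
  lift (mkTensor μ X Y) (fun c t ξ => by
    induction t with
    | zero => simp
    | tmul x y =>
      rw [TensorProduct.smul_tmul', mkTensor_tmul, mkMk_smul_left, mkTensor_tmul]
      rfl
    | add t t' h h' => simp only [smul_add, map_add, LinearMap.add_apply, h, h'])

theorem δ_mk (x : X) (y : Y) (ξ : Module.Dual k E) :
    δ μ X Y (mk μ (x ⊗ₜ y) ξ) = TensorProduct.map (mk μ x) (mk μ y) (dualComul ξ) := by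
  rw [δ, lift_mk]
  rfl

theorem ρ_δ (a : E) (w : Induced μ (X ⊗[k] Y)) :
    TensorProduct.map (ρ μ X a) LinearMap.id (δ μ X Y w) = δ μ X Y (ρ μ _ a w) := by
  induction w using induction₂ with
  | h0 => simp
  | h x y ξ =>
    rw [δ_mk, ρ_mk, δ_mk, ← LinearMap.comp_apply, ← TensorProduct.map_comp, ρ_comp_mk,
      LinearMap.id_comp, ← LinearMap.comp_id (mk μ y), TensorProduct.map_comp,
      LinearMap.comp_apply, map_mulLeft_id_dualComul, LinearMap.comp_id]
    rfl
  | hadd v w hv hw => simp only [map_add, hv, hw]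

theorem δ_ρ (a : E) (w : Induced μ (X ⊗[k] Y)) :
    TensorProduct.map LinearMap.id (ρ μ Y a) (δ μ X Y w) = δ μ X Y (ρ μ _ a w) := by
  induction w using induction₂ with
  | h0 => simp
  | h x y ξ =>
    rw [δ_mk, ρ_mk, δ_mk, ← LinearMap.comp_apply, ← TensorProduct.map_comp, ρ_comp_mk,
      LinearMap.id_comp, ← LinearMap.comp_id (mk μ x), TensorProduct.map_comp,
      LinearMap.comp_apply, map_id_mulLeft_dualComul, LinearMap.comp_id]
    rfl
  | hadd v w hv hw => simp only [map_add, hv, hw]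

theorem δ_mem (w : Induced μ (X ⊗[k] Y)) : δ μ X Y w ∈ dualTensor (ρ μ X) (ρ μ Y) := by
  rw [dualTensor, Submodule.mem_iInf]
  intro a
  rw [LinearMap.mem_eqLocus, ρ_δ, δ_ρ]

/-- In coordinates δ is the comultiplication of E^∨, so its injectivity and its image can be read
off from those of `dualComul`. -/
theorem map_coord_δ (f : Module.Dual k X) (g : Module.Dual k Y) (w : Induced μ (X ⊗[k] Y)) :
    TensorProduct.map (coord μ f) (coord μ g) (δ μ X Y w) =
      dualComul (coord μ (dualDistrib k X Y (f ⊗ₜ g)) w) := by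
  induction w using induction₂ with
  | h0 => simp
  | h x y ξ =>
    rw [δ_mk, ← LinearMap.comp_apply, ← TensorProduct.map_comp, coord_comp_mk, coord_comp_mk,
      map_mulLeft_dualComul, ← map_mul, ← dualDistrib_apply, ← coord_comp_mk]
    rfl
  | hadd v w hv hw => simp only [map_add, hv, hw]

variable [Module.Finite k X] [Module.Finite k Y]

theorem δ_injective : Function.Injective (δ μ X Y) := by
  rw [injective_iff_map_eq_zero]
  intro w hw
  let b := Module.finBasis k X
  let b' := Module.finBasis k Y
  rw [← sum_mk_coord (b.tensorProduct b') w]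
  refine Finset.sum_eq_zero fun ⟨p, q⟩ _ => ?_
  have h : (b.tensorProduct b').coord (p, q) =
      dualDistrib k X Y (b.coord p ⊗ₜ b'.coord q) := by
    refine TensorProduct.ext' fun x y => ?_
    simp [Module.Basis.tensorProduct_repr_tmul_apply, mul_comm]
  rw [h, dualComul_injective (a₁ := coord μ _ w) (a₂ := 0), map_zero]
  rw [← map_coord_δ, hw, map_zero, map_zero]

/-- Each pair of coordinates of z is a tensor in E^∨ ⊗ E^∨ on which the two actions of E agree,
hence a comultiplied form. These forms are the coordinates of the preimage. -/
theorem exists_δ_eq (z : Induced μ X ⊗[k] Induced μ Y) (hz : z ∈ dualTensor (ρ μ X) (ρ μ Y)) :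
    ∃ w, δ μ X Y w = z := by
  let b := Module.finBasis k X
  let b' := Module.finBasis k Y
  have h : ∀ f g, ∃ ξ, dualComul ξ = TensorProduct.map (coord μ f) (coord μ g) z := by
    intro f g
    refine ⟨_, exists_dualComul_eq _ fun a => ?_⟩
    rw [dualTensor, Submodule.mem_iInf] at hz
    have := congrArg (TensorProduct.map (coord μ f) (coord μ g)) (LinearMap.mem_eqLocus.1 (hz a))
    rw [← LinearMap.comp_apply, ← TensorProduct.map_comp, ← LinearMap.comp_apply,
      ← TensorProduct.map_comp, coord_comp_ρ, coord_comp_ρ] at this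
    rw [← LinearMap.comp_apply, ← TensorProduct.map_comp, ← LinearMap.comp_apply,
      ← TensorProduct.map_comp]
    exact this
  choose ξ hξ using h
  refine ⟨∑ p, ∑ q, mk μ (b p ⊗ₜ b' q) (ξ (b.coord p) (b'.coord q)), ?_⟩
  simp only [map_sum, δ_mk, hξ]
  -- What remains is the expansion of a tensor in two bases. It holds for every z, so the agreement
  -- condition is dropped to allow induction over pure tensors.
  clear hz ξ hξ
  induction z with
  | zero => simp
  | tmul v w =>
    simp only [TensorProduct.map_tmul]
    conv_rhs => rw [← sum_mk_coord b v, ← sum_mk_coord b' w, TensorProduct.sum_tmul]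
    refine Finset.sum_congr rfl fun p _ => ?_
    rw [TensorProduct.tmul_sum]
  | add z z' h h' => 
    conv_rhs => rw [← h, ← h']
    simp only [map_add, Finset.sum_add_distrib]

variable (μ X Y) in
/-- The isomorphism `E^∨ ⊗ (X ⊗ Y) ≅ (E^∨ ⊗ X) ⊗^E (E^∨ ⊗ Y)`. -/
def δEquiv : Induced μ (X ⊗[k] Y) ≃ₗ[k] dualTensor (ρ μ X) (ρ μ Y) :=
  LinearEquiv.ofBijective ((δ μ X Y).codRestrict _ δ_mem)
    ⟨fun _ _ h => δ_injective (congrArg Subtype.val h), fun z =>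
      let ⟨w, hw⟩ := exists_δ_eq z.1 z.2
      ⟨w, Subtype.ext hw⟩⟩

end Induced

/-! ### Contraction of E ⊗ E' by linear forms on E = k ⊗ A -/

section Contract

/-- The elements 1 ⊗ e span k ⊗ A over k. This restricts most checks to the elements of A, on which
μ' does not intervene. -/
theorem linearMap_ext_of_tmul {k₀ k A E' : Type u} [CommRing k₀] [Field k] [Algebra k₀ k]
    [CommRing A] [Algebra k₀ A] [CommRing E'] [Algebra k E'] {P : Type*} [AddCommGroup P] [Module k P]
    {g h : (k ⊗[k₀] A) ⊗[k] E' →ₗ[k] P}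
    (H : ∀ (e : A) (f : E'), g ((1 ⊗ₜ e) ⊗ₜ f) = h ((1 ⊗ₜ e) ⊗ₜ f)) : g = h := by
  refine TensorProduct.ext' fun a f => ?_
  induction a with
  | zero => simp
  | tmul c e =>
    have : (c ⊗ₜ e : k ⊗[k₀] A) = c • (1 ⊗ₜ e) := by simp [TensorProduct.smul_tmul']
    rw [this, ← TensorProduct.smul_tmul', map_smul, map_smul, H]
  | add a b ha hb => simp only [TensorProduct.add_tmul, map_add, ha, hb]

variable {k₀ k A E' : Type u} [CommRing k₀] [Field k] [Algebra k₀ k] [CommRing A] [Algebra k₀ A]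
  [CommRing E'] [Algebra k₀ E'] [Algebra k E'] [IsScalarTower k₀ k E'] (μ' : k →ₐ[k₀] E')

/-- The contraction `(k ⊗ A) ⊗ E' → E'`, `(c ⊗ e) ⊗ f ↦ c μ'(ξ(1 ⊗ e)) f`, defined by a linear form
`ξ` on `k ⊗ A`. -/
def contract (ξ : Module.Dual k (k ⊗[k₀] A)) : (k ⊗[k₀] A) ⊗[k] E' →ₗ[k] E' :=
  TensorProduct.lift ((LinearMap.mul k E').comp (LinearMap.liftBaseChange k
    (μ'.toLinearMap.comp ((ξ.restrictScalars k₀).comp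
      (Algebra.TensorProduct.includeRight : A →ₐ[k₀] k ⊗[k₀] A).toLinearMap))))

@[simp]
theorem contract_tmul (ξ : Module.Dual k (k ⊗[k₀] A)) (c : k) (e : A) (f : E') :
    contract μ' ξ ((c ⊗ₜ e) ⊗ₜ f) = c • (μ' (ξ (1 ⊗ₜ e)) * f) := by
  simp [contract]

/-- The algebra map `k ⊗ A → (k ⊗ A) ⊗ E'`, `c ⊗ e ↦ (1 ⊗ e) ⊗ μ'(c)`. -/
def scalarShift : k ⊗[k₀] A →ₐ[k₀] (k ⊗[k₀] A) ⊗[k] E' :=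
  Algebra.TensorProduct.lift
    (((Algebra.TensorProduct.includeRight (R := k) (A := k ⊗[k₀] A)
      (B := E')).restrictScalars k₀).comp μ')
    ((Algebra.TensorProduct.includeLeft (R := k) (S := k₀)).comp
      Algebra.TensorProduct.includeRight) (fun _ _ => Commute.all _ _)

@[simp]
theorem scalarShift_tmul (c : k) (e : A) :
    scalarShift μ' (c ⊗ₜ[k₀] e) = (1 ⊗ₜ e) ⊗ₜ μ' c := by
  simp [scalarShift]

theorem contract_add (ξ ξ' : Module.Dual k (k ⊗[k₀] A)) :
    contract μ' (ξ + ξ') = contract μ' ξ + contract μ' ξ' :=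
  linearMap_ext_of_tmul fun e f => by simp [add_mul]

theorem contract_smul (c : k) (ξ : Module.Dual k (k ⊗[k₀] A)) :
    contract μ' (c • ξ) = (LinearMap.mulLeft k (μ' c)).comp (contract μ' ξ) :=
  linearMap_ext_of_tmul fun e f => by simp [mul_assoc]

/-- A scalar c from the factor k of k ⊗ A comes out of the k-linear form ξ and is then sent to E' by
μ'. On the source this is multiplication by 1 ⊗ μ'(c), which explains the form of `scalarShift`. -/
theorem contract_comp_mulLeft (a : k ⊗[k₀] A) (ξ : Module.Dual k (k ⊗[k₀] A)) :
    contract μ' (ξ.comp (LinearMap.mulLeft k a)) =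
      (contract μ' ξ).comp (LinearMap.mulLeft k (scalarShift μ' a)) := by
  refine linearMap_ext_of_tmul fun e f => ?_
  induction a with
  | zero => simp
  | tmul c e' =>
    have : (c ⊗ₜ (e' * e) : k ⊗[k₀] A) = c • (1 ⊗ₜ (e' * e)) := by
      simp [TensorProduct.smul_tmul']
    simp [this, mul_assoc, mul_left_comm]
  | add a b ha hb =>
    simp only [contract_tmul, LinearMap.comp_apply, LinearMap.mulLeft_apply, map_add,
      add_mul, smul_add] at ha hb ⊢
    rw [ha, hb]

theorem contract_comp_mulLeft_tmul (f : E') (ξ : Module.Dual k (k ⊗[k₀] A)) :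
    (LinearMap.mulLeft k f).comp (contract μ' ξ) =
      (contract μ' ξ).comp (LinearMap.mulLeft k ((1 : k ⊗[k₀] A) ⊗ₜ f)) :=
  linearMap_ext_of_tmul fun e f' => by simp [mul_left_comm]

theorem contract_one (ξ : Module.Dual k (k ⊗[k₀] A)) : contract μ' ξ 1 = μ' (ξ 1) := by
  rw [Algebra.TensorProduct.one_def, Algebra.TensorProduct.one_def, contract_tmul]
  simp

theorem comp_contract {A₁ E₁ : Type u} [CommRing A₁] [Algebra k₀ A₁] [CommRing E₁] [Algebra k₀ E₁]
    [Algebra k E₁] [IsScalarTower k₀ k E₁] (g : A →ₐ[k₀] A₁) (h : E' →ₐ[k] E₁)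
    (μ₁ : k →ₐ[k₀] E₁) (hμ : ∀ c, μ₁ c = h (μ' c)) (ξ : Module.Dual k (k ⊗[k₀] A₁)) :
    h.toLinearMap.comp (contract μ'
      (ξ.comp (Algebra.TensorProduct.map (AlgHom.id k k) g).toLinearMap)) =
    (contract μ₁ ξ).comp
      (Algebra.TensorProduct.map (Algebra.TensorProduct.map (AlgHom.id k k) g) h).toLinearMap :=
  linearMap_ext_of_tmul fun e f => by simp [hμ]

variable [Module.Finite k (k ⊗[k₀] A)]

/-- The spanning set of all 1 ⊗ e contains a basis. On such a basis the contraction has the simple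
value μ'(ξ(1 ⊗ e)) f. -/
theorem exists_basis_one_tmul :
    ∃ (ι : Type u) (_ : Fintype ι) (b : Module.Basis ι k (k ⊗[k₀] A)) (e : ι → A),
      ∀ r, b r = 1 ⊗ₜ e r := by
  obtain ⟨s, hs, hspan, hli⟩ := exists_linearIndependent k
    (Set.range fun e : A => (1 ⊗ₜ e : k ⊗[k₀] A))
  have htop : ⊤ ≤ Submodule.span k (Set.range ((↑) : s → k ⊗[k₀] A)) := by
    rw [Subtype.range_coe, hspan]
    intro a _
    induction a with
    | zero => exact zero_mem _
    | tmul c e =>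
      have : (c ⊗ₜ e : k ⊗[k₀] A) = c • (1 ⊗ₜ e) := by simp [TensorProduct.smul_tmul']
      rw [this]
      exact Submodule.smul_mem _ _ (Submodule.subset_span ⟨e, rfl⟩)
    | add a b ha hb => exact add_mem (ha trivial) (hb trivial)
  let b := Module.Basis.mk hli htop
  have : Finite s := Module.Finite.finite_basis b
  choose e he using fun r : s => hs r.2
  exact ⟨s, Fintype.ofFinite s, b, e, fun r => by rw [Module.Basis.mk_apply]; exact (he r).symm⟩

/-- Every linear form on `(k ⊗ A) ⊗ E'` is a sum of compositions of contractions with linear forms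
on `E'`. -/
theorem exists_sum_comp_contract (η : Module.Dual k ((k ⊗[k₀] A) ⊗[k] E')) :
    ∃ (ι : Type u) (_ : Fintype ι) (ξ : ι → Module.Dual k (k ⊗[k₀] A)) (ζ : ι → Module.Dual k E'),
      η = ∑ r, (ζ r).comp (contract μ' (ξ r)) := by
  obtain ⟨ι, hι, b, e, hb⟩ := exists_basis_one_tmul (k₀ := k₀) (k := k) (A := A)
  -- The contraction by the dual basis vector of b r sends b s ⊗ f to f if r = s and to 0 otherwise,
  -- so η is the sum over r of η(b r ⊗ -) composed with these contractions.
  refine ⟨ι, hι, b.coord, fun r => η.comp (TensorProduct.mk k _ _ (b r)), ?_⟩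
  refine TensorProduct.ext (b.ext fun s => LinearMap.ext fun f => ?_)
  have h : ∀ ξ : Module.Dual k (k ⊗[k₀] A),
      contract μ' ξ (b s ⊗ₜ f) = μ' (ξ (b s)) * f := fun ξ => by
    rw [hb, contract_tmul, one_smul]
  change η (b s ⊗ₜ f) = (∑ r, (η.comp (TensorProduct.mk k _ _ (b r))).comp
    (contract μ' (b.coord r))) (b s ⊗ₜ f)
  rw [LinearMap.sum_apply, Finset.sum_eq_single s]
  · simp [h]
  · intro r _ hr
    simp [h, hr.symm]
  · simp

end Contract

namespace Induced

/-! ### The iterated induced module E'^∨ ⊗ (E^∨ ⊗ X) -/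

section Compose

variable {k₀ k A E' : Type u} [CommRing k₀] [Field k] [Algebra k₀ k] [CommRing A] [Algebra k₀ A]
  [CommRing E'] [Algebra k₀ E'] [Algebra k E'] [IsScalarTower k₀ k E']
  (μ : k →ₐ[k₀] k ⊗[k₀] A) (μ' : k →ₐ[k₀] E')
  {X Y : Type u} [AddCommGroup X] [Module k X] [AddCommGroup Y] [Module k Y]

/-- The composition of two induced modules is the module induced by this map. -/
def compScalar : k →ₐ[k₀] (k ⊗[k₀] A) ⊗[k] E' := (scalarShift μ').comp μ

variable (X) in
/-- The family of maps that defines `compose`. -/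
def composeAux : Induced (μ : k →+* k ⊗[k₀] A) X →+ Module.Dual k E' →ₗ[k]
    Induced (compScalar μ μ' : k →+* (k ⊗[k₀] A) ⊗[k] E') X :=
  liftAdd (AddMonoidHom.mk' (fun x => AddMonoidHom.mk'
      (fun ξ => (mk _ x).comp (contract μ' ξ).dualMap) (fun ξ ξ' => by
        ext ζ
        rw [contract_add, LinearMap.add_apply, LinearMap.comp_apply, LinearMap.comp_apply,
          LinearMap.comp_apply, ← map_add]
        congr 1
        ext y
        simp))
      (fun x x' => by
        refine AddMonoidHom.ext fun ξ => LinearMap.ext fun ζ => ?_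
        exact mk_add x x' _))
    (fun c x ξ => by
      refine LinearMap.ext fun ζ => ?_
      refine (mk_smul c x _).trans ?_
      change _ = mk _ x ((contract μ' _).dualMap ζ)
      rw [AlgHom.coe_toRingHom, contract_comp_mulLeft]
      rfl)

theorem composeAux_mk (x : X) (ξ : Module.Dual k (k ⊗[k₀] A)) (ζ : Module.Dual k E') :
    composeAux μ μ' X (mk _ x ξ) ζ = mk _ x (ζ.comp (contract μ' ξ)) := by
  rw [composeAux, liftAdd_mk]
  rfl

variable (X) in
/-- The map `E'^∨ ⊗ (E^∨ ⊗ X) → (E ⊗ E')^∨ ⊗ X`, where `E = k ⊗ A`. -/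
def compose : Induced (μ' : k →+* E') (Induced (μ : k →+* k ⊗[k₀] A) X) →ₗ[k]
    Induced (compScalar μ μ' : k →+* (k ⊗[k₀] A) ⊗[k] E') X :=
  lift (composeAux μ μ' X) (fun c v ζ => by
    induction v using induction with
    | h0 => simp
    | h x ξ =>
      rw [← map_smul, composeAux_mk, composeAux_mk, contract_smul]
      rfl
    | hadd v w hv hw => rw [smul_add, map_add, map_add, LinearMap.add_apply, LinearMap.add_apply, hv, hw])

theorem compose_mk (x : X) (ξ : Module.Dual k (k ⊗[k₀] A)) (ζ : Module.Dual k E') :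
    compose μ μ' X (mk _ (mk _ x ξ) ζ) = mk _ x (ζ.comp (contract μ' ξ)) := by
  rw [compose, lift_mk, composeAux_mk]

/-- Induction on the generators of an iterated induced module. -/
theorem induction_mk_mk {E : Type u} [CommRing E] [Algebra k E] {μ : k →+* E} {μ' : k →+* E'}
    {p : Induced μ' (Induced μ X) → Prop} (w : Induced μ' (Induced μ X)) (h0 : p 0)
    (h : ∀ x ξ ζ, p (mk μ' (mk μ x ξ) ζ)) (hadd : ∀ v w, p v → p w → p (v + w)) : p w := by
  induction w using induction with
  | h0 => exact h0
  | h v ζ =>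
    induction v using induction with
    | h0 => rwa [mk_zero]
    | h x ξ => exact h x ξ ζ
    | hadd v w hv hw =>
      rw [mk_add]
      exact hadd _ _ hv hw
  | hadd v w hv hw => exact hadd v w hv hw

/-- The inner action of E, applied through functoriality of the outer module, is not k-linear for
the outer structure: the part of E from A acts as on the first factor, but scalars act through μ' on
the second. -/
theorem compose_map_ρ (a : k ⊗[k₀] A) (w : Induced (μ' : k →+* E') (Induced (μ : k →+* k ⊗[k₀] A) X)) :
    compose μ μ' X (map _ (ρ _ X a) w) = ρ _ X (scalarShift μ' a) (compose μ μ' X w) := by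
  induction w using induction_mk_mk with
  | h0 => simp
  | h x ξ ζ => rw [map_mk, ρ_mk, compose_mk, compose_mk, ρ_mk, contract_comp_mulLeft]; rfl
  | hadd v w hv hw => simp only [map_add, hv, hw]

theorem compose_ρ (f : E') (w : Induced (μ' : k →+* E') (Induced (μ : k →+* k ⊗[k₀] A) X)) :
    compose μ μ' X (ρ _ _ f w) = ρ _ X ((1 : k ⊗[k₀] A) ⊗ₜ f) (compose μ μ' X w) := by
  induction w using induction_mk_mk with
  | h0 => simp
  | h x ξ ζ =>
    rw [ρ_mk, compose_mk, compose_mk, ρ_mk, LinearMap.comp_assoc, contract_comp_mulLeft_tmul]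
    rfl
  | hadd v w hv hw => simp only [map_add, hv, hw]

theorem compose_map_map (f : X →ₗ[k] Y)
    (w : Induced (μ' : k →+* E') (Induced (μ : k →+* k ⊗[k₀] A) X)) :
    compose μ μ' Y (map _ (map _ f) w) = map _ f (compose μ μ' X w) := by
  induction w using induction_mk_mk with
  | h0 => simp
  | h x ξ ζ => rw [map_mk, map_mk, compose_mk, compose_mk, map_mk]
  | hadd v w hv hw => simp only [map_add, hv, hw]

variable [Module.Finite k (k ⊗[k₀] A)] [Module.Finite k E']

/-- Surjective because contractions followed by forms on E' span the dual of E ⊗ E'; bijective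
because both sides have dimension dim X · dim E · dim E'. -/
theorem compose_bijective [Module.Finite k X] : Function.Bijective (compose μ μ' X) := by
  have hs : Function.Surjective (compose μ μ' X) := by
    rw [← LinearMap.range_eq_top, eq_top_iff]
    intro w _
    induction w using induction with
    | h0 => exact zero_mem _
    | h x η =>
      obtain ⟨ι, _, ξ, ζ, rfl⟩ := exists_sum_comp_contract μ' η
      rw [map_sum]
      exact sum_mem fun r _ => ⟨_, compose_mk μ μ' x (ξ r) (ζ r)⟩
    | hadd v w hv hw => exact add_mem (hv trivial) (hw trivial)
  refine ⟨(LinearMap.injective_iff_surjective_of_finrank_eq_finrank ?_).2 hs, hs⟩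
  rw [finrank, finrank, finrank,
    Module.finrank_tensorProduct (R := k) (M := k ⊗[k₀] A) (M' := E'), mul_assoc]

theorem compose_tensor (w : Induced (μ' : k →+* E') (Induced (μ : k →+* k ⊗[k₀] A) (X ⊗[k] Y))) :
    δ _ X Y (compose μ μ' (X ⊗[k] Y) w) =
      TensorProduct.map (compose μ μ' X) (compose μ μ' Y) (δ _ _ _ (map _ (δ _ X Y) w)) := by
  induction w using induction with
  | h0 => simp
  | hadd v w hv hw => simp only [map_add, hv, hw]
  | h v ζ =>
  induction v using induction₂ with
  | h0 => simp [mk_zero]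
  | hadd v w hv hw => simp only [mk_add, map_add, hv, hw]
  | h x y ξ =>
  rw [compose_mk, δ_mk, map_mk, δ_mk]
  -- The comultiplication of ξ is not a pure tensor, so it is replaced by an arbitrary z to permit
  -- induction. The form θ is recorded only by its values on elements (1 ⊗ e) ⊗ f, which determine
  -- it.
  have key : ∀ z : Module.Dual k (k ⊗[k₀] A) ⊗[k] Module.Dual k (k ⊗[k₀] A),
      ∃ θ, TensorProduct.map (compose μ μ' X) (compose μ μ' Y)
        (δ (μ' : k →+* E') _ _ (mk _ (TensorProduct.map (mk _ x) (mk _ y) z) ζ)) =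
          TensorProduct.map (mk _ x) (mk _ y) θ ∧
        ∀ e f e' f', dualDistrib k _ _ θ (((1 ⊗ₜ e) ⊗ₜ f) ⊗ₜ ((1 ⊗ₜ e') ⊗ₜ f')) =
          ζ (μ' (dualDistrib k _ _ z ((1 ⊗ₜ e) ⊗ₜ (1 ⊗ₜ e'))) * (f * f')) := by
    intro z
    induction z with
    | zero => exact ⟨0, by simp [mk_zero], by simp⟩
    | add z z' h h' =>
      obtain ⟨θ, h₁, h₂⟩ := h
      obtain ⟨θ', h₁', h₂'⟩ := h'
      refine ⟨θ + θ', ?_, fun e f e' f' => ?_⟩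
      · simp only [map_add, mk_add, h₁, h₁']
      · simp only [map_add, LinearMap.add_apply, h₂, h₂', add_mul]
    | tmul ξ₁ ξ₂ =>
      refine ⟨TensorProduct.map (contract μ' ξ₁).dualMap (contract μ' ξ₂).dualMap (dualComul ζ),
        ?_, fun e f e' f' => ?_⟩
      · rw [TensorProduct.map_tmul, δ_mk, TensorProduct.map_map, TensorProduct.map_map]
        congr 2
        · exact LinearMap.ext fun ζ => compose_mk μ μ' x ξ₁ ζ
        · exact LinearMap.ext fun ζ => compose_mk μ μ' y ξ₂ ζ
      · rw [dualDistrib_map, dualDistrib_dualComul, dualDistrib_apply]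
        simp only [contract_tmul, one_smul, map_mul]
        congr 1
        ring
  obtain ⟨θ, h₁, h₂⟩ := key (dualComul ξ)
  rw [h₁]
  congr 1
  -- For z the comultiplication of ξ, both forms take the value ζ(μ'(ξ(1 ⊗ ee')) f f').
  refine (dualDistribEquiv k _ _).injective ?_
  refine TensorProduct.ext (linearMap_ext_of_tmul fun e f => linearMap_ext_of_tmul fun e' f' => ?_)
  refine Eq.trans ?_ (h₂ e f e' f').symm
  refine (dualDistrib_dualComul _ _ _).trans ?_
  simp

end Compose

end Induced

namespace Induced

/-! ### Transition maps between induced modules -/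

section Restrict

variable {k E E' E'' : Type u} [Field k] [CommRing E] [Algebra k E] [CommRing E'] [Algebra k E']
  [CommRing E''] [Algebra k E''] {μ : k →+* E}
variable {X Y : Type u} [AddCommGroup X] [Module k X] [AddCommGroup Y] [Module k Y]
variable (f : E →ₐ[k] E') (ν : k →+* E') (hν : ∀ c, ν c = f (μ c))

/-- The map `E'^∨ ⊗ X → E^∨ ⊗ X` induced by an algebra map `f : E → E'`. -/
def restrict : Induced ν X →ₗ[k] Induced μ X :=
  (shriekEval f (ρ μ X)).comp (toShriek f ν hν)

@[simp]
theorem restrict_mk (x : X) (η : Module.Dual k E') :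
    restrict f ν hν (mk ν x η) = mk μ x (η.comp f.toLinearMap) := by
  refine (toShriek_mk f ν hν x η 1).trans ?_
  congr 1
  ext
  simp

theorem restrict_comp_mk (x : X) :
    (restrict f ν hν).comp (mk ν x) = (mk μ x).comp f.toLinearMap.dualMap :=
  LinearMap.ext fun η => restrict_mk f ν hν x η

theorem restrict_ρ (a : E) (w : Induced ν X) :
    restrict f ν hν (ρ ν X (f a) w) = ρ μ X a (restrict f ν hν w) := by
  induction w using induction with
  | h0 => simp
  | h x η =>
    rw [ρ_mk, restrict_mk, restrict_mk, ρ_mk]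
    congr 1
    ext
    simp
  | hadd v w hv hw => simp only [map_add, hv, hw]

theorem restrict_map (g : X →ₗ[k] Y) (w : Induced ν X) :
    restrict f ν hν (map ν g w) = map μ g (restrict f ν hν w) := by
  induction w using induction with
  | h0 => simp
  | h x η => simp
  | hadd v w hv hw => simp only [map_add, hv, hw]

theorem toShriek_apply (w : Induced ν X) (y : E') :
    (toShriek f ν hν w).1 y = restrict f ν hν (ρ ν X y w) := by
  refine LinearMap.congr_fun (f := (LinearMap.applyₗ y).comp
    ((Submodule.subtype _).comp (toShriek f ν hν)))
    (g := (restrict f ν hν).comp (ρ ν X y)) (linearMap_ext fun x ξ => ?_) w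
  rw [LinearMap.comp_apply, LinearMap.comp_apply, LinearMap.comp_apply, ρ_mk, restrict_mk]
  refine (toShriek_mk f ν hν x ξ y).trans ?_
  congr 1
  ext a
  simp [mul_comm]

theorem toShriek_ρ (w : Induced ν X) (a y : E') :
    (toShriek f ν hν (ρ ν X a w)).1 y = (toShriek f ν hν w).1 (a * y) := by
  rw [toShriek_apply, toShriek_apply, mul_comm a y, map_mul]
  rfl

theorem restrict_restrict (g : E'' →ₐ[k] E) {κ : k →+* E''} (hμ : ∀ c, μ c = g (κ c))
    (h : E'' →ₐ[k] E') (hh : h = f.comp g) (hν' : ∀ c, ν c = h (κ c)) (w : Induced ν X) :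
    restrict g μ hμ (restrict f ν hν w) = restrict h ν hν' w := by
  subst hh
  induction w using induction with
  | h0 => simp
  | h x η =>
    rw [restrict_mk, restrict_mk, restrict_mk]
    rfl
  | hadd v w hv hw => simp only [map_add, hv, hw]

theorem restrict_id (h : ∀ c, μ c = AlgHom.id k E (μ c)) (w : Induced μ X) :
    restrict (AlgHom.id k E) μ h w = w := by
  induction w using induction with
  | h0 => simp
  | h x η =>
    rw [restrict_mk]
    rfl
  | hadd v w hv hw => simp only [map_add, hv, hw]

theorem δ_restrict [Module.Finite k E] [Module.Finite k E'] (w : Induced ν (X ⊗[k] Y)) :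
    δ μ X Y (restrict f ν hν w) =
      TensorProduct.map (restrict f ν hν) (restrict f ν hν) (δ ν X Y w) := by
  induction w using induction₂ with
  | h0 => simp
  | h x y η =>
    rw [restrict_mk, δ_mk, δ_mk, TensorProduct.map_map, restrict_comp_mk, restrict_comp_mk,
      ← TensorProduct.map_map, map_dualMap_dualComul]
    rfl
  | hadd v w hv hw => simp only [map_add, hv, hw]

/-- The isomorphism `E'^∨ ⊗ X ≅ f^!(E^∨ ⊗ X)`. -/
def shriekEquiv [Module.Finite k X] : Induced ν X ≃ₗ[k] shriek f (ρ μ X) :=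
  LinearEquiv.ofBijective (toShriek f ν hν) (toShriek_bijective f ν hν)

theorem shriekEquiv_apply [Module.Finite k X] (w : Induced ν X) (y : E') :
    (shriekEquiv f ν hν w).1 y = restrict f ν hν (ρ ν X y w) := toShriek_apply f ν hν w y

end Restrict

/-! ### Unit objects, exactness and the constraints of the tensor structure -/

section Constraints

variable {k E : Type u} [Field k] [CommRing E] [Algebra k E] {μ : k →+* E}
variable {X Y Z X' Y' : Type u} [AddCommGroup X] [Module k X] [AddCommGroup Y] [Module k Y]
  [AddCommGroup Z] [Module k Z] [AddCommGroup X'] [Module k X'] [AddCommGroup Y'] [Module k Y']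

variable (μ) in
/-- The isomorphism `E^∨ ⊗ k ≅ E^∨`. -/
def unitEquiv : Induced μ k ≃ₗ[k] Module.Dual k E where
  toLinearMap := coord μ LinearMap.id
  invFun := mk μ (1 : k)
  left_inv w := by
    change mk μ 1 (coord μ LinearMap.id w) = w
    induction w using induction with
    | h0 => simp
    | h x ξ =>
      rw [← LinearMap.comp_apply (coord μ _), coord_comp_mk]
      refine (mk_smul x 1 ξ).symm.trans ?_
      rw [smul_eq_mul, mul_one]
    | hadd v w hv hw => simp only [map_add, hv, hw]
  right_inv ξ := by
    ext y
    simp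

theorem unitEquiv_apply (w : Induced μ k) : unitEquiv μ w = coord μ LinearMap.id w := rfl

theorem unitEquiv_restrict {E' : Type u} [CommRing E'] [Algebra k E'] (f : E →ₐ[k] E')
    (ν : k →+* E') (hν : ∀ c, ν c = f (μ c)) (w : Induced ν k) (y : E) :
    unitEquiv μ (restrict f ν hν w) y = unitEquiv ν w (f y) := by
  induction w using induction with
  | h0 => simp
  | h x ξ => simp [unitEquiv_apply, hν]
  | hadd v w hv hw => simp only [map_add, LinearMap.add_apply, hv, hw]

variable (X) in
/-- The isomorphism `k^∨ ⊗ X ≅ X`. -/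
def idEquiv : Induced (RingHom.id k) X ≃ₗ[k] X where
  toLinearMap := lift (AddMonoidHom.mk'
      (fun x => (LinearMap.toSpanSingleton k X x).comp (LinearMap.applyₗ (1 : k)))
      (fun x y => by ext; simp))
    (fun c x ξ => by
      have : ξ c = c * ξ 1 := by rw [← smul_eq_mul, ← map_smul, smul_eq_mul, mul_one]
      simp [this, smul_smul, mul_comm])
  invFun x := mk (RingHom.id k) x LinearMap.id
  left_inv w := by
    simp only [AddHom.toFun_eq_coe, LinearMap.coe_toAddHom]
    induction w using induction with
    | h0 => simp [mk_zero]
    | h x ξ =>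
      rw [lift_mk]
      refine (mk_smul (ξ 1) x _).trans ?_
      congr 1
      ext
      simp
    | hadd v w hv hw => rw [map_add, mk_add, hv, hw]
  right_inv x := by simp

@[simp]
theorem idEquiv_mk (x : X) (ξ : Module.Dual k k) : idEquiv X (mk (RingHom.id k) x ξ) = ξ 1 • x := by
  change lift _ _ _ = _
  rw [lift_mk]
  rfl

theorem idEquiv_map (f : X →ₗ[k] Y) (w : Induced (RingHom.id k) X) :
    idEquiv Y (map _ f w) = f (idEquiv X w) := by
  induction w using induction with
  | h0 => simp
  | h x η => simp
  | hadd v w hv hw => simp only [map_add, hv, hw]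

theorem map_id (w : Induced μ X) : map μ LinearMap.id w = w := by
  induction w using induction with
  | h0 => simp
  | h x η => simp
  | hadd v w hv hw => simp only [map_add, hv, hw]

theorem map_comp (f : X →ₗ[k] Y) (g : Y →ₗ[k] Z) (w : Induced μ X) :
    map μ (g.comp f) w = map μ g (map μ f w) := by
  induction w using induction with
  | h0 => simp
  | h x η => simp
  | hadd v w hv hw => simp only [map_add, hv, hw]

theorem map_comp_mk (f : X →ₗ[k] Y) (x : X) : (map μ f).comp (mk μ x) = mk μ (f x) :=
  LinearMap.ext fun ξ => map_mk f x ξ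

theorem map_add_left (f g : X →ₗ[k] Y) : map μ (f + g) = map μ f + map μ g :=
  linearMap_ext fun x ξ => by simp [mk_add]

/-- Functoriality is linear only in scalars that μ treats like the structure map of E. For an action
these include the image of k₀, whence the k₀-linearity of τ. -/
theorem map_smul_of_eq (c : k) (h : μ c = algebraMap k E c) (f : X →ₗ[k] Y) :
    map μ (c • f) = c • map μ f :=
  linearMap_ext fun x ξ => by
    rw [map_mk, LinearMap.smul_apply, mk_smul, h, LinearMap.smul_apply, map_mk, ← map_smul]
    congr 1
    ext y
    simp [← Algebra.smul_def]

theorem map_injective (f : X →ₗ[k] Y) (hf : Function.Injective f) :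
    Function.Injective (map μ f) := by
  obtain ⟨g, hg⟩ := f.exists_leftInverse_of_injective (LinearMap.ker_eq_bot.2 hf)
  refine Function.LeftInverse.injective (g := map μ g) fun w => ?_
  rw [← map_comp, hg, map_id]

theorem map_surjective (f : X →ₗ[k] Y) (hf : Function.Surjective f) :
    Function.Surjective (map μ f) := by
  obtain ⟨g, hg⟩ := f.exists_rightInverse_of_surjective (LinearMap.range_eq_top.2 hf)
  refine Function.RightInverse.surjective (g := map μ g) fun w => ?_
  rw [← map_comp, hg, map_id]

/-- With a section s of g, every y - s (g y) lies in the image of f. Applying the functor to this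
decomposition gives exactness without any flatness argument. -/
theorem map_exact (f : X →ₗ[k] Y) (g : Y →ₗ[k] Z) (hfg : Function.Exact f g)
    (hg : Function.Surjective g) : Function.Exact (map μ f) (map μ g) := by
  obtain ⟨s, hs⟩ := g.exists_rightInverse_of_surjective (LinearMap.range_eq_top.2 hg)
  have hgf : g.comp f = 0 := hfg.linearMap_comp_eq_zero
  have hr : ∀ y, ∃ x, f x = y - s (g y) := fun y => by
    refine (hfg _).1 ?_
    rw [map_sub, ← LinearMap.comp_apply g s, hs]
    simp
  intro w
  constructor
  · intro hw
    have h : ∀ v : Induced μ Y, v - map μ s (map μ g v) ∈ LinearMap.range (map μ f) := by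
      intro v
      induction v using induction with
      | h0 => simp
      | h y ξ =>
        obtain ⟨x, hx⟩ := hr y
        refine ⟨mk μ x ξ, ?_⟩
        rw [map_mk, hx, map_mk, map_mk, eq_sub_iff_add_eq, ← mk_add, sub_add_cancel]
      | hadd v w hv hw =>
        rw [map_add, map_add, add_sub_add_comm]
        exact add_mem hv hw
    have := h w
    rwa [hw, map_zero, sub_zero] at this
  · rintro ⟨v, rfl⟩
    rw [← map_comp, hgf]
    induction v using induction with
    | h0 => simp
    | h y ξ => simp [mk_zero]
    | hadd v w hv hw => simp only [map_add, hv, hw, add_zero]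

variable [Module.Finite k E]

theorem δ_map (f : X →ₗ[k] X') (g : Y →ₗ[k] Y') (w : Induced μ (X ⊗[k] Y)) :
    δ μ X' Y' (map μ (TensorProduct.map f g) w) =
      TensorProduct.map (map μ f) (map μ g) (δ μ X Y w) := by
  induction w using induction₂ with
  | h0 => simp
  | h x y η =>
    rw [map_mk, TensorProduct.map_tmul, δ_mk, δ_mk, TensorProduct.map_map, map_comp_mk,
      map_comp_mk]
  | hadd v w hv hw => simp only [map_add, hv, hw]

theorem δ_comp_mk (x : X) (y : Y) :
    (δ μ X Y).comp (mk μ (x ⊗ₜ y)) = (TensorProduct.map (mk μ x) (mk μ y)).comp dualComul :=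
  LinearMap.ext fun ξ => δ_mk x y ξ

theorem assoc_δ (w : Induced μ ((X ⊗[k] Y) ⊗[k] Z)) :
    TensorProduct.assoc k _ _ _ (TensorProduct.map (δ μ X Y) LinearMap.id (δ μ (X ⊗[k] Y) Z w)) =
      TensorProduct.map LinearMap.id (δ μ Y Z)
        (δ μ X (Y ⊗[k] Z) (map μ (TensorProduct.assoc k X Y Z).toLinearMap w)) := by
  induction w using induction with
  | h0 => simp
  | hadd v w hv hw => simp only [map_add, hv, hw]
  | h t ξ =>
  induction t with
  | zero => simp [mk_zero]
  | add t t' h h' => simp only [map_add, mk_add, h, h']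
  | tmul t z =>
  induction t with
  | zero => simp [mk_zero]
  | add t t' h h' => simp only [map_add, mk_add, TensorProduct.add_tmul, h, h']
  | tmul x y =>
    rw [map_mk, LinearEquiv.coe_coe, TensorProduct.assoc_tmul, δ_mk, δ_mk, TensorProduct.map_map,
      TensorProduct.map_map, δ_comp_mk, δ_comp_mk, LinearMap.id_comp, LinearMap.id_comp]
    have h₁ : ∀ v : Module.Dual k E ⊗[k] Module.Dual k E,
        TensorProduct.map (mk μ x) ((TensorProduct.map (mk μ y) (mk μ z)).comp dualComul) v =
          TensorProduct.map (mk μ x) (TensorProduct.map (mk μ y) (mk μ z))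
            (TensorProduct.map LinearMap.id dualComul v) := fun v => by
      rw [TensorProduct.map_map, LinearMap.comp_id]
    have h₂ : ∀ v : Module.Dual k E ⊗[k] Module.Dual k E,
        TensorProduct.map ((TensorProduct.map (mk μ x) (mk μ y)).comp dualComul) (mk μ z) v =
          TensorProduct.map (TensorProduct.map (mk μ x) (mk μ y)) (mk μ z)
            (TensorProduct.map dualComul LinearMap.id v) := fun v => by
      rw [TensorProduct.map_map, LinearMap.comp_id]
    rw [h₁, h₂, ← assoc_dualComul, TensorProduct.map_map_assoc]

theorem comm_δ (w : Induced μ (X ⊗[k] Y)) :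
    TensorProduct.comm k _ _ (δ μ X Y w) =
      δ μ Y X (map μ (TensorProduct.comm k X Y).toLinearMap w) := by
  induction w using induction₂ with
  | h0 => simp
  | h x y ξ =>
    rw [map_mk, LinearEquiv.coe_coe, TensorProduct.comm_tmul, δ_mk, δ_mk, ← TensorProduct.map_comm,
      comm_dualComul]
  | hadd v w hv hw => simp only [map_add, hv, hw]

/-- On a generator ξ ⊗ (c ⊗ x) the scalar c acts on the comultiplied form as multiplication by μ c,
and what is left is the counit law `lid_dualComul`. -/
theorem lid_δ (w : Induced μ (k ⊗[k] X)) :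
    TensorProduct.lid k _ (TensorProduct.map ((LinearMap.applyₗ (1 : E)).comp
      (unitEquiv μ).toLinearMap) LinearMap.id (δ μ k X w)) =
      map μ (TensorProduct.lid k X).toLinearMap w := by
  induction w using induction₂ with
  | h0 => simp
  | h c x ξ =>
    rw [map_mk, LinearEquiv.coe_coe, TensorProduct.lid_tmul, δ_mk, TensorProduct.map_map, mk_smul']
    have h : ∀ v : Module.Dual k E ⊗[k] Module.Dual k E,
        TensorProduct.lid k _ (TensorProduct.map (((LinearMap.applyₗ (1 : E)).comp
          (unitEquiv μ).toLinearMap).comp (mk μ c)) (LinearMap.id.comp (mk μ x)) v) =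
          mk μ x (TensorProduct.lid k _ (TensorProduct.map (LinearMap.applyₗ (1 : E)) LinearMap.id
            (TensorProduct.map (LinearMap.mulLeft k (μ c)).dualMap LinearMap.id v))) := by
      intro v
      induction v with
      | zero => simp
      | add t t' h h' => simp only [map_add, h, h']
      | tmul ξ η => simp [unitEquiv_apply]
    rw [h, map_mulLeft_id_dualComul, lid_dualComul]
    rfl
  | hadd v w hv hw => simp only [map_add, hv, hw]

end Constraints

end Induced

/-! ### The functor X ↦ E^∨ ⊗ X into the prolongation -/

section InducedPlng

variable {k : Type u} [Field k] {E : FormalSet k}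

/-- A compatible family of ring maps from `k` to the algebras of a pro-finite algebra. -/
structure CompatibleMaps (E : FormalSet k) where
  /-- the maps -/
  map : ∀ i, k →+* E.A i
  compat : ∀ {i j : E.I} (u : i ⟶ j) c, map j c = E.tr u (map i c)

variable (ν : CompatibleMaps E)

/-- The object `E^∨ ⊗ X` of the prolongation category. -/
def inducedPlng (X : FGModuleCat.{u} k) : Plng E where
  X i := FGModuleCat.of k (Induced (ν.map i) X)
  ρ i := Induced.ρ (ν.map i) X
  injective i := Induced.isInjectiveAction
  t {i j} u := Induced.restrict (E.tr u) (ν.map j) (ν.compat u)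
  t_id i x := by
    have h : E.tr (𝟙 i) = AlgHom.id k _ := by
      rw [FormalSet.tr, E.alg.map_id]
      rfl
    have h' : ∀ (f : E.A i →ₐ[k] E.A i) (hf : f = AlgHom.id k _)
      (hν : ∀ c, ν.map i c = f (ν.map i c)), Induced.restrict f (ν.map i) hν x = x := by
      rintro f rfl hν
      exact Induced.restrict_id _ _
    exact h' _ h _
  t_comp u v x := by
    refine (Induced.restrict_restrict _ _ _ _ _ _ ?_ _ _).symm
    rw [FormalSet.tr, E.alg.map_comp]
    rfl
  t_linear u a x := Induced.restrict_ρ _ _ _ a x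
  cartesian {i j} u := by
    convert Induced.toShriek_bijective (X := X) (E.tr u) (ν.map j) (ν.compat u) using 1
    funext w
    refine Subtype.ext (LinearMap.ext fun y => ?_)
    exact (Induced.toShriek_apply _ _ _ w y).symm

/-- The functor `X ↦ E^∨ ⊗ X`. -/
def inducedFunctor : FGModuleCat.{u} k ⥤ Plng E where
  obj := inducedPlng ν
  map f :=
    { app := fun i => Induced.map (ν.map i) f.hom.hom
      linear := fun _ a x => Induced.map_ρ _ a x
      comm := fun _ x => (Induced.restrict_map _ _ _ _ x).symm }
  map_id _ := Plng.Hom.ext (funext fun _ => LinearMap.ext fun w => Induced.map_id w)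
  map_comp _ _ := Plng.Hom.ext (funext fun _ => LinearMap.ext fun w => Induced.map_comp _ _ w)

theorem inducedFunctor_exact : IsExactFunctor (inducedFunctor ν) := by
  intro _ _ _ _ _ _ hf hfg hg
  exact ⟨Induced.map_injective _ hf, Induced.map_exact _ _ hfg hg, Induced.map_surjective _ hg⟩

/-- The tensor structure of the functor `X ↦ E^∨ ⊗ X`. -/
def inducedTensor : TensorStructure (inducedFunctor ν) where
  mulIso i X Y := Induced.δEquiv (ν.map i) X Y
  unitIso i := Induced.unitEquiv (ν.map i)
  mul_linear _ _ _ a w := (Induced.ρ_δ a w).symm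
  mul_trans _ _ _ w := Induced.δ_restrict _ _ _ w
  unit_linear _ a w y := Induced.coord_ρ _ a w y
  unit_trans _ w y := Induced.unitEquiv_restrict _ _ _ w y
  natural _ _ _ _ _ f g w := Induced.δ_map f.hom.hom g.hom.hom w
  assoc _ _ _ _ w := Induced.assoc_δ w
  comm _ _ _ w := Induced.comm_δ w
  unit _ _ w := Induced.lid_δ w

end InducedPlng

variable {k₀ k : Type u} [CommRing k₀] [Field k] [Algebra k₀ k] {M : FormalMonoid k₀}

theorem FormalSet.point_comp_tr {R : Type u} [CommRing R] (M : FormalSet R) {B : Type u}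
    [CommRing B] [Algebra R B] {i j : M.I} (u : i ⟶ j) (φ : M.A j →ₐ[R] B) :
    M.point i (φ.comp (M.tr u)) = M.point j φ :=
  (Quot.sound (r := M.PointRel B) (a := ⟨j, φ⟩) (b := ⟨i, φ.comp (M.tr u)⟩) ⟨u, rfl⟩).symm

theorem liftScalar_restrictScalars_comp {A F F' : Type u} [CommRing A] [Algebra k₀ A] [CommRing F]
    [Algebra k₀ F] [Algebra k F] [IsScalarTower k₀ k F] [CommRing F'] [Algebra k₀ F'] [Algebra k F']
    [IsScalarTower k₀ k F'] (φ : A →ₐ[k₀] F) (g : F →ₐ[k] F') :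
    liftScalar (k := k) ((g.restrictScalars k₀).comp φ) = g.comp (liftScalar φ) := by
  ext
  simp [liftScalar]

/-! ### Compatibilities needed for the isomorphisms a and b of an induced functor -/

namespace Induced

section

variable {E E' E'' : Type u} [CommRing E] [Algebra k E] [CommRing E'] [Algebra k E']
  [CommRing E''] [Algebra k E''] {μ : k →+* E}
variable {X Y : Type u} [AddCommGroup X] [Module k X] [AddCommGroup Y] [Module k Y]

theorem δ_mk_id (z : X ⊗[k] Y) :
    δ (RingHom.id k) X Y (mk (RingHom.id k) z LinearMap.id) =
      TensorProduct.map (idEquiv X).symm.toLinearMap (idEquiv Y).symm.toLinearMap z := by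
  induction z with
  | zero => simp [mk_zero]
  | add z z' h h' => rw [mk_add, map_add, map_add, h, h']
  | tmul x y =>
    rw [δ_mk]
    exact congrArg _ (dualComul_algHom (AlgHom.id k k))

variable [Module.Finite k X] [Module.Finite k Y]

theorem shriekCongr_shriekEquiv (f : E →ₐ[k] E') (ν : k →+* E') (hν : ∀ c, ν c = f (μ c))
    (g : X →ₗ[k] Y) (h : ∀ a x, map μ g (ρ μ X a x) = ρ μ Y a (map μ g x)) (w : Induced ν X) :
    shriekCongr f (ρ μ X) (ρ μ Y) (map μ g) h (shriekEquiv f ν hν w) =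
      shriekEquiv f ν hν (map ν g w) := by
  refine Subtype.ext (LinearMap.ext fun y => ?_)
  rw [shriekEquiv_apply, ← map_ρ, restrict_map, ← shriekEquiv_apply]
  rfl

theorem shriekMap_shriekEquiv (f : E →ₐ[k] E') (f' : E'' →ₐ[k] E') (g : E'' →ₐ[k] E)
    (hf : f' = f.comp g) {κ : k →+* E''} (hμ : ∀ c, μ c = g (κ c)) (ν : k →+* E')
    (hν : ∀ c, ν c = f (μ c)) (hν' : ∀ c, ν c = f' (κ c))
    (h : ∀ a x, restrict g μ hμ (ρ μ X (g a) x) = ρ κ X a (restrict g μ hμ x))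
    (w : Induced ν X) :
    shriekMap f f' g hf (ρ μ X) (ρ κ X) (restrict g μ hμ) h (shriekEquiv f ν hν w) =
      shriekEquiv f' ν hν' w := by
  refine Subtype.ext (LinearMap.ext fun y => ?_)
  rw [shriekEquiv_apply, ← restrict_restrict f ν hν g hμ f' hf hν', ← shriekEquiv_apply]
  rfl

end

section

variable {A A₁ E' E₁ E : Type u} [CommRing A] [Algebra k₀ A] [CommRing A₁] [Algebra k₀ A₁]
  [CommRing E'] [Algebra k₀ E'] [Algebra k E'] [IsScalarTower k₀ k E']
  [CommRing E₁] [Algebra k₀ E₁] [Algebra k E₁] [IsScalarTower k₀ k E₁] [CommRing E] [Algebra k E]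
  (μ : k →ₐ[k₀] k ⊗[k₀] A) (μ' : k →ₐ[k₀] E') {X : Type u} [AddCommGroup X] [Module k X]

/-- On a generator both sides are ζ(μ'(ξ(μ x))). The left one evaluates the contraction at the
shifted scalar, which `contract_comp_mulLeft` turns into an evaluation at 1. -/
theorem unit_compose (f : E →ₐ[k] (k ⊗[k₀] A) ⊗[k] E') {κ : k →+* E}
    (h : ∀ c, (compScalar μ μ' : k →+* (k ⊗[k₀] A) ⊗[k] E') c = f (κ c))
    (w : Induced (μ' : k →+* E') (Induced (μ : k →+* k ⊗[k₀] A) k)) :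
    unitEquiv κ (restrict f _ h (compose μ μ' k w)) 1 =
      unitEquiv _ (map _ ((LinearMap.applyₗ 1).comp (unitEquiv _).toLinearMap) w) 1 := by
  induction w using induction_mk_mk with
  | h0 => simp
  | h x ξ ζ =>
    rw [compose_mk, restrict_mk, map_mk, unitEquiv_apply, unitEquiv_apply, coord_mk, coord_mk]
    simp only [LinearMap.comp_apply, LinearEquiv.coe_coe, LinearMap.applyₗ_apply_apply,
      unitEquiv_apply, coord_mk, LinearMap.id_apply, mul_one, AlgHom.toLinearMap_apply, ← h]
    change ζ (contract μ' ξ (scalarShift μ' (μ x))) = ζ (μ' (ξ (μ x)))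
    have := LinearMap.congr_fun (contract_comp_mulLeft μ' (μ x) ξ) 1
    rw [contract_one] at this
    simpa using congrArg ζ this.symm
  | hadd v w hv hw => simp only [map_add, LinearMap.add_apply, hv, hw]

theorem restrict_compose_restrict (μ₁ : k →ₐ[k₀] k ⊗[k₀] A₁) (μ₁' : k →ₐ[k₀] E₁)
    (p : A →ₐ[k₀] A₁) (q : E' →ₐ[k] E₁)
    (hp : ∀ c, (μ₁ : k →+* k ⊗[k₀] A₁) c =
      Algebra.TensorProduct.map (AlgHom.id k k) p ((μ : k →+* k ⊗[k₀] A) c))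
    (hq : ∀ c, (μ₁' : k →+* E₁) c = q ((μ' : k →+* E') c))
    (hpq : ∀ c, (compScalar μ₁ μ₁' : k →+* (k ⊗[k₀] A₁) ⊗[k] E₁) c =
      Algebra.TensorProduct.map (Algebra.TensorProduct.map (AlgHom.id k k) p) q
        ((compScalar μ μ' : k →+* (k ⊗[k₀] A) ⊗[k] E') c))
    (w : Induced (μ₁' : k →+* E₁) (Induced (μ₁ : k →+* k ⊗[k₀] A₁) X)) :
    compose μ μ' X (map _ (restrict (Algebra.TensorProduct.map (AlgHom.id k k) p) _ hp)
      (restrict q _ hq w)) =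
      restrict (Algebra.TensorProduct.map (Algebra.TensorProduct.map (AlgHom.id k k) p) q) _ hpq
        (compose μ₁ μ₁' X w) := by
  induction w using induction_mk_mk with
  | h0 => simp
  | h x ξ ζ =>
    rw [restrict_mk, map_mk, restrict_mk, compose_mk, compose_mk, restrict_mk,
      LinearMap.comp_assoc, comp_contract μ' p q μ₁' hq]
    rfl
  | hadd v w hv hw => simp only [map_add, hv, hw]

end

end Induced

/-! ### From an action to an E₀-structure -/

namespace Action

/-- Yoneda: the pair consisting of the point φ and of z is the image of the tautological pair over k
⊗ A_i under the map to B that z and φ define. Hence the coactions determine the action. -/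
theorem smul_point (μ : Action M k) {B : Type u} [CommRing B] [Algebra k₀ B] (i : M.I)
    (φ : M.A i →ₐ[k₀] B) (z : k →ₐ[k₀] B) :
    μ.smul B (M.point i φ) z =
      (Algebra.TensorProduct.lift z φ fun _ _ => Commute.all _ _).comp (μ.coaction i) := by
  rw [coaction, μ.natural]
  congr 1
  · refine congrArg (M.point i) (AlgHom.ext fun a => ?_)
    simp
  · ext c
    simp

theorem ext_coaction {μ ν : Action M k} (h : ∀ i, μ.coaction i = ν.coaction i) : μ = ν := by
  ext B _ _ g z : 6
  induction g using Quot.ind with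
  | mk p => exact (μ.smul_point p.1 p.2 z).trans ((congrArg _ (h p.1)).trans
      (ν.smul_point p.1 p.2 z).symm)

theorem coaction_trans (μ : Action M k) {i j : M.I} (u : i ⟶ j) (c : k) :
    μ.coaction j c = (M.baseChange k).tr u (μ.coaction i c) := by
  let f : k ⊗[k₀] M.A i →ₐ[k₀] k ⊗[k₀] M.A j :=
    (Algebra.TensorProduct.map (AlgHom.id k k) (M.tr u)).restrictScalars k₀
  have h := μ.natural f (M.point i Algebra.TensorProduct.includeRight) Algebra.TensorProduct.includeLeft
  refine (AlgHom.congr_fun (Eq.trans h ?_) c).symm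
  rw [coaction]
  congr 1
  · refine Eq.trans ?_ (M.point_comp_tr u
      (Algebra.TensorProduct.includeRight : M.A j →ₐ[k₀] k ⊗[k₀] M.A j))
    refine congrArg (M.point i) (AlgHom.ext fun a => ?_)
    simp [f]
  · ext c
    simp [f]

theorem liftScalar_coaction {B : Type u} [CommRing B] [Algebra k₀ B] [Algebra k B]
    [IsScalarTower k₀ k B] (μ : Action M k) (i : M.I) (φ : M.A i →ₐ[k₀] B) (c : k) :
    liftScalar φ (μ.coaction i c) =
      μ.smul B (M.point i φ) ((Algebra.ofId k B).restrictScalars k₀) c := by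
  rw [smul_point, AlgHom.comp_apply]
  generalize μ.coaction i c = a
  induction a with
  | zero => simp
  | tmul c e => simp [liftScalar]
  | add a b ha hb => rw [map_add, map_add, ha, hb]

theorem liftScalar_coaction_one (μ : Action M k) (l : M.I) (φ : M.A l →ₐ[k₀] k)
    (hφ : M.point l φ = 1) (c : k) : liftScalar φ (μ.coaction l c) = c := by
  rw [liftScalar_coaction, hφ, μ.one_smul]
  rfl

/-- Associativity for the two tautological points: the point over E_j moves the structure map k →
E_i ⊗ E_j to μ^# in the second factor, and the point over E_i then acts on this new k-structure,
which gives `compScalar`. -/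
theorem liftScalar_coaction_mul (μ : Action M k) (i j l : M.I) (φ : M.A l →ₐ[k₀] EEAlg k M i j)
    (hφ : M.point l φ = mulPoint k M i j) (c : k) :
    liftScalar φ (μ.coaction l c) =
      Induced.compScalar (μ.coaction i) (μ.coaction j) c := by
  rw [liftScalar_coaction, hφ, mulPoint, μ.mul_smul, smul_point, smul_point]
  refine AlgHom.congr_fun (congrArg (fun f : k ⊗[k₀] M.A i →ₐ[k₀] EEAlg k M i j =>
    f.comp (μ.coaction i)) ?_) c
  refine Algebra.TensorProduct.ext ?_ ?_
  · rw [Algebra.TensorProduct.lift_comp_includeLeft, scalarShift,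
      Algebra.TensorProduct.lift_comp_includeLeft]
    congr 1
    refine Algebra.TensorProduct.ext ?_ ?_
    · rw [Algebra.TensorProduct.lift_comp_includeLeft]
      ext c
      exact (AlgHom.commutes (Algebra.TensorProduct.includeRight (R := k) (A := EAlg k M i)
        (B := EAlg k M j)) c).symm
    · ext a
      simp [inr]
  · ext a
    simp [inl, scalarShift]

/-- The family of coactions of an action. -/
def coactionMaps (μ : Action M k) : CompatibleMaps (M.baseChange k) where
  map i := (μ.coaction i : k →+* k ⊗[k₀] M.A i)
  compat u c := μ.coaction_trans u c

variable (μ : Action M k)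

theorem id_eq_liftScalar (l : M.I) (φ : M.A l →ₐ[k₀] k) (hφ : M.point l φ = 1) (c : k) :
    RingHom.id k c = liftScalar φ (μ.coactionMaps.map l c) :=
  (μ.liftScalar_coaction_one l φ hφ c).symm

theorem compScalar_eq_liftScalar (i j l : M.I) (φ : M.A l →ₐ[k₀] EEAlg k M i j)
    (hφ : M.point l φ = mulPoint k M i j) (c : k) :
    (Induced.compScalar (μ.coaction i) (μ.coaction j) : k →+* EEAlg k M i j) c =
      liftScalar φ (μ.coactionMaps.map l c) :=
  (μ.liftScalar_coaction_mul i j l φ hφ c).symm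

/-- The isomorphism `X ≅ φ^!(E_l^∨ ⊗ X)` for a representative `φ` of the unit. -/
def unitShriek (l : M.I) (φ : M.A l →ₐ[k₀] k) (hφ : M.point l φ = 1) (X : Type u)
    [AddCommGroup X] [Module k X] [Module.Finite k X] :
    Induced (RingHom.id k) X ≃ₗ[k] shriek (liftScalar φ) (Induced.ρ (μ.coactionMaps.map l) X) :=
  Induced.shriekEquiv (liftScalar φ) (RingHom.id k) (μ.id_eq_liftScalar l φ hφ)

/-- The unit isomorphism for the functor `X ↦ E^∨ ⊗ X` defined by an action. -/
def unitIso : UnitIso (inducedTensor μ.coactionMaps) where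
  iso l φ hφ X := (μ.unitShriek l φ hφ X).symm.trans (Induced.idEquiv X)
  natural l φ hφ X Y f w := by
    obtain ⟨w, rfl⟩ := (μ.unitShriek l φ hφ X).surjective w
    refine Eq.trans (congrArg _ (Induced.shriekCongr_shriekEquiv _ _ _ f.hom.hom _ w)) ?_
    refine (congrArg _ ((μ.unitShriek l φ hφ Y).symm_apply_apply _)).trans ?_
    refine (Induced.idEquiv_map f.hom.hom w).trans ?_
    exact congrArg (fun v => f.hom.hom (Induced.idEquiv X v))
      ((μ.unitShriek l φ hφ X).symm_apply_apply w).symm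
  trans {l l'} v φ hφ hφ' X w := by
    obtain ⟨w, rfl⟩ := (μ.unitShriek l φ hφ X).surjective w
    refine Eq.trans (congrArg _ (Induced.shriekMap_shriekEquiv _ _ _ _ _ _ _
      (μ.id_eq_liftScalar l' _ hφ') _ w)) ?_
    refine (congrArg _ ((μ.unitShriek l' _ hφ' X).symm_apply_apply _)).trans ?_
    exact congrArg (Induced.idEquiv X) ((μ.unitShriek l φ hφ X).symm_apply_apply w).symm
  iso_tensor l φ hφ X Y z := by
    refine (Induced.δ_restrict _ _ _ _).trans ?_
    refine (congrArg _ (Induced.δ_mk_id z)).trans ?_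
    exact TensorProduct.map_map _ _ _ _ _
  iso_unit l φ hφ c := by
    refine (Induced.unitEquiv_restrict (liftScalar φ) _ (μ.id_eq_liftScalar l φ hφ)
      (Induced.mk (RingHom.id k) c LinearMap.id) 1).trans ?_
    rw [Induced.unitEquiv_apply, Induced.coord_mk]
    simp

/-- The isomorphism `E_j^∨ ⊗ (E_i^∨ ⊗ X) ≅ φ^!(E_l^∨ ⊗ X)` for a representative `φ` of the
product. -/
def mulShriek (i j l : M.I) (φ : M.A l →ₐ[k₀] EEAlg k M i j)
    (hφ : M.point l φ = mulPoint k M i j) (X : Type u)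
    [AddCommGroup X] [Module k X] [Module.Finite k X] :
    Induced (Induced.compScalar (μ.coaction i) (μ.coaction j) : k →+* EEAlg k M i j) X ≃ₗ[k]
      shriek (liftScalar φ) (Induced.ρ (μ.coactionMaps.map l) X) :=
  Induced.shriekEquiv (liftScalar φ) _ (μ.compScalar_eq_liftScalar i j l φ hφ)

/-- The product isomorphism for the functor `X ↦ E^∨ ⊗ X` defined by an action. -/
def mulIso : MulIso (inducedTensor μ.coactionMaps) where
  iso i j l φ hφ X := (LinearEquiv.ofBijective
    (Induced.compose (μ.coaction i) (μ.coaction j) X)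
    (Induced.compose_bijective _ _)).trans (μ.mulShriek i j l φ hφ X)
  linear_left i j l φ hφ X e w y := by
    refine Eq.trans (congrArg (fun v => (μ.mulShriek i j l φ hφ X v).1 y)
      (Induced.compose_map_ρ (μ.coaction i) (μ.coaction j) (1 ⊗ₜ e) w)) ?_
    refine (Induced.toShriek_ρ _ _ (μ.compScalar_eq_liftScalar i j l φ hφ) _ _ _).trans ?_
    rw [scalarShift_tmul, map_one]
    rfl
  linear_right i j l φ hφ X e w y := by
    refine Eq.trans (congrArg (fun v => (μ.mulShriek i j l φ hφ X v).1 y)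
      (Induced.compose_ρ (μ.coaction i) (μ.coaction j) e w)) ?_
    exact Induced.toShriek_ρ _ _ _ _ _ _
  natural i j l φ hφ X Y f w := by
    refine Eq.trans (congrArg (μ.mulShriek i j l φ hφ Y)
      (Induced.compose_map_map (μ.coaction i) (μ.coaction j) f.hom.hom w)) ?_
    exact (Induced.shriekCongr_shriekEquiv _ _ _ f.hom.hom _ _).symm
  trans i j l l' v φ hφ hφ' X w :=
    (Induced.shriekMap_shriekEquiv _ _ _ _ _ _ _ _ _ _).symm
  trans' {i i' j j'} p q l φ hφ hφ' X w y := by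
    -- Both composed scalar maps are read off from the same coaction at l, since φ represents the
    -- product at level (i, j) and its composite with the transition map represents it at level (i',
    -- j').
    have hpq : ∀ c, Induced.compScalar (μ.coaction i') (μ.coaction j') c =
        trEE k M p q (Induced.compScalar (μ.coaction i) (μ.coaction j) c) := fun c => by
      rw [← μ.liftScalar_coaction_mul i' j' l _ hφ', ← μ.liftScalar_coaction_mul i j l φ hφ,
        liftScalar_restrictScalars_comp]
      rfl
    refine Eq.trans (congrArg (fun v => (μ.mulShriek i j l φ hφ X v).1 y)
      (Induced.restrict_compose_restrict (μ.coaction i) (μ.coaction j) (μ.coaction i')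
        (μ.coaction j') (M.tr p) (Algebra.TensorProduct.map (AlgHom.id k k) (M.tr q))
        (μ.coaction_trans p) (μ.coaction_trans q) hpq w)) ?_
    generalize hv : Induced.compose (μ.coaction i') (μ.coaction j') X w = v
    refine (Induced.shriekEquiv_apply _ _ _ _ _).trans ?_
    refine (congrArg _ (Induced.restrict_ρ (trEE k M p q) _ hpq y v).symm).trans ?_
    refine (Induced.restrict_restrict _ _ _ _ _ _ (liftScalar_restrictScalars_comp φ _)
      (μ.compScalar_eq_liftScalar i' j' l _ hφ') _).trans ?_
    rw [← hv]
    exact (Induced.shriekEquiv_apply _ _ (μ.compScalar_eq_liftScalar i' j' l _ hφ') _ _).symm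
  iso_tensor i j l φ hφ X Y w := by
    refine (Induced.δ_restrict _ _ _ _).trans ?_
    refine (congrArg _ (Induced.compose_tensor (μ.coaction i) (μ.coaction j) w)).trans ?_
    exact TensorProduct.map_map _ _ _ _ _
  iso_unit i j l φ hφ w := by
    refine Eq.trans ?_ (Induced.unit_compose (μ.coaction i) (μ.coaction j)
      (liftScalar φ) (μ.compScalar_eq_liftScalar i j l φ hφ) w)
    rfl

/-- The `E₀`-structure defined by an action. -/
def toEStructure : EStructure k M where
  τ := inducedFunctor μ.coactionMaps
  map_add i X Y f g := Induced.map_add_left _ _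
  map_smul i X Y c f := by
    refine Induced.map_smul_of_eq _ ?_ _
    change μ.coaction i (algebraMap k₀ k c) = algebraMap k (k ⊗[k₀] M.A i) (algebraMap k₀ k c)
    rw [AlgHom.commutes, ← IsScalarTower.algebraMap_apply]
  exact := inducedFunctor_exact _
  tensor := inducedTensor _
  a := μ.unitIso
  b := μ.mulIso

end Action

variable {k₀ k : Type u} [CommRing k₀] [Field k] [Algebra k₀ k] {M : FormalMonoid k₀}

/-! ### Elements and linear forms as morphisms from and to 𝟙 -/

section Elements

variable (X : FGModuleCat.{u} k)

/-- The morphism `𝟙 → X` that corresponds to an element of `X`. -/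
def elemHom (x : X) : 𝟙_ (FGModuleCat.{u} k) ⟶ X := ⟨ModuleCat.ofHom (LinearMap.toSpanSingleton k X x)⟩

/-- The morphism `X → 𝟙` that corresponds to a linear form on `X`. -/
def formHom (f : Module.Dual k X) : X ⟶ 𝟙_ (FGModuleCat.{u} k) := ⟨ModuleCat.ofHom f⟩

variable {X}

theorem elemHom_comp {Y : FGModuleCat.{u} k} (f : X ⟶ Y) (x : X) :
    elemHom X x ≫ f = elemHom Y (f.hom.hom x) := by
  refine FGModuleCat.hom_ext (LinearMap.ext fun (c : k) => ?_)
  exact map_smul f.hom.hom c x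

theorem elemHom_formHom (f : Module.Dual k X) (x : X) :
    elemHom X x ≫ formHom X f = f x • 𝟙 (𝟙_ (FGModuleCat.{u} k)) := by
  refine FGModuleCat.hom_ext (LinearMap.ext fun (c : k) => ?_)
  refine (map_smul f c x).trans ?_
  exact mul_comm c (f x)

theorem elemHom_add (x y : X) : elemHom X (x + y) = elemHom X x + elemHom X y :=
  FGModuleCat.hom_ext (LinearMap.ext fun (c : k) => smul_add c x y)

/-- Placing the scalar on the source 𝟙 makes it an element of End(𝟙), which is how `tauOne` enters
the description of τ(X). -/
theorem elemHom_smul (c : k) (x : X) :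
    elemHom X (c • x) = (c • 𝟙 (𝟙_ (FGModuleCat.{u} k))) ≫ elemHom X x := by
  refine FGModuleCat.hom_ext (LinearMap.ext fun (d : k) => ?_)
  change d • c • x = (c * d) • x
  rw [smul_smul, mul_comm]

theorem elemHom_one : elemHom (𝟙_ (FGModuleCat.{u} k)) (1 : k) = 𝟙 _ :=
  FGModuleCat.hom_ext (LinearMap.ext fun (d : k) => mul_one d)

/-- This resolution of the identity presents X as a sum of copies of 𝟙. An additive functor
preserves it. -/
theorem sum_formHom_elemHom {ι : Type*} [Fintype ι] (b : Module.Basis ι k X) :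
    ∑ a, formHom X (b.coord a) ≫ elemHom X (b a) = 𝟙 X := by
  refine FGModuleCat.hom_ext (LinearMap.ext fun x => ?_)
  have h := map_sum (AddMonoidHom.mk' (fun f : X ⟶ X => f.hom.hom x) (fun _ _ => rfl))
    (fun a => formHom X (b.coord a) ≫ elemHom X (b a)) Finset.univ
  exact h.trans (b.sum_repr x)

end Elements

/-! ### Generators and coordinates of τ_i(X) for an arbitrary structure -/

namespace EStructure

variable (S : EStructure k M) (i : M.I)

theorem tmap_comp {X Y Z : FGModuleCat.{u} k} (f : X ⟶ Y) (g : Y ⟶ Z) (w : (S.τ.obj X).X i) :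
    tmap S.τ i (f ≫ g) w = tmap S.τ i g (tmap S.τ i f w) :=
  congrArg (fun h : S.τ.obj X ⟶ S.τ.obj Z => Plng.Hom.app h i w) (S.τ.map_comp f g)

theorem tmap_id (X : FGModuleCat.{u} k) (w : (S.τ.obj X).X i) : tmap S.τ i (𝟙 X) w = w :=
  congrArg (fun f : S.τ.obj X ⟶ S.τ.obj X => Plng.Hom.app f i w) (S.τ.map_id X)

theorem tmap_sum {X Y : FGModuleCat.{u} k} {ι : Type*} (s : Finset ι) (f : ι → (X ⟶ Y)) :
    tmap S.τ i (∑ a ∈ s, f a) = ∑ a ∈ s, tmap S.τ i (f a) :=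
  map_sum (AddMonoidHom.mk' (fun f : X ⟶ Y => tmap S.τ i f) (S.map_add i)) f s

/-- The element of `τ_i(X)` that corresponds to `ξ ⊗ x`. -/
def elem (X : FGModuleCat.{u} k) (x : X) : Module.Dual k (EAlg k M i) →ₗ[k] (S.τ.obj X).X i :=
  (tmap S.τ i (elemHom X x)).comp (S.tensor.unitIso i).symm.toLinearMap

/-- The coordinate `τ_i(X) → E_i^∨` with respect to a linear form on `X`. -/
def coord (X : FGModuleCat.{u} k) (f : Module.Dual k X) :
    (S.τ.obj X).X i →ₗ[k] Module.Dual k (EAlg k M i) :=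
  (S.tensor.unitIso i).toLinearMap.comp (tmap S.τ i (formHom X f))

variable {i} {X Y : FGModuleCat.{u} k}

theorem elem_apply (x : X) (ξ : Module.Dual k (EAlg k M i)) :
    S.elem i X x ξ = tmap S.τ i (elemHom X x) ((S.tensor.unitIso i).symm ξ) := rfl

theorem unitIso_ρ_symm (a : EAlg k M i) (ξ : Module.Dual k (EAlg k M i)) :
    (S.τ.obj (𝟙_ (FGModuleCat.{u} k))).ρ i a ((S.tensor.unitIso i).symm ξ) =
      (S.tensor.unitIso i).symm (ξ.comp (LinearMap.mulLeft k a)) := by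
  rw [LinearEquiv.eq_symm_apply]
  refine LinearMap.ext fun y => ?_
  refine (S.tensor.unit_linear i a _ y).trans ?_
  rw [LinearEquiv.apply_symm_apply]
  rfl

theorem tmap_elem (f : X ⟶ Y) (x : X) (ξ : Module.Dual k (EAlg k M i)) :
    tmap S.τ i f (S.elem i X x ξ) = S.elem i Y (f.hom.hom x) ξ := by
  rw [elem_apply, ← tmap_comp, elemHom_comp, elem_apply]

theorem elem_add (x y : X) (ξ : Module.Dual k (EAlg k M i)) :
    S.elem i X (x + y) ξ = S.elem i X x ξ + S.elem i X y ξ := by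
  rw [elem_apply, elemHom_add, S.map_add]
  rfl

/-- The scalar acts as an endomorphism of 𝟙, hence on τ_i(𝟙) = E_i^∨ through `tauOne`. This is the
balancing relation of E_i^∨ ⊗_μ X. -/
theorem elem_smul (c : k) (x : X) (ξ : Module.Dual k (EAlg k M i)) :
    S.elem i X (c • x) ξ = S.elem i X x (ξ.comp (LinearMap.mulLeft k (S.tauOne i c))) := by
  rw [elem_apply, elemHom_smul, tmap_comp, tmap_smul_id, unitIso_ρ_symm, elem_apply]

theorem elem_zero (ξ : Module.Dual k (EAlg k M i)) : S.elem i X 0 ξ = 0 := by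
  have := S.elem_add (0 : X) 0 ξ
  rwa [add_zero, left_eq_add] at this

theorem ρ_elem (a : EAlg k M i) (x : X) (ξ : Module.Dual k (EAlg k M i)) :
    (S.τ.obj X).ρ i a (S.elem i X x ξ) = S.elem i X x (ξ.comp (LinearMap.mulLeft k a)) := by
  rw [elem_apply, elem_apply, ← unitIso_ρ_symm]
  exact ((S.τ.map (elemHom X x)).linear i a _).symm

theorem unitIso_symm_t {j : M.I} (u : i ⟶ j) (ξ : Module.Dual k (EAlg k M j)) :
    (S.τ.obj (𝟙_ (FGModuleCat.{u} k))).t u ((S.tensor.unitIso j).symm ξ) =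
      (S.tensor.unitIso i).symm (ξ.comp ((M.baseChange k).tr u).toLinearMap) := by
  rw [LinearEquiv.eq_symm_apply]
  refine LinearMap.ext fun y => ?_
  refine (S.tensor.unit_trans u _ y).trans ?_
  rw [LinearEquiv.apply_symm_apply]
  rfl

theorem t_elem {j : M.I} (u : i ⟶ j) (x : X) (ξ : Module.Dual k (EAlg k M j)) :
    (S.τ.obj X).t u (S.elem j X x ξ) =
      S.elem i X x (ξ.comp ((M.baseChange k).tr u).toLinearMap) := by
  rw [elem_apply, elem_apply, ← unitIso_symm_t]
  exact ((S.τ.map (elemHom X x)).comm u _).symm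

theorem unitIso_elem_one (ξ : Module.Dual k (EAlg k M i)) :
    S.tensor.unitIso i (S.elem i (𝟙_ (FGModuleCat.{u} k)) (1 : k) ξ) = ξ := by
  rw [elem_apply, elemHom_one, tmap_id, LinearEquiv.apply_symm_apply]

theorem elem_unit (c : k) (ξ : Module.Dual k (EAlg k M i)) :
    S.elem i (𝟙_ (FGModuleCat.{u} k)) c ξ = S.elem i (𝟙_ (FGModuleCat.{u} k)) (1 : k)
      (ξ.comp (LinearMap.mulLeft k (S.tauOne i c))) := by
  have h := S.elem_smul (X := 𝟙_ (FGModuleCat.{u} k)) c (1 : k) ξ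
  exact (congrArg (fun z : k => S.elem i (𝟙_ (FGModuleCat.{u} k)) z ξ) (mul_one c).symm).trans h

theorem ε_apply (w : (S.τ.obj (𝟙_ (FGModuleCat.{u} k))).X i) :
    S.tensor.ε i w = S.tensor.unitIso i w 1 := rfl

theorem ε_elem (c : k) (ξ : Module.Dual k (EAlg k M i)) :
    S.tensor.ε i (S.elem i (𝟙_ (FGModuleCat.{u} k)) c ξ) = ξ (S.tauOne i c) := by
  rw [elem_unit, ε_apply, unitIso_elem_one]
  simp

theorem coord_elem (f : Module.Dual k X) (x : X) (ξ : Module.Dual k (EAlg k M i)) :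
    S.coord i X f (S.elem i X x ξ) = ξ.comp (LinearMap.mulLeft k (S.tauOne i (f x))) := by
  rw [coord, LinearMap.comp_apply, elem_apply, ← tmap_comp, elemHom_formHom, tmap_smul_id,
    unitIso_ρ_symm]
  exact (S.tensor.unitIso i).apply_symm_apply _

theorem sum_elem_coord {ι : Type*} [Fintype ι] (b : Module.Basis ι k X) (w : (S.τ.obj X).X i) :
    ∑ a, S.elem i X (b a) (S.coord i X (b.coord a) w) = w := by
  conv_rhs => rw [← S.tmap_id i X w, ← sum_formHom_elemHom b, tmap_sum, LinearMap.sum_apply]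
  refine Finset.sum_congr rfl fun a _ => ?_
  rw [elem_apply, coord, LinearMap.comp_apply, tmap_comp]
  congr 1
  exact (S.tensor.unitIso i).symm_apply_apply _

theorem elem_induction {p : (S.τ.obj X).X i → Prop} (w : (S.τ.obj X).X i)
    (h0 : p 0) (h : ∀ x ξ, p (S.elem i X x ξ)) (hadd : ∀ v w, p v → p w → p (v + w)) : p w := by
  rw [← S.sum_elem_coord (Module.finBasis k X) w]
  exact Finset.sum_induction _ p hadd h0 fun a _ => h _ _

theorem elem_induction₂ {p : (S.τ.obj (X ⊗ Y)).X i → Prop} (w : (S.τ.obj (X ⊗ Y)).X i)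
    (h0 : p 0) (h : ∀ (x : X) (y : Y) ξ, p (S.elem i (X ⊗ Y) (x ⊗ₜ[k] y) ξ))
    (hadd : ∀ v w, p v → p w → p (v + w)) : p w := by
  induction w using S.elem_induction with
  | h0 => exact h0
  | h t ξ =>
    change X ⊗[k] Y at t
    induction t with
    | zero =>
      refine (S.elem_zero ξ).symm ▸ h0
    | tmul x y => exact h x y ξ
    | add t t' ht ht' => exact (S.elem_add (X := X ⊗ Y) t t' ξ).symm ▸ hadd _ _ ht ht'
  | hadd v w hv hw => exact hadd v w hv hw

/-! ### The ring map `tauOne` -/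

theorem apply_tauOne (c : k) (ξ : Module.Dual k (EAlg k M i)) :
    ξ (S.tauOne i c) =
      S.tensor.ε i (tmap S.τ i (c • 𝟙 (𝟙_ (FGModuleCat.{u} k))) ((S.tensor.unitIso i).symm ξ)) :=
  Module.apply_evalEquiv_symm_apply k (EAlg k M i) ξ _

theorem eq_of_forall_dual {a b : EAlg k M i} (h : ∀ ξ : Module.Dual k (EAlg k M i), ξ a = ξ b) :
    a = b :=
  sub_eq_zero.1 ((Module.forall_dual_apply_eq_zero_iff k _).1 fun ξ => by
    rw [map_sub, h, sub_self])

variable (i) in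
/-- The map `τ_𝟙 : k → E_i` as a map of algebras. -/
def tauOneHom : k →ₐ[k₀] EAlg k M i where
  toFun := S.tauOne i
  map_one' := eq_of_forall_dual fun ξ => by
    rw [apply_tauOne, one_smul, tmap_id, ε_apply, LinearEquiv.apply_symm_apply]
  map_mul' c d := eq_of_forall_dual fun ξ => by
    have h : (c * d) • 𝟙 (𝟙_ (FGModuleCat.{u} k)) =
        (d • 𝟙 (𝟙_ (FGModuleCat.{u} k))) ≫ (c • 𝟙 (𝟙_ (FGModuleCat.{u} k))) := by
      simp [smul_smul]
    rw [apply_tauOne, h, tmap_comp, tmap_smul_id S i d, unitIso_ρ_symm, ← apply_tauOne, mul_comm]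
    rfl
  map_zero' := eq_of_forall_dual fun ξ => by
    have := S.map_add i (0 : 𝟙_ (FGModuleCat.{u} k) ⟶ 𝟙_ (FGModuleCat.{u} k)) 0
    rw [add_zero, left_eq_add] at this
    rw [apply_tauOne, zero_smul, this]
    simp
  map_add' c d := eq_of_forall_dual fun ξ => by
    rw [apply_tauOne, add_smul, S.map_add, LinearMap.add_apply, _root_.map_add,
      ← apply_tauOne, ← apply_tauOne, _root_.map_add]
  commutes' c := eq_of_forall_dual fun ξ => by
    rw [apply_tauOne, S.map_smul, LinearMap.smul_apply, _root_.map_smul, tmap_id, ε_apply,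
      LinearEquiv.apply_symm_apply, IsScalarTower.algebraMap_apply k₀ k (EAlg k M i),
      Algebra.algebraMap_eq_smul_one (algebraMap k₀ k c), _root_.map_smul]

theorem tauOneHom_apply (c : k) : S.tauOneHom i c = S.tauOne i c := rfl

theorem tauOne_trans {j : M.I} (u : i ⟶ j) (c : k) :
    S.tauOne j c = (M.baseChange k).tr u (S.tauOne i c) := by
  refine eq_of_forall_dual fun ξ => ?_
  have h := S.apply_tauOne c (ξ.comp ((M.baseChange k).tr u).toLinearMap)
  rw [← unitIso_symm_t] at h
  rw [apply_tauOne]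
  refine Eq.trans ?_ h.symm
  have h' := (S.τ.map (c • 𝟙 (𝟙_ (FGModuleCat.{u} k)))).comm u ((S.tensor.unitIso j).symm ξ)
  refine Eq.trans ?_ (congrArg (S.tensor.ε i) h').symm
  refine Eq.trans ?_ (S.tensor.unit_trans u _ 1).symm
  rw [map_one]
  rfl

end EStructure

variable {k₀ k : Type u} [CommRing k₀] [Field k] [Algebra k₀ k] {M : FormalMonoid k₀}

theorem elemHom_tmul {X Y : FGModuleCat.{u} k} (x : X) (y : Y) :
    elemHom (X ⊗ Y) (x ⊗ₜ[k] y) =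
      (λ_ (𝟙_ (FGModuleCat.{u} k))).inv ≫ (elemHom X x ⊗ₘ elemHom Y y) := by
  refine FGModuleCat.hom_ext (LinearMap.ext fun (c : k) => ?_)
  change c • (x ⊗ₜ[k] y) = ((1 : k) • x) ⊗ₜ[k] (c • y)
  rw [one_smul, TensorProduct.tmul_smul]

/-! ### Tensor structure, a and b on generators -/

namespace EStructure

variable (S : EStructure k M) {i : M.I} {X Y : FGModuleCat.{u} k}

/-- The tensor structure at 𝟙 is forced. Its value lies where the two actions of E agree, so it is
the comultiplication of its contraction by ε, and the unit constraint says that this contraction is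
ξ. -/
theorem δ_leftUnitor_inv (ξ : Module.Dual k (EAlg k M i)) :
    S.tensor.δ i _ _ (tmap S.τ i (λ_ (𝟙_ (FGModuleCat.{u} k))).inv
      ((S.tensor.unitIso i).symm ξ)) =
      TensorProduct.map (S.tensor.unitIso i).symm.toLinearMap
        (S.tensor.unitIso i).symm.toLinearMap (dualComul ξ) := by
  let U : (S.τ.obj (𝟙_ (FGModuleCat.{u} k))).X i ≃ₗ[k] Module.Dual k (EAlg k M i) :=
    S.tensor.unitIso i
  have hU : ∀ a, (LinearMap.mulLeft k a).dualMap.comp U.toLinearMap =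
      U.toLinearMap.comp ((S.τ.obj (𝟙_ (FGModuleCat.{u} k))).ρ i a) := fun a =>
    LinearMap.ext fun w => LinearMap.ext fun y => (S.tensor.unit_linear i a w y).symm
  let v := tmap S.τ i (λ_ (𝟙_ (FGModuleCat.{u} k))).inv (U.symm ξ)
  have hmem := (Submodule.mem_iInf _).1 (S.tensor.mulIso i _ _ v).2
  have h := exists_dualComul_eq (TensorProduct.map U.toLinearMap U.toLinearMap
    (S.tensor.δ i _ _ v)) (fun a => by
      rw [TensorProduct.map_map, TensorProduct.map_map, hU, LinearMap.id_comp,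
        ← LinearMap.comp_id U.toLinearMap, LinearMap.comp_assoc, LinearMap.id_comp,
        TensorProduct.map_comp, TensorProduct.map_comp]
      exact congrArg (TensorProduct.map U.toLinearMap U.toLinearMap)
        (LinearMap.mem_eqLocus.1 (hmem a)))
  have h₁ : TensorProduct.lid k _ (TensorProduct.map (LinearMap.applyₗ (1 : EAlg k M i))
      LinearMap.id (TensorProduct.map U.toLinearMap U.toLinearMap (S.tensor.δ i _ _ v))) = ξ := by
    have h₂ : ∀ z : (S.τ.obj (𝟙_ (FGModuleCat.{u} k))).X i ⊗[k]
        (S.τ.obj (𝟙_ (FGModuleCat.{u} k))).X i,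
        TensorProduct.lid k _ (TensorProduct.map (LinearMap.applyₗ (1 : EAlg k M i))
          LinearMap.id (TensorProduct.map U.toLinearMap U.toLinearMap z)) =
        U (TensorProduct.lid k _ (TensorProduct.map (S.tensor.ε i) LinearMap.id z)) := by
      intro z
      induction z with
      | zero => simp
      | tmul v w =>
        simp only [TensorProduct.map_tmul, TensorProduct.lid_tmul, LinearMap.id_apply,
          _root_.map_smul]
        rfl
      | add z z' h h' => simp only [_root_.map_add, h, h']
    rw [h₂]
    refine (congrArg U (S.tensor.unit i _ v)).trans ?_
    rw [← tmap_comp, Iso.inv_hom_id, tmap_id, LinearEquiv.apply_symm_apply]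
  rw [h₁] at h
  rw [h, TensorProduct.map_map]
  change S.tensor.δ i _ _ v = TensorProduct.map (U.symm.toLinearMap.comp U.toLinearMap)
    (U.symm.toLinearMap.comp U.toLinearMap) (S.tensor.δ i _ _ v)
  simp only [LinearEquiv.symm_comp, TensorProduct.map_id]
  rfl

theorem δ_elem (x : X) (y : Y) (ξ : Module.Dual k (EAlg k M i)) :
    S.tensor.δ i X Y (S.elem i (X ⊗ Y) (x ⊗ₜ[k] y) ξ) =
      TensorProduct.map (S.elem i X x) (S.elem i Y y) (dualComul ξ) := by
  rw [elem_apply, elemHom_tmul, tmap_comp]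
  refine (S.tensor.natural i (elemHom X x) (elemHom Y y) _).trans ?_
  refine (congrArg _ (S.δ_leftUnitor_inv ξ)).trans ?_
  rw [TensorProduct.map_map]
  rfl

/-! ### The isomorphisms `a` and `b` -/

variable {l : M.I}

/-- An element of τ_l(𝟙) is a form on E_l and ε is its value at 1; letting E_l act first yields all
other values. -/
theorem unit_ext {v w : (S.τ.obj (𝟙_ (FGModuleCat.{u} k))).X l}
    (h : ∀ a, S.tensor.ε l ((S.τ.obj (𝟙_ (FGModuleCat.{u} k))).ρ l a v) =
      S.tensor.ε l ((S.τ.obj (𝟙_ (FGModuleCat.{u} k))).ρ l a w)) : v = w := by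
  refine (S.tensor.unitIso l).injective (LinearMap.ext fun a => ?_)
  have := h a
  rw [ε_apply, ε_apply, S.tensor.unit_linear l a v 1, S.tensor.unit_linear l a w 1] at this
  rwa [mul_one] at this

theorem ε_ρ_elem_one (a : EAlg k M l) (ξ : Module.Dual k (EAlg k M l)) :
    S.tensor.ε l ((S.τ.obj (𝟙_ (FGModuleCat.{u} k))).ρ l a
      (S.elem l (𝟙_ (FGModuleCat.{u} k)) (1 : k) ξ)) = ξ a := by
  rw [ρ_elem, ε_apply, unitIso_elem_one]
  simp

/-- At 𝟙, an element h of φ^! τ(𝟙) satisfies a · h(1) = φ(a) h(1), so h(1) is a multiple of φ as a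
form, and `iso_unit` fixes the multiple to be 1. Naturality along 𝟙 → X gives the general case. -/
theorem shriekEval_a_symm (φ : M.A l →ₐ[k₀] k) (hφ : M.point l φ = 1) (x : X) :
    shriekEval _ _ ((S.a.iso l φ hφ X).symm x) = S.elem l X x (liftScalar φ).toLinearMap := by
  have h₁ : shriekEval _ _ ((S.a.iso l φ hφ (𝟙_ (FGModuleCat.{u} k))).symm (1 : k)) =
      S.elem l (𝟙_ (FGModuleCat.{u} k)) (1 : k) (liftScalar φ).toLinearMap := by
    refine S.unit_ext fun a => ?_
    rw [ε_ρ_elem_one]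
    generalize hh : (S.a.iso l φ hφ (𝟙_ (FGModuleCat.{u} k))).symm (1 : k) = h
    have h₂ : (S.τ.obj (𝟙_ (FGModuleCat.{u} k))).ρ l a (h.1 1) = liftScalar φ a • h.1 1 := by
      rw [← h.2, ← smul_eq_mul, _root_.map_smul]
    change S.tensor.ε l ((S.τ.obj (𝟙_ (FGModuleCat.{u} k))).ρ l a (h.1 1)) = _
    rw [h₂, _root_.map_smul]
    have h₃ := S.a.iso_unit l φ hφ 1
    rw [hh] at h₃
    change S.tensor.ε l (h.1 1) = 1 at h₃
    rw [h₃]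
    exact mul_one _
  have h₂ := S.a.natural l φ hφ (elemHom X x)
    ((S.a.iso l φ hφ (𝟙_ (FGModuleCat.{u} k))).symm (1 : k))
  rw [LinearEquiv.apply_symm_apply] at h₂
  have h₃ : (elemHom X x).hom.hom (1 : k) = x := one_smul k x
  rw [h₃] at h₂
  conv_lhs => rw [← h₂, LinearEquiv.symm_apply_apply]
  refine (congrArg (tmap S.τ l (elemHom X x)) h₁).trans ?_
  rw [tmap_elem, h₃]

theorem shriek_ext {F : Type u} [CommRing F] [Algebra k F] {E : Type u} [CommRing E] [Algebra k E]
    {X : Type u} [AddCommGroup X] [Module k X] {f : E →ₐ[k] F} {ρ : E →ₐ[k] Module.End k X}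
    {g h : shriek f ρ} (H : ∀ y, g.1 y = h.1 y) : g = h :=
  Subtype.ext (LinearMap.ext H)

/-- For y = (1 ⊗ e) ⊗ f, bilinearity of b moves e to the inner form and f to the outer one, and
`iso_unit` evaluates the result. The inner evaluation is the scalar ξ(1 ⊗ e), which reaches E_j
through `tauOne`; this is the contraction. -/
theorem ε_b_elem_one {j : M.I} (φ : M.A l →ₐ[k₀] EEAlg k M i j)
    (hφ : M.point l φ = mulPoint k M i j) (ξ : Module.Dual k (EAlg k M i))
    (ζ : Module.Dual k (EAlg k M j)) (y : EEAlg k M i j) :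
    S.tensor.ε l ((S.b.iso i j l φ hφ (𝟙_ (FGModuleCat.{u} k)) (S.elem j _
      (S.elem i (𝟙_ (FGModuleCat.{u} k)) (1 : k) ξ) ζ)).1 y) =
      ζ (contract (S.tauOneHom j) ξ y) := by
  refine LinearMap.congr_fun (f := (S.tensor.ε l).comp (S.b.iso i j l φ hφ
    (𝟙_ (FGModuleCat.{u} k)) (S.elem j _ (S.elem i (𝟙_ (FGModuleCat.{u} k)) (1 : k) ξ) ζ)).1)
    (g := ζ.comp (contract (S.tauOneHom j) ξ)) (linearMap_ext_of_tmul fun e f => ?_) y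
  have hy : ((1 ⊗ₜ e) ⊗ₜ f : EEAlg k M i j) = ((1 ⊗ₜ e) ⊗ₜ 1) * ((1 ⊗ₜ f) * 1) := by simp
  rw [LinearMap.comp_apply, hy, ← S.b.linear_left, ← S.b.linear_right]
  refine (S.b.iso_unit i j l φ hφ _).trans ?_
  have h₁ := S.tmap_elem (i := j) (X := (S.τ.obj (𝟙_ (FGModuleCat.{u} k))).X i)
    ⟨ModuleCat.ofHom ((S.τ.obj (𝟙_ (FGModuleCat.{u} k))).ρ i (1 ⊗ₜ e))⟩
    (S.elem i (𝟙_ (FGModuleCat.{u} k)) (1 : k) ξ) ζ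
  have h₂ := S.tmap_elem (i := j) (X := (S.τ.obj (𝟙_ (FGModuleCat.{u} k))).X i)
    (Y := 𝟙_ (FGModuleCat.{u} k)) ⟨ModuleCat.ofHom (S.tensor.ε i)⟩
    ((S.τ.obj (𝟙_ (FGModuleCat.{u} k))).ρ i (1 ⊗ₜ e) (S.elem i (𝟙_ (FGModuleCat.{u} k)) (1 : k) ξ))
    (ζ.comp (LinearMap.mulLeft k f))
  refine (congrArg (fun w => S.tensor.ε j (tmapₗ S.τ j (Y := 𝟙_ (FGModuleCat.{u} k))
    (S.tensor.ε i) ((S.τ.obj ((S.τ.obj (𝟙_ (FGModuleCat.{u} k))).X i)).ρ j f w))) h₁).trans ?_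
  rw [ρ_elem]
  refine (congrArg (S.tensor.ε j) h₂).trans ?_
  refine (S.ε_elem _ _).trans ?_
  have h₃ := S.ε_ρ_elem_one (1 ⊗ₜ e : EAlg k M i) ξ
  refine (congrArg (fun c => ζ (f * S.tauOne j c)) h₃).trans ?_
  rw [← hy, LinearMap.comp_apply, contract_tmul, one_smul, mul_comm]
  rfl

/-- At 𝟙 the element is recovered from ε by letting E_l act, with values supplied by `ε_b_elem_one`;
naturality along 𝟙 → X does the rest. So b depends on nothing but `tauOne`. -/
theorem b_elem {j : M.I} (φ : M.A l →ₐ[k₀] EEAlg k M i j)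
    (hφ : M.point l φ = mulPoint k M i j) (x : X) (ξ : Module.Dual k (EAlg k M i))
    (ζ : Module.Dual k (EAlg k M j)) (y : EEAlg k M i j) :
    (S.b.iso i j l φ hφ X (S.elem j _ (S.elem i X x ξ) ζ)).1 y =
      S.elem l X x (Induced.translate (liftScalar φ)
        (ζ.comp (contract (S.tauOneHom j) ξ)) y) := by
  have h₁ : ∀ y, (S.b.iso i j l φ hφ (𝟙_ (FGModuleCat.{u} k)) (S.elem j _
      (S.elem i (𝟙_ (FGModuleCat.{u} k)) (1 : k) ξ) ζ)).1 y =
      S.elem l (𝟙_ (FGModuleCat.{u} k)) (1 : k) (Induced.translate (liftScalar φ)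
        (ζ.comp (contract (S.tauOneHom j) ξ)) y) := fun y => by
    refine S.unit_ext fun a => ?_
    rw [ε_ρ_elem_one, ← (S.b.iso i j l φ hφ (𝟙_ (FGModuleCat.{u} k)) _).2, ε_b_elem_one]
    rfl
  have h₃ : (elemHom X x).hom.hom (1 : k) = x := one_smul k x
  have h₂ := S.tmap_elem (elemHom X x) (1 : k) ξ
  rw [h₃] at h₂
  have h₄ := S.tmap_elem (i := j) (X := (S.τ.obj (𝟙_ (FGModuleCat.{u} k))).X i)
    (Y := (S.τ.obj X).X i) ⟨ModuleCat.ofHom (tmap S.τ i (elemHom X x))⟩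
    (S.elem i (𝟙_ (FGModuleCat.{u} k)) (1 : k) ξ) ζ
  have h₅ := S.b.natural i j l φ hφ (elemHom X x)
    (S.elem j _ (S.elem i (𝟙_ (FGModuleCat.{u} k)) (1 : k) ξ) ζ)
  rw [← h₂]
  refine (congrArg (fun w => (S.b.iso i j l φ hφ X w).1 y) (h₄.symm.trans rfl)).trans ?_
  refine (congrArg (fun w : shriek _ _ => w.1 y) h₅).trans ?_
  refine (congrArg (tmap S.τ l (elemHom X x)) (h₁ y)).trans ?_
  rw [tmap_elem, h₃]

end EStructure

variable {k₀ k : Type u} [CommRing k₀] [Field k] [Algebra k₀ k] {M : FormalMonoid k₀}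

namespace EStructure

variable (S T : EStructure k M)

/-! ### The action defined by a structure -/

/-- The inverse of a sends c both to c times the form φ, by linearity, and to φ multiplied by
`tauOne c`, by the formula for a. Evaluation at 1 compares the two. -/
theorem liftScalar_tauOne_one (l : M.I) (φ : M.A l →ₐ[k₀] k) (hφ : M.point l φ = 1) (c : k) :
    liftScalar φ (S.tauOne l c) = c := by
  have h₁ := S.shriekEval_a_symm (X := 𝟙_ (FGModuleCat.{u} k)) φ hφ c
  have hc : (c : 𝟙_ (FGModuleCat.{u} k)) = c • (1 : k) := (mul_one c).symm
  have h₂ : (S.a.iso l φ hφ (𝟙_ (FGModuleCat.{u} k))).symm c =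
      c • (S.a.iso l φ hφ (𝟙_ (FGModuleCat.{u} k))).symm (1 : k) :=
    (congrArg _ hc).trans (_root_.map_smul _ c _)
  rw [h₂, _root_.map_smul, S.shriekEval_a_symm φ hφ, elem_unit S c] at h₁
  have h₃ := congrArg (fun w => S.tensor.unitIso l w 1) h₁
  simp only [_root_.map_smul, unitIso_elem_one] at h₃
  simpa using h₃.symm

/-- b is computed on one element of τ_j(τ_i(𝟙)) in two ways: with c as the element of 𝟙, so that c
acts through `tauOne` at l, and with c moved onto ξ, where it acts through i and is shifted into
E_j. Contractions followed by forms separate the results. -/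
theorem liftScalar_tauOne_mul (i j l : M.I) (φ : M.A l →ₐ[k₀] EEAlg k M i j)
    (hφ : M.point l φ = mulPoint k M i j) (c : k) :
    liftScalar φ (S.tauOne l c) =
      Induced.compScalar (S.tauOneHom i) (S.tauOneHom j) c := by
  have h : ∀ (ξ : Module.Dual k (EAlg k M i)) (ζ : Module.Dual k (EAlg k M j)),
      ζ (contract (S.tauOneHom j) ξ (liftScalar φ (S.tauOne l c))) =
        ζ (contract (S.tauOneHom j) ξ (Induced.compScalar (S.tauOneHom i) (S.tauOneHom j) c)) := by
    intro ξ ζ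
    have h₁ := S.b_elem (X := 𝟙_ (FGModuleCat.{u} k)) φ hφ c ξ ζ 1
    have h₂ := congrArg (fun w => (S.b.iso i j l φ hφ (𝟙_ (FGModuleCat.{u} k))
      (S.elem j ((S.τ.obj (𝟙_ (FGModuleCat.{u} k))).X i) w ζ)).1 1) (S.elem_unit c ξ)
    have h₃ := (h₁.symm.trans h₂).trans (S.b_elem (X := 𝟙_ (FGModuleCat.{u} k)) φ hφ (1 : k)
      (ξ.comp (LinearMap.mulLeft k (S.tauOne i c))) ζ 1)
    rw [elem_unit S c] at h₃
    have h₄ := congrArg (fun w => S.tensor.unitIso l w 1) h₃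
    simp only [unitIso_elem_one] at h₄
    rw [contract_comp_mulLeft] at h₄
    change ζ _ = ζ (contract (S.tauOneHom j) ξ (scalarShift (S.tauOneHom j) (S.tauOne i c)))
    simpa using h₄
  refine sub_eq_zero.1 ((Module.forall_dual_apply_eq_zero_iff k _).1 fun η => ?_)
  obtain ⟨ι, _, ξ, ζ, rfl⟩ := exists_sum_comp_contract (S.tauOneHom j) η
  rw [LinearMap.sum_apply]
  refine Finset.sum_eq_zero fun r _ => ?_
  rw [LinearMap.comp_apply, map_sub, map_sub, h, sub_self]

/-- The map `k → B` obtained from `z : k → B` by the action of a `B`-point of `M`. -/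
def actionSMul {B : Type u} [CommRing B] [Algebra k₀ B] (g : M.Points B) (z : k →ₐ[k₀] B) :
    k →ₐ[k₀] B :=
  Quot.lift (fun p : Σ i : M.I, (M.A i →ₐ[k₀] B) =>
    (Algebra.TensorProduct.lift z p.2 fun _ _ => Commute.all _ _).comp (S.tauOneHom p.1))
    (by
      rintro ⟨j, φ⟩ ⟨i, ψ⟩ ⟨u, hu⟩
      refine Eq.trans ?_ (congrArg (fun ψ => (Algebra.TensorProduct.lift z ψ fun _ _ =>
        Commute.all _ _).comp (S.tauOneHom i)) hu.symm)
      refine AlgHom.ext fun c => ?_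
      change Algebra.TensorProduct.lift z φ (fun _ _ => Commute.all _ _) (S.tauOne j c) =
        Algebra.TensorProduct.lift z (φ.comp (M.tr u)) (fun _ _ => Commute.all _ _) (S.tauOne i c)
      rw [S.tauOne_trans u c]
      refine AlgHom.congr_fun (φ₁ := (Algebra.TensorProduct.lift z φ fun _ _ => Commute.all _ _).comp
        ((Algebra.TensorProduct.map (AlgHom.id k k) (M.tr u)).restrictScalars k₀))
        (φ₂ := Algebra.TensorProduct.lift z (φ.comp (M.tr u)) fun _ _ => Commute.all _ _) ?_ _
      refine Algebra.TensorProduct.ext ?_ ?_ <;> ext <;> simp) g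

theorem actionSMul_point {B : Type u} [CommRing B] [Algebra k₀ B] (i : M.I) (φ : M.A i →ₐ[k₀] B)
    (z : k →ₐ[k₀] B) : S.actionSMul (M.point i φ) z =
      (Algebra.TensorProduct.lift z φ fun _ _ => Commute.all _ _).comp (S.tauOneHom i) := rfl

theorem exists_point {B : Type u} [CommRing B] [Algebra k₀ B] (g : M.Points B) :
    ∃ i φ, M.point i φ = g :=
  Quot.inductionOn g fun p => ⟨p.1, p.2, rfl⟩

theorem map_point {B C : Type u} [CommRing B] [Algebra k₀ B] [CommRing C] [Algebra k₀ C]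
    (f : B →ₐ[k₀] C) (i : M.I) (φ : M.A i →ₐ[k₀] B) :
    (M.point i φ).map f = M.point i (f.comp φ) := rfl

theorem comp_lift {B C : Type u} [CommRing B] [Algebra k₀ B] [CommRing C] [Algebra k₀ C]
    (f : B →ₐ[k₀] C) {A : Type u} [CommRing A] [Algebra k₀ A] (z : k →ₐ[k₀] B) (φ : A →ₐ[k₀] B) :
    f.comp (Algebra.TensorProduct.lift z φ fun _ _ => Commute.all _ _) =
      Algebra.TensorProduct.lift (f.comp z) (f.comp φ) fun _ _ => Commute.all _ _ := by
  refine Algebra.TensorProduct.ext ?_ ?_ <;> ext <;> simp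

theorem lift_eq_liftScalar {B A : Type u} [CommRing B] [Algebra k₀ B] [Algebra k B]
    [IsScalarTower k₀ k B] [CommRing A] [Algebra k₀ A] (φ : A →ₐ[k₀] B) :
    Algebra.TensorProduct.lift ((Algebra.ofId k B).restrictScalars k₀) φ
      (fun _ _ => Commute.all _ _) = (liftScalar (k := k) φ).restrictScalars k₀ := by
  refine Algebra.TensorProduct.ext ?_ ?_ <;> ext <;> simp [liftScalar]

theorem actionSMul_mul_aux {B : Type u} [CommRing B] [Algebra k₀ B] [Algebra k B]
    [IsScalarTower k₀ k B] (g h : M.Points B) :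
    S.actionSMul (g * h) ((Algebra.ofId k B).restrictScalars k₀) =
      S.actionSMul g (S.actionSMul h ((Algebra.ofId k B).restrictScalars k₀)) := by
  obtain ⟨i, φ, rfl⟩ := exists_point g
  obtain ⟨j, ψ, rfl⟩ := exists_point h
  -- The product of points is known only as a natural operation. It is represented in the universal
  -- case E_i ⊗ E_j, and then transported to B along the map G that φ and ψ define.
  obtain ⟨l, χ, hχ⟩ := exists_point (mulPoint k M i j)
  let G : EEAlg k M i j →ₐ[k] B :=
    Algebra.TensorProduct.lift (liftScalar φ) (liftScalar ψ) fun _ _ => Commute.all _ _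
  have hG : M.point i φ * M.point j ψ = M.point l ((G.restrictScalars k₀).comp χ) := by
    rw [← map_point, hχ, mulPoint, M.map_mul, map_point, map_point]
    congr 2
    · ext a
      simp [G, inl, liftScalar]
    · ext a
      simp [G, inr, liftScalar]
  rw [hG, actionSMul_point, actionSMul_point, actionSMul_point, lift_eq_liftScalar,
    lift_eq_liftScalar, liftScalar_restrictScalars_comp]
  ext c
  simp only [AlgHom.comp_apply, AlgHom.restrictScalars_apply, tauOneHom_apply]
  rw [S.liftScalar_tauOne_mul i j l χ hχ]
  refine AlgHom.congr_fun (φ₁ := (G.restrictScalars k₀).comp (scalarShift (S.tauOneHom j)))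
    (φ₂ := Algebra.TensorProduct.lift _ φ fun _ _ => Commute.all _ _) ?_ (S.tauOne i c)
  refine Algebra.TensorProduct.ext ?_ ?_ <;> ext <;> simp [G, liftScalar]

/-- The action of `M` on `Spec k` defined by a structure. -/
def toAction : Action M k where
  smul B _ _ g z := S.actionSMul g z
  natural f g z := by
    obtain ⟨i, φ, rfl⟩ := exists_point g
    rw [actionSMul_point, map_point, actionSMul_point, ← AlgHom.comp_assoc, comp_lift]
  one_smul B _ _ z := by
    -- The unit point over B is the image under z of the unit point over k, where the unit law for
    -- `tauOne` applies.
    obtain ⟨l, φ, hφ⟩ := exists_point (M := M) (1 : M.Points k)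
    rw [← M.map_one z, ← hφ, map_point, actionSMul_point]
    ext c
    have h := AlgHom.congr_fun (comp_lift z (AlgHom.id k₀ k) φ) (S.tauOne l c)
    refine Eq.trans h.symm (congrArg z ?_)
    refine Eq.trans ?_ (S.liftScalar_tauOne_one l φ hφ c)
    exact AlgHom.congr_fun (lift_eq_liftScalar φ) _
  mul_smul B _ _ g h z := by
    -- Regarding B as a k-algebra through z reduces to the case in which z is the structure map.
    let : Algebra k B := z.toRingHom.toAlgebra
    have : IsScalarTower k₀ k B := IsScalarTower.of_algebraMap_eq fun c => (z.commutes c).symm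
    exact S.actionSMul_mul_aux g h

theorem coaction_toAction (i : M.I) (c : k) : S.toAction.coaction i c = S.tauOne i c := by
  refine AlgHom.congr_fun (φ₁ := Algebra.TensorProduct.lift Algebra.TensorProduct.includeLeft
    Algebra.TensorProduct.includeRight fun _ _ => Commute.all _ _)
    (φ₂ := AlgHom.id k₀ (k ⊗[k₀] M.A i)) ?_ (S.tauOne i c)
  refine Algebra.TensorProduct.ext ?_ ?_ <;> ext <;> simp

/-! ### The functor underlying a structure -/

variable {S T} {i : M.I} {X Y : FGModuleCat.{u} k}

theorem elem_sum {ι : Type*} (s : Finset ι) (x : ι → X) (ξ : Module.Dual k (EAlg k M i)) :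
    S.elem i X (∑ a ∈ s, x a) ξ = ∑ a ∈ s, S.elem i X (x a) ξ :=
  map_sum (AddMonoidHom.mk' (fun x => S.elem i X x ξ) fun x y => S.elem_add x y ξ) x s

theorem isInducedBy (μ : Action M k) (h : ∀ i c, μ.coaction i c = S.tauOne i c) :
    IsInducedBy S μ := by
  let Θ : ∀ (i : M.I) (X : FGModuleCat.{u} k), (TwistedDual μ i ⊗[k] X) →+ (S.τ.obj X).X i :=
    fun i X => TensorProduct.liftAddHom (M := TwistedDual μ i)
      (AddMonoidHom.mk' (fun ξ : Module.Dual k (EAlg k M i) =>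
        AddMonoidHom.mk' (fun x => S.elem i X x ξ) (fun x y => S.elem_add x y ξ))
        (fun ξ η => AddMonoidHom.ext fun x => _root_.map_add (S.elem i X x) ξ η))
      (fun c ξ x => by
        refine Eq.trans ?_ (S.elem_smul c x ξ).symm
        rw [← h]
        rfl)
  have hΘ : ∀ (i : M.I) (X : FGModuleCat.{u} k) (ξ : Module.Dual k (EAlg k M i)) (x : X),
      Θ i X (TwistedDual.of μ i ξ ⊗ₜ x) = S.elem i X x ξ := fun _ _ _ _ => rfl
  -- The inverse expands an element of τ_i(X) in coordinates with respect to a basis of X;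
  -- `coord_elem` and `sum_elem_coord` are the two inverse laws.
  let Ψ : ∀ (i : M.I) (X : FGModuleCat.{u} k), (S.τ.obj X).X i →+ (TwistedDual μ i ⊗[k] X) :=
    fun i X => AddMonoidHom.mk' (fun w => ∑ a, TwistedDual.of μ i
      (S.coord i X ((Module.finBasis k X).coord a) w) ⊗ₜ[k] Module.finBasis k X a)
      (fun v w => by
        rw [← Finset.sum_add_distrib]
        refine Finset.sum_congr rfl fun a _ => ?_
        rw [_root_.map_add, ← TensorProduct.add_tmul]
        rfl)
  have hΨΘ : ∀ (i : M.I) (X : FGModuleCat.{u} k) w, Ψ i X (Θ i X w) = w := by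
    intro i X w
    induction w with
    | zero => rw [map_zero, map_zero]
    | add v w hv hw => rw [_root_.map_add, _root_.map_add, hv, hw]
    | tmul ξ x =>
      refine (congrArg (Ψ i X) (hΘ i X ξ x)).trans ?_
      refine Eq.trans ?_ (congrArg (fun x : X => ξ ⊗ₜ[k] x) ((Module.finBasis k X).sum_repr x))
      refine Eq.trans ?_ (TensorProduct.tmul_sum ..).symm
      change ∑ a, TwistedDual.of μ i (S.coord i X ((Module.finBasis k X).coord a)
        (S.elem i X x ξ)) ⊗ₜ[k] Module.finBasis k X a = _
      refine Finset.sum_congr rfl fun a _ => ?_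
      refine Eq.trans ?_ (TensorProduct.smul_tmul ((Module.finBasis k X).repr x a) ξ
        (Module.finBasis k X a))
      refine congrArg (fun η : TwistedDual μ i => η ⊗ₜ[k] Module.finBasis k X a) ?_
      refine (S.coord_elem (X := X) ((Module.finBasis k X).coord a) x
        (show Module.Dual k (EAlg k M i) from ξ)).trans ?_
      rw [← h]
      rfl
  have hΘΨ : ∀ (i : M.I) (X : FGModuleCat.{u} k) w, Θ i X (Ψ i X w) = w := by
    intro i X w
    refine (map_sum (Θ i X) (fun a => TwistedDual.of μ i
      (S.coord i X ((Module.finBasis k X).coord a) w) ⊗ₜ[k] Module.finBasis k X a)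
      Finset.univ).trans ?_
    exact S.sum_elem_coord (Module.finBasis k X) w
  refine ⟨fun i X => { Θ i X with
    invFun := Ψ i X
    left_inv := hΨΘ i X
    right_inv := hΘΨ i X }, ?_, ?_, ?_, ?_⟩
  · intro i X e ξ x
    exact (S.ρ_elem e x ξ).symm
  · intro i X Y f ξ x
    exact (S.tmap_elem f x ξ).symm
  · intro i j v X ξ x
    exact (S.t_elem v x ξ).symm
  · intro i ξ
    exact S.unitIso_elem_one ξ

/-! ### Structures with the same action are isomorphic -/

variable (S T) in
/-- The map `τ_i(X) → σ_i(X)` that sends `ξ ⊗ x` to `ξ ⊗ x`. -/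
def transfer (i : M.I) (X : FGModuleCat.{u} k) : (S.τ.obj X).X i →ₗ[k] (T.τ.obj X).X i :=
  ∑ a, (T.elem i X (Module.finBasis k X a)).comp (S.coord i X ((Module.finBasis k X).coord a))

/-- The chosen basis plays no role: basis coefficients of x act through `tauOne` of S when read off
and through that of T when reinserted, and these agree. -/
theorem transfer_elem (h : ∀ i c, S.tauOne i c = T.tauOne i c) (x : X)
    (ξ : Module.Dual k (EAlg k M i)) : transfer S T i X (S.elem i X x ξ) = T.elem i X x ξ := by
  rw [transfer, LinearMap.sum_apply]
  conv_rhs => rw [← (Module.finBasis k X).sum_repr x, elem_sum]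
  refine Finset.sum_congr rfl fun a _ => ?_
  rw [LinearMap.comp_apply, coord_elem, elem_smul, h]
  rfl

/-- The natural transformation between structures with the same action. -/
def transferHom (h : ∀ i c, S.tauOne i c = T.tauOne i c) : S.τ ⟶ T.τ where
  app X :=
    { app := fun i => transfer S T i X
      linear := fun i a w => by
        induction w using S.elem_induction with
        | h0 => simp
        | h x ξ => rw [ρ_elem, transfer_elem h, transfer_elem h, ρ_elem]
        | hadd v w hv hw => simp only [_root_.map_add, hv, hw]
      comm := fun {i j} u w => by
        induction w using S.elem_induction with
        | h0 => simp
        | h x ξ =>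
          refine (congrArg _ (S.t_elem u x ξ)).trans ?_
          rw [transfer_elem h, transfer_elem h]
          exact (T.t_elem u x ξ).symm
        | hadd v w hv hw => simp only [_root_.map_add, hv, hw] }
  naturality X Y f := by
    refine Plng.Hom.ext (funext fun i => LinearMap.ext fun w => ?_)
    change transfer S T i Y (tmap S.τ i f w) = tmap T.τ i f (transfer S T i X w)
    induction w using S.elem_induction with
    | h0 => simp
    | h x ξ => rw [tmap_elem, transfer_elem h, transfer_elem h, tmap_elem]
    | hadd v w hv hw => simp only [_root_.map_add, hv, hw]

theorem transfer_δ (h : ∀ i c, S.tauOne i c = T.tauOne i c) (w : (S.τ.obj (X ⊗ Y)).X i) :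
    T.tensor.δ i X Y (transfer S T i (X ⊗ Y) w) =
      TensorProduct.map (transfer S T i X) (transfer S T i Y) (S.tensor.δ i X Y w) := by
  induction w using S.elem_induction₂ with
  | h0 => simp
  | h x y ξ =>
    rw [transfer_elem h, δ_elem, δ_elem, TensorProduct.map_map]
    congr 2 <;> exact LinearMap.ext fun ξ => (transfer_elem h _ ξ).symm
  | hadd v w hv hw => simp only [_root_.map_add, hv, hw]

theorem transfer_ε (h : ∀ i c, S.tauOne i c = T.tauOne i c)
    (w : (S.τ.obj (𝟙_ (FGModuleCat.{u} k))).X i) :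
    T.tensor.ε i (transfer S T i _ w) = S.tensor.ε i w := by
  induction w using S.elem_induction with
  | h0 => simp
  | h x ξ => rw [transfer_elem h, ε_elem, ε_elem, h]
  | hadd v w hv hw => simp only [_root_.map_add, hv, hw]

theorem shriek_ext_one {E : Type u} [CommRing E] [Algebra k E] {X : Type u} [AddCommGroup X]
    [Module k X] {f : E →ₐ[k] k} {ρ : E →ₐ[k] Module.End k X} {g h : shriek f ρ}
    (H : g.1 1 = h.1 1) : g = h :=
  Subtype.ext (LinearMap.ext_ring H)

variable {l : M.I}

/-- An element of φ^! τ(X) over k is its value at 1, and in both structures the inverse of a takes x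
to the generator of x and φ. -/
theorem transfer_a (h : ∀ i c, S.tauOne i c = T.tauOne i c) (φ : M.A l →ₐ[k₀] k)
    (hφ : M.point l φ = 1) (X : FGModuleCat.{u} k)
    (w : shriek (liftScalar φ) ((S.τ.obj X).ρ l)) :
    T.a.iso l φ hφ X (shriekCongr _ _ _ (((transferHom h).app X).app l)
      (((transferHom h).app X).linear l) w) = S.a.iso l φ hφ X w := by
  obtain ⟨x, rfl⟩ := (S.a.iso l φ hφ X).symm.surjective w
  rw [LinearEquiv.apply_symm_apply, ← LinearEquiv.eq_symm_apply]
  refine shriek_ext_one ?_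
  refine Eq.trans ?_ (T.shriekEval_a_symm φ hφ x).symm
  refine Eq.trans (congrArg (transfer S T l X) (S.shriekEval_a_symm φ hφ x)) ?_
  exact transfer_elem h x _

theorem transfer_b_elem {j : M.I} (h : ∀ i c, S.tauOne i c = T.tauOne i c)
    (φ : M.A l →ₐ[k₀] EEAlg k M i j) (hφ : M.point l φ = mulPoint k M i j)
    (X : FGModuleCat.{u} k) (v : (S.τ.obj X).X i) (ζ : Module.Dual k (EAlg k M j)) :
    T.b.iso i j l φ hφ X (T.elem j _ (transfer S T i X v) ζ) =
      shriekCongr _ _ _ (((transferHom h).app X).app l) (((transferHom h).app X).linear l)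
        (S.b.iso i j l φ hφ X (S.elem j _ v ζ)) := by
  induction v using S.elem_induction with
  | h0 => simp only [map_zero, elem_zero]
  | hadd v w hv hw => simp only [_root_.map_add, elem_add, hv, hw]
  | h x ξ =>
    refine shriek_ext fun y => ?_
    rw [transfer_elem h, T.b_elem]
    refine Eq.trans ?_ (congrArg (transfer S T l X) (S.b_elem φ hφ x ξ ζ y)).symm
    have hST : S.tauOneHom j = T.tauOneHom j := AlgHom.ext fun c => h j c
    rw [transfer_elem h, hST]

theorem transfer_b {j : M.I} (h : ∀ i c, S.tauOne i c = T.tauOne i c)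
    (φ : M.A l →ₐ[k₀] EEAlg k M i j) (hφ : M.point l φ = mulPoint k M i j)
    (X : FGModuleCat.{u} k) (w : (S.τ.obj ((S.τ.obj X).X i)).X j) :
    T.b.iso i j l φ hφ X (transfer S T j _ (tmapₗ S.τ j (transfer S T i X) w)) =
      shriekCongr _ _ _ (((transferHom h).app X).app l) (((transferHom h).app X).linear l)
        (S.b.iso i j l φ hφ X w) := by
  induction w using S.elem_induction with
  | h0 => simp only [map_zero]
  | hadd v w hv hw => simp only [_root_.map_add, hv, hw]
  | h v ζ =>
    refine Eq.trans ?_ (transfer_b_elem h φ hφ X v ζ)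
    refine congrArg (T.b.iso i j l φ hφ X) ?_
    refine (congrArg (transfer S T j _) (S.tmap_elem (i := j) (X := (S.τ.obj X).X i)
      (Y := (T.τ.obj X).X i) (FGModuleCat.ofHom (transfer S T i X)) v ζ)).trans ?_
    exact transfer_elem h _ ζ

/-- The morphism between structures with the same action. -/
def homOfTauOne (h : ∀ i c, S.tauOne i c = T.tauOne i c) : S ⟶ T where
  u := transferHom h
  tensor _ _ _ w := transfer_δ h w
  unit _ w := transfer_ε h w
  comm_a _ φ hφ X w := transfer_a h φ hφ X w
  comm_b _ _ _ φ hφ X w := transfer_b h φ hφ X w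

theorem homOfTauOne_comp (h : ∀ i c, S.tauOne i c = T.tauOne i c)
    (h' : ∀ i c, T.tauOne i c = S.tauOne i c) :
    homOfTauOne h ≫ homOfTauOne h' = 𝟙 S := by
  refine Hom.ext (NatTrans.ext (funext fun X => Plng.Hom.ext (funext fun i =>
    LinearMap.ext fun w => ?_)))
  change transfer T S i X (transfer S T i X w) = w
  induction w using S.elem_induction with
  | h0 => simp
  | h x ξ => rw [transfer_elem h, transfer_elem h']
  | hadd v w hv hw => simp only [_root_.map_add, hv, hw]

/-- Structures with the same action are isomorphic. -/
def isoOfTauOne (h : ∀ i c, S.tauOne i c = T.tauOne i c) : S ≅ T where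
  hom := homOfTauOne h
  inv := homOfTauOne fun i c => (h i c).symm
  hom_inv_id := homOfTauOne_comp h _
  inv_hom_id := homOfTauOne_comp _ h

/-- Compatibility with ε and E-linearity force u at 𝟙 to respect the identifications with E^∨.
Naturality for the endomorphism c of 𝟙 then equates the two actions of c. -/
theorem tauOne_eq_of_hom (f : S ⟶ T) (i : M.I) (c : k) : S.tauOne i c = T.tauOne i c := by
  refine eq_of_forall_dual fun ξ => ?_
  rw [apply_tauOne, apply_tauOne]
  have h₁ : (f.u.app (𝟙_ (FGModuleCat.{u} k))).app i ((S.tensor.unitIso i).symm ξ) =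
      (T.tensor.unitIso i).symm ξ := by
    refine T.unit_ext fun a => ?_
    rw [← (f.u.app (𝟙_ (FGModuleCat.{u} k))).linear, f.unit, unitIso_ρ_symm, unitIso_ρ_symm,
      ε_apply, ε_apply, LinearEquiv.apply_symm_apply, LinearEquiv.apply_symm_apply]
  have h₂ := congrArg (fun g : S.τ.obj _ ⟶ T.τ.obj _ =>
    Plng.Hom.app g i ((S.tensor.unitIso i).symm ξ))
    (f.u.naturality (c • 𝟙 (𝟙_ (FGModuleCat.{u} k))))
  rw [← h₁]
  refine Eq.trans ?_ (congrArg (T.tensor.ε i) h₂)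
  exact (f.unit i _).symm

end EStructure

theorem Action.tauOne_toEStructure (μ : Action M k) (i : M.I) (c : k) :
    μ.toEStructure.tauOne i c = μ.coaction i c := by
  refine EStructure.eq_of_forall_dual fun ξ => ?_
  rw [EStructure.apply_tauOne]
  change Induced.unitEquiv (μ.coactionMaps.map i) (Induced.map _ (c • LinearMap.id)
    (Induced.mk _ (1 : k) ξ)) 1 = _
  rw [Induced.map_mk, Induced.unitEquiv_apply, Induced.coord_mk]
  simp
  rfl

end ETensor

end

/-! ### The bijection between isomorphism classes and actions -/

theorem mainTheorem5 {k₀ k : Type u} [CommRing k₀] [Field k] [Algebra k₀ k]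
    (M : ETensor.FormalMonoid k₀) (hM : M.IsQuasiSeparable) :
    ∃ Φ : ETensor.EStructureClasses k M → ETensor.Action M k,
      (∀ (S : ETensor.EStructure k M) (i : M.I) (c : k),
        (Φ S.isoClass).coaction i c = S.tauOne i c) ∧
      Function.Bijective Φ ∧
      (∀ S : ETensor.EStructure k M, ETensor.IsInducedBy S (Φ S.isoClass)) := by
  refine ⟨Quotient.lift (fun S => S.toAction) fun S T ⟨e⟩ =>
    ETensor.Action.ext_coaction fun i => ?_, fun S i c => S.coaction_toAction i c, ⟨?_, ?_⟩,
    fun S => ETensor.EStructure.isInducedBy _ S.coaction_toAction⟩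
  · ext c
    rw [S.coaction_toAction, T.coaction_toAction, ETensor.EStructure.tauOne_eq_of_hom e.hom]
  · refine Quotient.ind₂ fun S T (h : S.toAction = T.toAction) => Quotient.sound ⟨?_⟩
    exact ETensor.EStructure.isoOfTauOne fun i c => by
      rw [← S.coaction_toAction, h, T.coaction_toAction]
  · intro μ
    refine ⟨μ.toEStructure.isoClass, ETensor.Action.ext_coaction fun i => AlgHom.ext fun c => ?_⟩
    exact (μ.toEStructure.coaction_toAction i c).trans (μ.tauOne_toEStructure i c)
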